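/- Let $(M^{n+1},g)$ be a closed (compact, connected, without boundary) smooth Riemannian manifold, and put $\mathfrak h=\tfrac12\operatorname{Vol}(M)$. Let $\mathcal C(M)$ be the set of Caccioppoli sets (measurable sets of finite perimeter) in $M$. Let $\mathcal B(M)$ be the space of mod $2$ boundaries $\partial\Omega$, $\Omega\in\mathcal C(M)$, where $\partial\Omega=\partial\Theta$ iff $\partial(\Omega\triangle\Theta)$ has zero mass; it carries the flat topology. $\operatorname{Area}(\partial\Omega)$ is the perimeter (mass). Let $\mathcal H(M)\subset\mathcal B(M)$ be the subspace of half-volume cycles: those $\partial\Omega$ with $\operatorname{Vol}(\Omega)=\mathfrak h$. The cohomology rings of $\mathcal B(M)$ and $\mathcal H(M)$ with coefficients in $\mathbb Z_2$ are $\mathbb Z_2[\lambda]$ with $\lambda$ of degree $1$. For a finite cubical complex $X$, a continuous map $\Phi\colon X\to\mathcal B(M)$ (respectively $\Phi\colon X\to\mathcal H(M)$) is a $p$-sweepout (respectively a half-volume $p$-sweepout) if $\Phi^*\lambda^p\ne0$ in $H^p(X,\mathbb Z_2)$. It has no concentration of mass if $\lim_{r\to0}\sup_{q\in M}\sup_{x\in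 X}\operatorname{Area}(\Phi(x)\llcorner B(q,r))=0$. Let $\omega_p$ (respectively $\tilde\omega_p$) be the infimum of $\sup_{x\in X}\operatorname{Area}(\Phi(x))$ over all $p$-sweepouts (respectively half-volume $p$-sweepouts) $\Phi$ with no concentration of mass; the infimum is taken in $[0,\infty]$. (1) There is a finite constant $K\ge 0$, depending only on $M$, such that $\tilde\omega_p\le\omega_p+K+1$ for all integers $p\ge1$. (2) Morse functions exist on $M$. Let $f\colon M\to\mathbb R$ be any Morse function and let $K_f=\sup_{c\in\mathbb R}\mathcal H^n(f^{-1}(c))$ be the maximal area of a level set of $f$. Then $K_f<\infty$, and $\tilde\omega_p\le\omega_p+K_f+1$ for all $p\ge1$. Moreover, there is a deformation retraction $\theta\colon\mathcal B(M)\times[0,1]\to\mathcal B(M)$ onto $\mathcal H(M)$, that is, a continuous map with $\theta(T,0)=T$ and $\theta(T,1)\in\mathcal H(M)$ for all $T\in\mathcal B(M)$ and with $\theta(T,t)=T$ for all $T\in\mathcal H(M)$ and $t\in[0,1]$, that has the following properties. (a) If $\Omega\in\mathcal C(M)$ satisfies $\operatorname{Vol}(\Omega)\le\mathfrak h$ and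 $t\in[0,1]$, then $\theta(\partial\Omega,t)=\partial(\Omega\cup B)$, where $B=\{f\le c\}$ is a sublevel set of $f$ with $\operatorname{Vol}(\Omega\cup B)=\operatorname{Vol}(\Omega)+t(\mathfrak h-\operatorname{Vol}(\Omega))$. (b) $\operatorname{Area}(\theta(T,t))\le\operatorname{Area}(T)+K_f$ for all $T\in\mathcal B(M)$ and $t\in[0,1]$. (c) If $p\ge1$ and $\Phi\colon X\to\mathcal B(M)$ is a $p$-sweepout with no concentration of mass, then $\Psi(x)=\theta(\Phi(x),1)$ defines a half-volume $p$-sweepout $\Psi\colon X\to\mathcal H(M)$ with no concentration of mass, and $\sup_{x\in X}\operatorname{Area}(\Psi(x))\le\sup_{x\in X}\operatorname{Area}(\Phi(x))+K_f$. -/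

import Mathlib

open Set Filter MeasureTheory Bundle Manifold
open scoped ContDiff ENNReal NNReal Topology symmDiff

noncomputable section

/-! ## Singular cohomology with coefficients in `ℤ/2` -/

namespace SingularCohomology

/-- Singular `k`-simplices of `X`. -/
abbrev Simplex (k : ℕ) (X : Type*) [TopologicalSpace X] : Type _ :=
  C(stdSimplex ℝ (Fin (k + 1)), X)

/-- Singular `k`-cochains of `X` with coefficients in `ℤ/2`. -/
abbrev Cochain (k : ℕ) (X : Type*) [TopologicalSpace X] : Type _ :=
  Simplex k X → ZMod 2

variable {X Y : Type*} [TopologicalSpace X] [TopologicalSpace Y]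

/-- The simplex obtained from `σ` by precomposing with the affine map of standard simplices which
is given by `s` on the vertices. -/
def Simplex.restrict {k l : ℕ} (s : Fin (k + 1) → Fin (l + 1)) (σ : Simplex l X) : Simplex k X :=
  σ.comp ⟨stdSimplex.map s, stdSimplex.continuous_map s⟩

/-- The coboundary operator (over `ℤ/2` no signs are needed). -/
def coboundary {k : ℕ} (c : Cochain k X) : Cochain (k + 1) X :=
  fun σ => ∑ i : Fin (k + 2), c (σ.restrict i.succAbove)

/-- A cochain whose coboundary vanishes. -/
def IsCocycle {k : ℕ} (c : Cochain k X) : Prop := coboundary c = 0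

/-- A cochain which is the coboundary of a cochain of degree one less. A `0`-cochain is a
coboundary only if it is `0`. For a cocycle, this says that its class in `H^k(X; ℤ/2)` is `0`. -/
def IsCoboundary : {k : ℕ} → Cochain k X → Prop
  | 0, c => c = 0
  | _ + 1, c => ∃ b, coboundary b = c

/-- The cup product of cochains: front face times back face. -/
def cup {p q : ℕ} (a : Cochain p X) (b : Cochain q X) : Cochain (p + q) X :=
  fun σ => a (σ.restrict (k := p) (l := p + q) (Fin.castLE (by omega))) *
    b (σ.restrict (k := q) (l := p + q) (Fin.natAdd p))

/-- The `k`-th cup power of a `1`-cochain; the `0`-th power is the unit cochain. -/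
def cupPow (a : Cochain 1 X) : (k : ℕ) → Cochain k X
  | 0 => fun _ => 1
  | k + 1 => cup (cupPow a k) a

/-- The pullback of a cochain by a continuous map. -/
def pullback {k : ℕ} (Φ : C(X, Y)) (c : Cochain k Y) : Cochain k X :=
  fun σ => c (Φ.comp σ)

/-- The cocycle `ℓ` represents a class `λ` in degree one such that the cohomology ring of `Y` with
coefficients in `ℤ/2` is the polynomial ring `ℤ/2[λ]`: for each `k`, the group `H^k(Y; ℤ/2)` is
`{0, λ^k}` with `λ^k ≠ 0`. -/
def IsPolynomialGenerator (ℓ : Cochain 1 Y) : Prop :=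
  IsCocycle ℓ ∧ ∀ k : ℕ, ¬ IsCoboundary (cupPow ℓ k) ∧
    ∀ c : Cochain k Y, IsCocycle c → IsCoboundary c ∨ IsCoboundary (c - cupPow ℓ k)

end SingularCohomology

open SingularCohomology in
/-- `Φ^* λ^p ≠ 0` in `H^p(X; ℤ/2)`, where `λ` is the generator in degree one of the cohomology ring
`H^*(Y; ℤ/2) = ℤ/2[λ]`. -/
def IsPSweepout {X Y : Type*} [TopologicalSpace X] [TopologicalSpace Y] (p : ℕ) (Φ : C(X, Y)) :
    Prop :=
  ∃ ℓ : Cochain 1 Y, IsPolynomialGenerator ℓ ∧ ¬ IsCoboundary (pullback Φ (cupPow ℓ p))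

/-! ## Cubical complexes -/

/-- The closed cell of the integer lattice in `ℝ^m` with lowest corner `a` and edges in the
directions `J`. -/
def cubicalCell {m : ℕ} (a : Fin m → ℤ) (J : Finset (Fin m)) : Set (Fin m → ℝ) :=
  {x | ∀ i, (i ∈ J → (a i : ℝ) ≤ x i ∧ x i ≤ a i + 1) ∧ (i ∉ J → x i = a i)}

/-- (The underlying space of) a finite cubical complex: a finite union of closed lattice cells. -/
def IsCubicalComplex {m : ℕ} (X : Set (Fin m → ℝ)) : Prop :=
  ∃ S : Finset ((Fin m → ℤ) × Finset (Fin m)), X = ⋃ c ∈ S, cubicalCell c.1 c.2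

/-! ## Caccioppoli sets and their boundaries in a Riemannian manifold of dimension `n + 1` -/

section Manifold

variable (n : ℕ) {M : Type*} [MetricSpace M] [MeasurableSpace M] [BorelSpace M]

/-- The Riemannian volume: the `(n+1)`-dimensional Hausdorff measure of the Riemannian distance,
normalized to be Lebesgue measure on Euclidean space. -/
abbrev riemVol : Measure M := μHE[n + 1]

variable [ChartedSpace (EuclideanSpace ℝ (Fin (n + 1))) M]

/-- A Morse function: smooth, with nondegenerate Hessian (computed in the chart at the point) at
each critical point. -/
def IsMorse (f : M → ℝ) : Prop :=
  ContMDiff (𝓡 (n + 1)) 𝓘(ℝ, ℝ) ∞ f ∧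
    ∀ x : M, mfderiv (𝓡 (n + 1)) 𝓘(ℝ, ℝ) f x = 0 →
      ∀ v : EuclideanSpace ℝ (Fin (n + 1)),
        (∀ w : EuclideanSpace ℝ (Fin (n + 1)),
          fderiv ℝ (fderiv ℝ (f ∘ (extChartAt (𝓡 (n + 1)) x).symm))
            (extChartAt (𝓡 (n + 1)) x x) v w = 0) → v = 0

/-- The continuous function `h` is the divergence of the vector field `X`: by the divergence
theorem, `∫ h φ = - ∫ dφ(X)` for all smooth functions `φ`. -/
def IsDivergence (X : ∀ x : M, TangentSpace (𝓡 (n + 1)) x) (h : M → ℝ) : Prop :=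
  Continuous h ∧ ∀ φ : M → ℝ, ContMDiff (𝓡 (n + 1)) 𝓘(ℝ, ℝ) ∞ φ →
    ∫ x, h x * φ x ∂(riemVol n) = - ∫ x, mfderiv (𝓡 (n + 1)) 𝓘(ℝ, ℝ) φ x (X x) ∂(riemVol n)

/-- The maximal (supremal) `n`-dimensional Hausdorff measure (area) of a level set of `f`. -/
def maxLevelArea (f : M → ℝ) : ℝ≥0∞ := ⨆ c : ℝ, (μHE[n] : Measure M) (f ⁻¹' {c})

variable [IsManifold (𝓡 (n + 1)) ∞ M]
  [RiemannianBundle (fun x : M => TangentSpace (𝓡 (n + 1)) x)]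

/-- The perimeter of `Ω` in the open set `U`: the supremum of `∫_Ω div X` over all smooth
vector fields `X` with support in `U` and `|X| ≤ 1`. -/
def perimeter (Ω U : Set M) : ℝ≥0∞ :=
  ⨆ (X : ∀ x : M, TangentSpace (𝓡 (n + 1)) x) (h : M → ℝ)
    (_ : ContMDiff (𝓡 (n + 1)) (𝓡 (n + 1)).tangent ∞
      (fun x => (⟨x, X x⟩ : TangentBundle (𝓡 (n + 1)) M)))
    (_ : closure {x | X x ≠ 0} ⊆ U) (_ : ∀ x, ‖X x‖ ≤ 1) (_ : IsDivergence n X h),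
    ENNReal.ofReal (∫ x in Ω, h x ∂(riemVol n))

variable (M)

/-- Caccioppoli sets: measurable sets of finite perimeter. -/
structure CaccioppoliSet where
  /-- The underlying set. -/
  carrier : Set M
  measurableSet : MeasurableSet carrier
  perimeter_lt_top : perimeter n carrier univ < ⊤

/-- The space of those mod 2 cycles of dimension `n` that are boundaries of Caccioppoli sets. Two
Caccioppoli sets have the same boundary mod 2 exactly if the boundary of their symmetric
difference (that is, of their sum mod 2) is zero, i.e. has zero mass. -/
def BoundaryCycle : Type _ :=
  Quot fun Ω Θ : CaccioppoliSet n M => perimeter n (Ω.carrier ∆ Θ.carrier) univ = 0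

variable {M} {n}

/-- The boundary of a Caccioppoli set. -/
def CaccioppoliSet.boundary (Ω : CaccioppoliSet n M) : BoundaryCycle n M := Quot.mk _ Ω

/-- The volume of a Caccioppoli set. -/
def CaccioppoliSet.vol (Ω : CaccioppoliSet n M) : ℝ≥0∞ := riemVol n Ω.carrier

variable (n M) in
/-- Half the volume of `M`. -/
def halfVol : ℝ≥0∞ := riemVol n (univ : Set M) / 2

namespace BoundaryCycle

/-- `T.areaIn U` is the area (mass) of `T` restricted to the open set `U`. It is the perimeter
in `U` of any `Ω` with `∂Ω = T`; as all these `Ω` give the same value, the infimum just selects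
it. -/
def areaIn (T : BoundaryCycle n M) (U : Set M) : ℝ≥0∞ :=
  ⨅ (Ω : CaccioppoliSet n M) (_ : Ω.boundary = T), perimeter n Ω.carrier U

/-- The area (mass) of `T`. -/
def area (T : BoundaryCycle n M) : ℝ≥0∞ := T.areaIn univ

/-- The flat distance: the infimum of `Area(P) + Vol(Q)` over `S - T = P + ∂Q`. If `S = ∂Ω` and
`T = ∂Θ` then, mod 2, `P = ∂(Ω ∆ Θ ∆ Q)`. -/
def flatDist (S T : BoundaryCycle n M) : ℝ≥0∞ :=
  ⨅ (Ω : CaccioppoliSet n M) (_ : Ω.boundary = S) (Θ : CaccioppoliSet n M) (_ : Θ.boundary = T)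
    (Q : CaccioppoliSet n M),
    perimeter n ((Ω.carrier ∆ Θ.carrier) ∆ Q.carrier) univ + Q.vol

/-- The flat topology, i.e. the topology of the flat distance. -/
instance : TopologicalSpace (BoundaryCycle n M) where
  IsOpen V := ∀ T ∈ V, ∃ ε : ℝ≥0∞, 0 < ε ∧ ∀ S, flatDist T S < ε → S ∈ V
  isOpen_univ := fun _ _ => ⟨1, one_pos, fun _ _ => mem_univ _⟩
  isOpen_inter := by
    intro V W hV hW T hT
    obtain ⟨ε, hε, h₁⟩ := hV T hT.1
    obtain ⟨δ, hδ, h₂⟩ := hW T hT.2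
    exact ⟨min ε δ, lt_min hε hδ, fun S hS =>
      ⟨h₁ S (hS.trans_le (min_le_left _ _)), h₂ S (hS.trans_le (min_le_right _ _))⟩⟩
  isOpen_sUnion := by
    intro s hs T hT
    obtain ⟨V, hV, hTV⟩ := hT
    obtain ⟨ε, hε, h⟩ := hs V hV T hTV
    exact ⟨ε, hε, fun S hS => ⟨V, hV, h S hS⟩⟩

end BoundaryCycle

variable (n M) in
/-- The half-volume cycles: boundaries of Caccioppoli sets of half the volume of `M`. It carries
the (subspace topology of the) flat topology. -/
def halfVolumeCycles : Set (BoundaryCycle n M) :=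
  {T | ∃ Ω : CaccioppoliSet n M, Ω.vol = halfVol n M ∧ Ω.boundary = T}

/-- No concentration of mass: the area in balls of radius `r` tends to `0` uniformly as
`r → 0`. -/
def NoConcentrationOfMass {X : Type*} (Φ : X → BoundaryCycle n M) : Prop :=
  Tendsto (fun r : ℝ => ⨆ (q : M) (x : X), (Φ x).areaIn (Metric.ball q r)) (𝓝[>] 0) (𝓝 0)

/-- `Φ` is a `p`-sweepout with no concentration of mass. -/
def IsAdmissibleSweepout {X : Type*} [TopologicalSpace X] (p : ℕ) (Φ : C(X, BoundaryCycle n M)) :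
    Prop :=
  IsPSweepout p Φ ∧ NoConcentrationOfMass Φ

/-- `Ψ` is a half-volume `p`-sweepout with no concentration of mass. -/
def IsAdmissibleHalfVolumeSweepout {X : Type*} [TopologicalSpace X] (p : ℕ)
    (Ψ : C(X, halfVolumeCycles n M)) : Prop :=
  IsPSweepout p Ψ ∧ NoConcentrationOfMass fun x => (Ψ x : BoundaryCycle n M)

variable (n M) in
/-- The `p`-width `ω_p` of `M`. -/
def pWidth (p : ℕ) : ℝ≥0∞ :=
  ⨅ (m : ℕ) (X : Set (Fin m → ℝ)) (_ : IsCubicalComplex X) (Φ : C(X, BoundaryCycle n M))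
    (_ : IsAdmissibleSweepout p Φ), ⨆ x : X, (Φ x).area

variable (n M) in
/-- The half-volume `p`-width of `M`. -/
def halfVolumePWidth (p : ℕ) : ℝ≥0∞ :=
  ⨅ (m : ℕ) (X : Set (Fin m → ℝ)) (_ : IsCubicalComplex X) (Ψ : C(X, halfVolumeCycles n M))
    (_ : IsAdmissibleHalfVolumeSweepout p Ψ), ⨆ x : X, (Ψ x : BoundaryCycle n M).area

/-- `θ` is the deformation retraction of the space of boundaries onto the half-volume cycles that
is constructed from `f`: if `Vol(Ω) ≤ 𝔥` then `θ(∂Ω, t) = ∂(Ω ∪ B)` for a sublevel set `B` of `f`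
with `Vol(Ω ∪ B) = Vol(Ω) + t (𝔥 - Vol(Ω))`. (Every element of `BoundaryCycle n M` is `∂Ω` for
such an `Ω`, as `∂Ω = ∂(M \ Ω)`, so this formula determines `θ`.) -/
structure IsHalfVolumeRetraction (f : M → ℝ)
    (θ : C(BoundaryCycle n M × unitInterval, BoundaryCycle n M)) : Prop where
  map_zero : ∀ T, θ (T, 0) = T
  map_one_mem : ∀ T, θ (T, 1) ∈ halfVolumeCycles n M
  map_of_mem : ∀ T ∈ halfVolumeCycles n M, ∀ t, θ (T, t) = T
  map_boundary : ∀ Ω : CaccioppoliSet n M, Ω.vol ≤ halfVol n M → ∀ t : unitInterval,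
    ∃ (c : ℝ) (Ω' : CaccioppoliSet n M), Ω'.carrier = Ω.carrier ∪ {x | f x ≤ c} ∧
      Ω'.vol = Ω.vol + ENNReal.ofReal t * (halfVol n M - Ω.vol) ∧
      θ (Ω.boundary, t) = Ω'.boundary

end Manifold

end

/-!
Fix a Morse function `f`. A set `Ω` with `Vol Ω ≤ 𝔥` is enlarged by sublevel sets of `f`. The level
sets of `f` are null sets (`IsMorse.riemVol_level`), so that the volume of `Ω ∪ {f ≤ c}` depends
continuously on `c` and takes each value between `Vol Ω` and `Vol M`
(`IsMorse.exists_volume_union_sublevel_eq`). At the time `t`, the retraction adds the sublevel set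
which covers the fraction `t` of the volume that `Ω` lacks to `𝔥`.

* **Well-definedness and continuity.** On `𝓑(M)` the flat topology is the topology of the distance
  `min (Vol (Ω ∆ Θ), Vol (M \ (Ω ∆ Θ)))` (`BoundaryCycle.mem_nhds_iff`). This rests on the fact that
  on a connected closed manifold a set of small perimeter has small volume, or its complement has
  (`isIsoperimetric_univ`), and on the fact that sets of finite perimeter are closed under symmetric
  differences (`perimeter_symmDiff_ne_top`). As sublevel sets are nested, the retraction is
  Lipschitz for this distance (`volDist_union_sublevel_le`), which also shows that no choice
  matters.
* **Area.** `Area (∂(Ω ∪ {f ≤ c}) ⌞ U)` exceeds `Area (∂Ω ⌞ U)` by at most the largest area in `U`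
  of a level set of `f` (`perimeter_union_sublevel_le`). The sublevel set is replaced by a steep
  smooth function of `f`, and the additional term is estimated by the coarea inequality
  (`lintegral_mfderiv_le_lintegral_level`).
* **Level sets.** Near each point the level sets of a Morse function are covered by boundedly many
  Lipschitz graphs (`exists_nhds_level_graphs`); near a nondegenerate critical point these graphs
  live in cones. Hence their area in a ball of radius `r` is at most `C r ^ n`
  (`IsMorse.exists_measure_level_le`). So `K_f` is finite, and for `n ≥ 1` no mass is concentrated.
* **Sweepouts.** A deformation retraction is a homotopy equivalence, so that composing with its
  final map turns sweepouts into half-volume sweepouts (`IsPSweepout.comp_retraction`), by the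
  homotopy invariance of singular cohomology. For `n = 0`, level sets are finite sets and do
  concentrate mass; but then a family without concentration of mass consists of zero cycles
  (`perimeter_eq_zero_of_dim_one`), so that it is constant and not a `p`-sweepout for `p ≥ 1`.
* **Morse functions** exist since a generic small linear perturbation, made in one chart after the
  other, removes all degenerate critical points, by Sard's theorem (`exists_isMorse`).

All computations with the volume and the perimeter are made in charts, where the Hausdorff measure
of the Riemannian distance has the density `√(det g)` (`riemVol_restrict_chart`) and where
translations detect the perimeter (`exists_volume_shift_le_perimeter`,
`perimeter_ne_top_of_hasShiftBound`).
-/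

noncomputable section

set_option linter.unusedSectionVars false

/-- The topology of the tangent bundle. As a local instance of high priority it spares the long
search for this instance in each statement about smooth bundle metrics. -/
abbrev tangentBundleTopology (n : ℕ) (M : Type*) [TopologicalSpace M]
    [ChartedSpace (EuclideanSpace ℝ (Fin (n + 1))) M] [IsManifold (𝓡 (n + 1)) ∞ M] :
    TopologicalSpace (TotalSpace (EuclideanSpace ℝ (Fin (n + 1)))
      (fun x : M => TangentSpace (𝓡 (n + 1)) x)) :=
  inferInstance

attribute [local instance 5000] tangentBundleTopology

/-! ### Homotopy invariance of singular cohomology mod 2 -/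

namespace SingularCohomology

variable {X Y Z : Type*} [TopologicalSpace X] [TopologicalSpace Y] [TopologicalSpace Z]

lemma Simplex.restrict_restrict {k l m : ℕ} (s : Fin (k + 1) → Fin (l + 1))
    (t : Fin (l + 1) → Fin (m + 1)) (σ : Simplex m X) :
    (σ.restrict t).restrict s = σ.restrict (t ∘ s) := by
  ext x
  simp only [Simplex.restrict, ContinuousMap.comp_apply, ContinuousMap.coe_mk]
  rw [← stdSimplex.map_comp_apply]

lemma Simplex.restrict_id {k : ℕ} (σ : Simplex k X) : σ.restrict id = σ := by
  ext x
  simp [Simplex.restrict]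

lemma coboundary_pullback {k : ℕ} (Φ : C(X, Y)) (c : Cochain k Y) :
    coboundary (pullback Φ c) = pullback Φ (coboundary c) := rfl

lemma pullback_cup {p q : ℕ} (Φ : C(X, Y)) (a : Cochain p Y) (b : Cochain q Y) :
    pullback Φ (cup a b) = cup (pullback Φ a) (pullback Φ b) := rfl

lemma pullback_cupPow (Φ : C(X, Y)) (a : Cochain 1 Y) (k : ℕ) :
    pullback Φ (cupPow a k) = cupPow (pullback Φ a) k := by
  induction k with
  | zero => rfl
  | succ k ih => rw [cupPow, cupPow, pullback_cup, ih]

lemma pullback_sub {k : ℕ} (Φ : C(X, Y)) (c d : Cochain k Y) :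
    pullback Φ (c - d) = pullback Φ c - pullback Φ d := rfl

lemma coboundary_sub {k : ℕ} (c d : Cochain k X) :
    coboundary (c - d) = coboundary c - coboundary d := by
  ext σ
  simp [coboundary, Finset.sum_sub_distrib]

lemma IsCocycle.pullback {k : ℕ} (Φ : C(X, Y)) {c : Cochain k Y} (hc : IsCocycle c) :
    IsCocycle (pullback Φ c) := by
  rw [IsCocycle, coboundary_pullback, hc]
  rfl

lemma IsCoboundary.pullback {k : ℕ} (Φ : C(X, Y)) {c : Cochain k Y} (hc : IsCoboundary c) :
    IsCoboundary (pullback Φ c) := by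
  cases k with
  | zero =>
    have : c = 0 := hc
    subst this
    rfl
  | succ k =>
    obtain ⟨b, rfl⟩ := hc
    exact ⟨SingularCohomology.pullback Φ b, coboundary_pullback Φ b⟩

lemma IsCoboundary.sub {k : ℕ} {c d : Cochain k X} (hc : IsCoboundary c) (hd : IsCoboundary d) :
    IsCoboundary (c - d) := by
  cases k with
  | zero =>
    have h1 : c = 0 := hc
    have h2 : d = 0 := hd
    rw [h1, h2, sub_zero]
    rfl
  | succ k =>
    obtain ⟨a, rfl⟩ := hc
    obtain ⟨b, rfl⟩ := hd
    exact ⟨a - b, coboundary_sub a b⟩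

lemma isCoboundary_zero {k : ℕ} : IsCoboundary (0 : Cochain k X) := by
  cases k with
  | zero => rfl
  | succ k => exact ⟨0, by ext; simp [coboundary]⟩

/-- The cup product of a cocycle with a cocycle of degree one is a cocycle. -/
lemma IsCocycle.cup {p : ℕ} {a : Cochain p X} {b : Cochain 1 X} (ha : IsCocycle a)
    (hb : IsCocycle b) : IsCocycle (cup a b) := by
  funext σ
  -- The faces of `σ` that miss one of the last two vertices keep the front face of degree `p`;
  -- the other ones keep the back face of degree `1`.
  have hA := congrFun ha (σ.restrict (k := p + 1) (Fin.castLE (by omega)))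
  have hB := congrFun hb (σ.restrict (k := 2) (Fin.natAdd p))
  simp only [coboundary, Simplex.restrict_restrict, Pi.zero_apply] at hA hB
  rw [Fin.sum_univ_castSucc] at hA
  rw [Fin.sum_univ_three] at hB
  simp only [coboundary, SingularCohomology.cup, Simplex.restrict_restrict, Pi.zero_apply]
  rw [Fin.sum_univ_castSucc, Fin.sum_univ_castSucc]
  have e1 : ∀ i : Fin (p + 1), ((i.castSucc.castSucc : Fin (p + 1 + 1 + 1)).succAbove ∘
      (Fin.natAdd p : Fin (1 + 1) → Fin (p + 1 + 1))) =
      (Fin.natAdd p : Fin (2 + 1) → Fin (p + 1 + 1 + 1)) ∘ (0 : Fin 3).succAbove := fun i => by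
    ext x
    simp only [Function.comp_apply, Fin.succAbove, Fin.lt_def]
    split_ifs <;> simp_all <;> omega
  have e2 : ∀ i : Fin (p + 1), ((i.castSucc.castSucc : Fin (p + 1 + 1 + 1)).succAbove ∘
      (Fin.castLE (by omega) : Fin (p + 1) → Fin (p + 1 + 1))) =
      (Fin.castLE (by omega) : Fin (p + 1 + 1) → Fin (p + 1 + 1 + 1)) ∘
        (i.castSucc : Fin (p + 1 + 1)).succAbove := fun i => by
    ext x
    simp only [Function.comp_apply, Fin.succAbove, Fin.lt_def]
    split_ifs <;> simp_all; omega
  have e3 : ((Fin.last (p + 1)).castSucc : Fin (p + 1 + 1 + 1)).succAbove ∘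
      (Fin.castLE (by omega) : Fin (p + 1) → Fin (p + 1 + 1)) =
      (Fin.castLE (by omega) : Fin (p + 1 + 1) → Fin (p + 1 + 1 + 1)) ∘
        (Fin.last (p + 1)).succAbove := by
    ext x
    simp only [Function.comp_apply, Fin.succAbove, Fin.lt_def]
    split_ifs <;> simp_all; omega
  have e4 : (Fin.last (p + 1 + 1) : Fin (p + 1 + 1 + 1)).succAbove ∘
      (Fin.castLE (by omega) : Fin (p + 1) → Fin (p + 1 + 1)) =
      (Fin.castLE (by omega) : Fin (p + 1 + 1) → Fin (p + 1 + 1 + 1)) ∘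
        (Fin.last (p + 1)).succAbove := by
    ext x
    simp only [Function.comp_apply, Fin.succAbove, Fin.lt_def]
    split_ifs <;> simp_all; omega
  have e5 : ((Fin.last (p + 1)).castSucc : Fin (p + 1 + 1 + 1)).succAbove ∘
      (Fin.natAdd p : Fin (1 + 1) → Fin (p + 1 + 1)) =
      (Fin.natAdd p : Fin (2 + 1) → Fin (p + 1 + 1 + 1)) ∘ (1 : Fin 3).succAbove := by
    ext x
    fin_cases x <;> simp [Fin.succAbove, Fin.lt_def]
  have e6 : (Fin.last (p + 1 + 1) : Fin (p + 1 + 1 + 1)).succAbove ∘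
      (Fin.natAdd p : Fin (1 + 1) → Fin (p + 1 + 1)) =
      (Fin.natAdd p : Fin (2 + 1) → Fin (p + 1 + 1 + 1)) ∘ (2 : Fin 3).succAbove := by
    ext x
    fin_cases x <;> simp [Fin.succAbove, Fin.lt_def]
  simp only [e1, e2, e3, e4, e5, e6, ← Finset.sum_mul]
  have h2 : ∀ u v w x y : ZMod 2, u + v = 0 → w + x + y = 0 → u * w + v * x + v * y = 0 := by
    decide
  exact h2 _ _ _ _ _ hA hB

lemma IsCocycle.cupPow {a : Cochain 1 X} (ha : IsCocycle a) (k : ℕ) : IsCocycle (cupPow a k) := by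
  induction k with
  | zero =>
    funext σ
    show ∑ i : Fin 2, (1 : ZMod 2) = 0
    decide
  | succ k ih => exact ih.cup ha

/-- The affine simplex in the unit interval whose vertices with number less than `a` are at `0`
and the other ones at `1`. -/
def intervalSimplex (l a : ℕ) : Simplex l unitInterval where
  toFun t := ⟨∑ x : Fin (l + 1), if a ≤ x then t x else 0, by
    constructor
    · exact Finset.sum_nonneg fun x _ => by split_ifs; exacts [t.2.1 x, le_rfl]
    · rw [← t.2.2]
      exact Finset.sum_le_sum fun x _ => by split_ifs; exacts [le_rfl, t.2.1 x]⟩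
  continuous_toFun := by
    refine Continuous.subtype_mk (continuous_finsetSum _ fun x _ => ?_) _
    split_ifs
    · exact (continuous_apply x).comp continuous_subtype_val
    · exact continuous_const

lemma restrict_intervalSimplex {k l a b : ℕ} (s : Fin (k + 1) → Fin (l + 1))
    (h : ∀ x, a ≤ (s x : ℕ) ↔ b ≤ (x : ℕ)) :
    (intervalSimplex l a).restrict s = intervalSimplex k b := by
  ext t
  show (∑ x : Fin (l + 1), if a ≤ (x : ℕ) then (stdSimplex.map s t) x else 0) =
    ∑ x : Fin (k + 1), if b ≤ (x : ℕ) then t x else 0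
  simp only [stdSimplex.map_coe, FunOnFinite.linearMap_apply_apply, ← h]
  rw [← Finset.sum_fiberwise Finset.univ s fun y => if a ≤ (s y : ℕ) then t y else 0]
  refine Finset.sum_congr rfl fun x _ => ?_
  split_ifs with h1
  · exact Finset.sum_congr rfl fun y hy => by rw [(Finset.mem_filter.1 hy).2, if_pos h1]
  · exact (Finset.sum_eq_zero fun y hy => by rw [(Finset.mem_filter.1 hy).2, if_neg h1]).symm

/-- The simplex in `Y` which is the image under the homotopy `H` of the simplex `σ` in `X`, moved
along the affine simplex number `a` of the interval. -/
def sweep (H : C(X × unitInterval, Y)) {k : ℕ} (σ : Simplex k X) (a : ℕ) : Simplex k Y :=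
  H.comp (σ.prodMk (intervalSimplex k a))

lemma sweep_restrict (H : C(X × unitInterval, Y)) {k l a b : ℕ} (σ : Simplex l X)
    (s : Fin (k + 1) → Fin (l + 1)) (h : ∀ x, a ≤ (s x : ℕ) ↔ b ≤ (x : ℕ)) :
    (sweep H σ a).restrict s = sweep H (σ.restrict s) b := by
  rw [sweep, sweep, ← restrict_intervalSimplex s h]
  rfl

lemma sweep_zero (H : C(X × unitInterval, Y)) {k : ℕ} (σ : Simplex k X) :
    sweep H σ 0 = (H.comp ((ContinuousMap.id X).prodMk (.const X 1))).comp σ := by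
  ext t
  refine congrArg H (Prod.ext rfl (Subtype.ext ?_))
  show (∑ x : Fin (k + 1), if 0 ≤ (x : ℕ) then t x else 0) = 1
  simp only [zero_le, if_true]
  exact t.2.2

lemma sweep_last (H : C(X × unitInterval, Y)) {k : ℕ} (σ : Simplex k X) :
    sweep H σ (k + 1) = (H.comp ((ContinuousMap.id X).prodMk (.const X 0))).comp σ := by
  ext t
  refine congrArg H (Prod.ext rfl (Subtype.ext ?_))
  show (∑ x : Fin (k + 1), if k + 1 ≤ (x : ℕ) then t x else 0) = 0
  exact Finset.sum_eq_zero fun x _ => if_neg (by have := x.2; omega)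

/-- The prism operator of a homotopy. -/
def prism (H : C(X × unitInterval, Y)) {k : ℕ} (c : Cochain (k + 1) Y) : Cochain k X :=
  fun σ => ∑ i : Fin (k + 1), c (sweep H (σ.restrict (k := k + 1) i.predAbove) (i + 1))

lemma sum_add_succ_zmod_two (g : ℕ → ZMod 2) (k : ℕ) :
    ∑ i : Fin k, (g i + g (i + 1)) = g 0 + g k := by
  induction k with
  | zero => simpa using (CharTwo.add_self_eq_zero (g 0)).symm
  | succ k ih =>
    rw [Fin.sum_univ_castSucc]
    simp only [Fin.val_castSucc, Fin.val_last, ih]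
    have : ∀ a b c : ZMod 2, a + b + (b + c) = a + c := by decide
    exact this _ _ _

/-- The two faces of each prism that contain a whole copy of the simplex cancel in pairs, except
for the bottom and the top. -/
lemma prism_coboundary_eq (H : C(X × unitInterval, Y)) {k : ℕ} (c : Cochain k Y)
    (σ : Simplex k X) :
    prism H (coboundary c) σ = c (sweep H σ 0) + c (sweep H σ (k + 1)) +
      ∑ i : Fin (k + 1), ∑ m : Fin k, c ((sweep H (σ.restrict (k := k + 1) i.predAbove)
        (i + 1)).restrict (i.castSucc.succAbove (i.succAbove m)).succAbove) := by
  rw [← sum_add_succ_zmod_two (fun a => c (sweep H σ a)), ← Finset.sum_add_distrib]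
  refine Finset.sum_congr rfl fun i _ => ?_
  rw [coboundary, Fin.sum_univ_succAbove _ i.castSucc, Fin.sum_univ_succAbove _ i, ← add_assoc]
  congr 2
  · congr 1
    rw [sweep_restrict (b := i), Simplex.restrict_restrict]
    · congr 1
      convert Simplex.restrict_id σ
      ext x
      simp only [Function.comp_apply, id]
      rw [Fin.predAbove_succAbove]
    · intro x
      simp only [Fin.succAbove, Fin.lt_def]
      split_ifs <;> simp_all; omega
  · congr 1
    rw [sweep_restrict (b := i + 1), Simplex.restrict_restrict]
    · congr 1
      convert Simplex.restrict_id σ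
      ext x
      simp only [Function.comp_apply, id, Fin.succAbove, Fin.predAbove, Fin.lt_def,
        Fin.val_castSucc, apply_dite Fin.val, Fin.val_pred, Fin.coe_castPred, dite_eq_ite,
        apply_ite Fin.val, Fin.val_succ]
      split_ifs <;> lia
    · intro x
      simp only [Fin.succAbove, Fin.lt_def]
      split_ifs <;> simp_all; omega

/-- The faces of the prisms over a simplex that do not contain a whole copy of it are the prisms
over its faces. -/
lemma coboundary_prism (H : C(X × unitInterval, Y)) {k : ℕ} (c : Cochain (k + 1) Y)
    (σ : Simplex (k + 1) X) :
    coboundary (prism H c) σ =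
      ∑ i : Fin (k + 2), ∑ m : Fin (k + 1), c ((sweep H (σ.restrict (k := k + 2) i.predAbove)
        (i + 1)).restrict (i.castSucc.succAbove (i.succAbove m)).succAbove) := by
  simp only [coboundary, prism]
  rw [← Fintype.sum_prod_type', ← Fintype.sum_prod_type']
  -- The pairs of a face and a prism over it correspond to the pairs of a prism and one of its
  -- remaining faces, by an involution.
  have hinv : ∀ q : Fin (k + 2) × Fin (k + 1),
      ((q.1.succAbove q.2).succAbove (q.2.predAbove q.1),
        (q.2.predAbove q.1).predAbove (q.1.succAbove q.2)) = q := fun q =>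
    Prod.ext (Fin.succAbove_succAbove_predAbove _ _) (Fin.predAbove_predAbove_succAbove _ _)
  refine Finset.sum_bij' (fun q _ => (q.1.succAbove q.2, q.2.predAbove q.1))
    (fun q _ => (q.1.succAbove q.2, q.2.predAbove q.1)) (fun _ _ => Finset.mem_univ _)
    (fun _ _ => Finset.mem_univ _) (fun q _ => hinv q) (fun q _ => hinv q) ?_
  rintro ⟨j, i⟩ -
  have h1 := hinv (j, i)
  simp only [Prod.mk.injEq] at h1
  simp only [h1.1]
  congr 1
  rw [sweep_restrict (b := i + 1), Simplex.restrict_restrict, Simplex.restrict_restrict]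
  · congr 2
    ext x
    simp only [Function.comp_apply, Fin.succAbove, Fin.predAbove, Fin.lt_def, Fin.val_castSucc,
      apply_dite Fin.val, Fin.val_pred, Fin.coe_castPred, dite_eq_ite, apply_ite Fin.val,
        Fin.val_succ]
    split_ifs <;> lia
  · intro x
    simp only [Fin.succAbove, Fin.lt_def, Fin.val_castSucc, apply_ite Fin.val, Fin.val_succ]
    split_ifs <;> lia

/-- Homotopic maps pull back a cocycle to cohomologous cocycles. -/
lemma IsCocycle.isCoboundary_pullback_sub {f g : C(X, Y)} (h : f.Homotopic g) {k : ℕ}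
    {c : Cochain k Y} (hc : IsCocycle c) :
    IsCoboundary (SingularCohomology.pullback f c - SingularCohomology.pullback g c) := by
  obtain ⟨F⟩ := h
  let H : C(X × unitInterval, Y) := F.toContinuousMap.comp .prodSwap
  have hf : H.comp ((ContinuousMap.id X).prodMk (.const X 0)) = f := by
    ext x; exact F.apply_zero x
  have hg : H.comp ((ContinuousMap.id X).prodMk (.const X 1)) = g := by
    ext x; exact F.apply_one x
  -- As `c` is a cocycle, the prism formula expresses the difference of the pullbacks at the two
  -- ends by the coboundary of the prism of `c`.
  have h0 : ∀ σ : Simplex k X, prism H (coboundary c) σ = 0 := fun σ => by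
    rw [hc]
    exact Finset.sum_eq_zero fun _ _ => rfl
  have h2 : ∀ u v w : ZMod 2, u + v + w = 0 → w = v - u := by decide
  cases k with
  | zero =>
    show SingularCohomology.pullback f c - SingularCohomology.pullback g c = 0
    funext σ
    have := h0 σ
    rw [prism_coboundary_eq, sweep_zero, sweep_last, hf, hg] at this
    simp only [Finset.univ_eq_empty, Finset.sum_empty, Finset.sum_const_zero] at this
    exact (h2 _ _ _ this).symm
  | succ k =>
    refine ⟨prism H c, ?_⟩
    funext σ
    have := h0 σ
    rw [prism_coboundary_eq, sweep_zero, sweep_last, hf, hg] at this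
    rw [coboundary_prism]
    exact h2 _ _ _ this

/-- A homotopy equivalence pulls back a polynomial generator to a polynomial generator; only the
case of a deformation retraction is stated. -/
lemma IsPolynomialGenerator.pullback {ℓ : Cochain 1 Y} (hℓ : IsPolynomialGenerator ℓ)
    (ι : C(X, Y)) (r : C(Y, X)) (h1 : r.comp ι = ContinuousMap.id X)
    (h2 : (ι.comp r).Homotopic (ContinuousMap.id Y)) :
    IsPolynomialGenerator (SingularCohomology.pullback ι ℓ) := by
  have h3 : ∀ k, IsCoboundary (SingularCohomology.pullback (ι.comp r) (cupPow ℓ k) -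
      cupPow ℓ k) := fun k => (hℓ.1.cupPow k).isCoboundary_pullback_sub h2
  refine ⟨hℓ.1.pullback ι, fun k => ⟨fun h => ?_, fun c hc => ?_⟩⟩
  · rw [← pullback_cupPow] at h
    have := (h.pullback r).sub (h3 k)
    refine (hℓ.2 k).1 ?_
    convert this
    exact (sub_sub_cancel _ _).symm
  · have h4 : SingularCohomology.pullback ι (SingularCohomology.pullback r c) = c := by
      have : SingularCohomology.pullback (r.comp ι) c = c := by rw [h1]; rfl
      exact this
    rcases (hℓ.2 k).2 _ (hc.pullback r) with h | h
    · left
      rw [← h4]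
      exact h.pullback ι
    · right
      rw [← pullback_cupPow, ← h4, ← pullback_sub]
      exact h.pullback ι

end SingularCohomology

open SingularCohomology

/-- Composition with a deformation retraction preserves sweepouts. -/
lemma IsPSweepout.comp_retraction {X Y Z : Type*} [TopologicalSpace X] [TopologicalSpace Y]
    [TopologicalSpace Z] {p : ℕ} {Φ : C(X, Y)} (hΦ : IsPSweepout p Φ) (ι : C(Z, Y)) (r : C(Y, Z))
    (h1 : r.comp ι = ContinuousMap.id Z) (h2 : (ι.comp r).Homotopic (ContinuousMap.id Y)) :
    IsPSweepout p (r.comp Φ) := by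
  obtain ⟨ℓ, hℓ, hp⟩ := hΦ
  refine ⟨pullback ι ℓ, hℓ.pullback ι r h1 h2, fun h => hp ?_⟩
  rw [← pullback_cupPow] at h
  have := h.sub (((hℓ.1.cupPow p).isCoboundary_pullback_sub h2).pullback Φ)
  convert this
  exact (sub_sub_cancel _ _).symm

/-- A constant map is not a sweepout. -/
lemma not_isPSweepout_of_constant {X Y : Type*} [TopologicalSpace X] [TopologicalSpace Y] {p : ℕ}
    (hp : 1 ≤ p) {Φ : C(X, Y)} (h : ∀ x y, Φ x = Φ y) : ¬ IsPSweepout p Φ := by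
  rintro ⟨ℓ, hℓ, h1⟩
  refine h1 ?_
  -- `ℓ` vanishes on a constant path, as this path is a face of a constant triangle, whose three
  -- faces are equal.
  have h2 : pullback Φ ℓ = 0 := by
    funext σ
    have h3 := congrFun hℓ.1 (ContinuousMap.const _ (Φ (σ (stdSimplex.vertex 0))))
    simp only [coboundary, Pi.zero_apply] at h3
    rw [Finset.sum_congr rfl (g := fun _ => ℓ (Φ.comp σ)), Finset.sum_const, Finset.card_univ,
      Fintype.card_fin] at h3
    · have h4 : ∀ a : ZMod 2, (1 + 2) • a = 0 → a = 0 := by decide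
      exact h4 _ h3
    · intro i _
      congr 1
      ext t
      exact h _ _
  obtain ⟨k, rfl⟩ := Nat.exists_eq_add_of_le' hp
  rw [pullback_cupPow, h2, cupPow]
  convert isCoboundary_zero
  funext σ
  exact mul_zero _

/-! ### The Riemannian distance in charts -/

section Riemannian

variable {n : ℕ} {M : Type*} [MetricSpace M]
    [ChartedSpace (EuclideanSpace ℝ (Fin (n + 1))) M] [IsManifold (𝓡 (n + 1)) ∞ M]
    [RiemannianBundle (fun x : M => TangentSpace (𝓡 (n + 1)) x)]
    [IsContMDiffRiemannianBundle (𝓡 (n + 1)) ∞ (EuclideanSpace ℝ (Fin (n + 1)))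
      (fun x : M => TangentSpace (𝓡 (n + 1)) x)]

local notation "𝔼" => EuclideanSpace ℝ (Fin (n + 1))
local notation "𝕀" => 𝓡 (n + 1)

instance isContinuousRiemannianBundle_of_smooth : IsContinuousRiemannianBundle
    (EuclideanSpace ℝ (Fin (n + 1))) (fun x : M => TangentSpace (𝓡 (n + 1)) x) := by
  obtain ⟨g, hg, h⟩ := IsContMDiffRiemannianBundle.exists_contMDiff (IB := 𝓡 (n + 1)) (n := ∞)
    (F := EuclideanSpace ℝ (Fin (n + 1))) (E := fun x : M => TangentSpace (𝓡 (n + 1)) x)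
  exact ⟨g, hg.continuous, h⟩

instance (x : M) : FiniteDimensional ℝ (TangentSpace (𝓡 (n + 1)) x) :=
  inferInstanceAs (FiniteDimensional ℝ (EuclideanSpace ℝ (Fin (n + 1))))

lemma finrank_tangentSpace (x : M) : Module.finrank ℝ (TangentSpace (𝓡 (n + 1)) x) = n + 1 :=
  finrank_euclideanSpace_fin (𝕜 := ℝ) (n := n + 1)

/-- An isometry of a tangent space with the Euclidean model space. -/
def tangentIsometry (x : M) : TangentSpace (𝓡 (n + 1)) x ≃ₗᵢ[ℝ] EuclideanSpace ℝ (Fin (n + 1)) :=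
  ((stdOrthonormalBasis ℝ (TangentSpace (𝓡 (n + 1)) x)).reindex
    (finCongr (finrank_tangentSpace x))).repr

/-- The coordinate frame of the preferred chart at `x₀`, as a map to the tangent space at `x`. -/
abbrev frameMap (x₀ x : M) : EuclideanSpace ℝ (Fin (n + 1)) →L[ℝ] TangentSpace (𝓡 (n + 1)) x :=
  (trivializationAt (EuclideanSpace ℝ (Fin (n + 1))) (TangentSpace (𝓡 (n + 1))) x₀).symmL ℝ x

/-- The components of tangent vectors at `x` in the preferred chart at `x₀`. -/
abbrev coordMap (x₀ x : M) : TangentSpace (𝓡 (n + 1)) x →L[ℝ] EuclideanSpace ℝ (Fin (n + 1)) :=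
  (trivializationAt (EuclideanSpace ℝ (Fin (n + 1)))
    (TangentSpace (𝓡 (n + 1))) x₀).continuousLinearMapAt ℝ x

lemma coordMap_frameMap {x₀ x : M} (hx : x ∈ (chartAt 𝔼 x₀).source) (v : 𝔼) :
    coordMap x₀ x (frameMap x₀ x v) = v := by
  simp only [Trivialization.continuousLinearMapAt_apply]
  exact Trivialization.linearMapAt_symmₗ _ (by simpa using hx) v

lemma frameMap_coordMap {x₀ x : M} (hx : x ∈ (chartAt 𝔼 x₀).source) (v : TangentSpace 𝕀 x) :
    frameMap x₀ x (coordMap x₀ x v) = v := by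
  simp only [Trivialization.continuousLinearMapAt_apply]
  exact Trivialization.symmₗ_linearMapAt _ (by simpa using hx) v

lemma frameMap_symm_eq {x₀ : M} {z : 𝔼} (hz : z ∈ (extChartAt 𝕀 x₀).target) :
    (frameMap x₀ ((extChartAt 𝕀 x₀).symm z) : 𝔼 →L[ℝ] 𝔼) =
      mfderivWithin 𝓘(ℝ, 𝔼) 𝕀 (extChartAt 𝕀 x₀).symm (range 𝕀) z := by
  have hx : (extChartAt 𝕀 x₀).symm z ∈ (chartAt 𝔼 x₀).source := by
    rw [← extChartAt_source 𝕀]; exact (extChartAt 𝕀 x₀).map_target hz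
  have := TangentBundle.symmL_trivializationAt (𝕜 := ℝ) (I := 𝕀) hx
  refine Eq.trans this ?_
  exact congr_arg (fun z : 𝔼 => (show 𝔼 →L[ℝ] 𝔼 from
    mfderivWithin 𝓘(ℝ, 𝔼) 𝕀 (extChartAt 𝕀 x₀).symm (range 𝕀) z)) ((extChartAt 𝕀 x₀).right_inv hz)

lemma eventually_norm_frameMap_le (x₀ : M) {r : ℝ} (hr : 1 < r) :
    ∀ᶠ y in 𝓝 x₀, ∀ v : 𝔼, ‖frameMap x₀ y v‖ ≤ r * ‖frameMap x₀ x₀ v‖ := by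
  filter_upwards [eventually_norm_symmL_trivializationAt_comp_self_lt 𝔼
    (fun x : M => TangentSpace (𝓡 (n + 1)) x) x₀ hr] with y hy v
  have h1 : frameMap x₀ y v = (frameMap x₀ y ∘L coordMap x₀ x₀) (frameMap x₀ x₀ v) := by
    rw [ContinuousLinearMap.comp_apply, coordMap_frameMap (mem_chart_source _ _)]
  rw [h1]
  exact (ContinuousLinearMap.le_opNorm _ _).trans (by gcongr)

lemma eventually_norm_frameMap_coordMap_le (x₀ : M) {r : ℝ} (hr : 1 < r) :
    ∀ᶠ y in 𝓝 x₀, ∀ u : TangentSpace 𝕀 y, ‖frameMap x₀ x₀ (coordMap x₀ y u)‖ ≤ r * ‖u‖ := by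
  filter_upwards [eventually_norm_symmL_trivializationAt_self_comp_lt 𝔼
    (fun x : M => TangentSpace (𝓡 (n + 1)) x) x₀ hr] with y hy u
  have h1 : frameMap x₀ x₀ (coordMap x₀ y u) = (frameMap x₀ x₀ ∘L coordMap x₀ y) u := rfl
  rw [h1]
  exact (ContinuousLinearMap.le_opNorm _ _).trans (by gcongr)

lemma fderiv_continuousLineMap_one (a b : 𝔼) (t : ℝ) :
    fderiv ℝ (ContinuousAffineMap.lineMap (R := ℝ) a b) t (1 : ℝ) = b - a := by
  have : HasDerivAt (ContinuousAffineMap.lineMap (R := ℝ) a b) (b - a) t := by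
    rw [ContinuousAffineMap.coe_lineMap_eq]
    exact AffineMap.hasDerivAt_lineMap
  rw [fderiv_apply_one_eq_deriv, this.deriv]

/-- Short distances are bounded above by the coordinate distance measured in the metric at the
centre of the chart: the image of a coordinate segment is a short path. -/
lemma exists_nhds_edist_le [IsRiemannianManifold (𝓡 (n + 1)) M] (x₀ : M) {r : ℝ≥0} (hr : 1 < r) :
    ∃ U ∈ 𝓝 x₀, ∀ x ∈ U, ∀ y ∈ U, edist x y ≤
      r * ‖frameMap x₀ x₀ (extChartAt 𝕀 x₀ y - extChartAt 𝕀 x₀ x)‖ₑ := by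
  have hN : ∀ᶠ z in 𝓝 (extChartAt 𝕀 x₀ x₀), z ∈ (extChartAt 𝕀 x₀).target ∧
      ∀ v : 𝔼, ‖frameMap x₀ ((extChartAt 𝕀 x₀).symm z) v‖ ≤ r * ‖frameMap x₀ x₀ v‖ := by
    refine Filter.Eventually.and (extChartAt_target_mem_nhds (I := 𝕀) x₀) ?_
    have h1 : Tendsto (extChartAt 𝕀 x₀).symm (𝓝 (extChartAt 𝕀 x₀ x₀)) (𝓝 x₀) := by
      have := continuousAt_extChartAt_symm (I := 𝕀) x₀
      rwa [ContinuousAt, extChartAt_to_inv] at this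
    exact h1.eventually (eventually_norm_frameMap_le x₀ (r := r) (by exact_mod_cast hr))
  obtain ⟨δ, δ0, hδ⟩ := Metric.eventually_nhds_iff_ball.1 hN
  refine ⟨(extChartAt 𝕀 x₀).source ∩ extChartAt 𝕀 x₀ ⁻¹' Metric.ball (extChartAt 𝕀 x₀ x₀) δ,
    inter_mem (extChartAt_source_mem_nhds x₀)
      ((continuousAt_extChartAt x₀).preimage_mem_nhds (Metric.ball_mem_nhds _ δ0)), ?_⟩
  rintro x ⟨hxs, hxb⟩ y ⟨hys, hyb⟩
  rw [mem_preimage] at hxb hyb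
  -- The coordinate segment from `x` to `y`, and its image in the manifold.
  let η := ContinuousAffineMap.lineMap (R := ℝ) (extChartAt 𝕀 x₀ x) (extChartAt 𝕀 x₀ y)
  have hη : ∀ t ∈ Icc (0 : ℝ) 1, η t ∈ Metric.ball (extChartAt 𝕀 x₀ x₀) δ := by
    rw [← MapsTo, mapsTo_iff_image_subset, ContinuousAffineMap.coe_lineMap_eq,
      ← segment_eq_image_lineMap]
    exact (convex_ball _ _).segment_subset hxb hyb
  have η_smooth : ContMDiffOn 𝓘(ℝ, ℝ) 𝓘(ℝ, 𝔼) 1 η (Icc 0 1) := by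
    apply ContMDiff.contMDiffOn
    rw [contMDiff_iff_contDiff]
    exact ContinuousAffineMap.contDiff _
  rw [IsRiemannianManifold.out (I := 𝕀) x y]
  have hle : riemannianEDist 𝕀 x y ≤ pathELength 𝕀 ((extChartAt 𝕀 x₀).symm ∘ η) 0 1 := by
    apply riemannianEDist_le_pathELength _ _ _ zero_le_one
    · exact (contMDiffOn_extChartAt_symm (n := 1) x₀).comp η_smooth
        (fun t ht => (hδ _ (hη t ht)).1)
    · simp [-extChartAt, η, ContinuousAffineMap.coe_lineMap_eq, (extChartAt 𝕀 x₀).left_inv hxs]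
    · simp [-extChartAt, η, ContinuousAffineMap.coe_lineMap_eq, (extChartAt 𝕀 x₀).left_inv hys]
  refine hle.trans ?_
  rw [pathELength_eq_lintegral_mfderivWithin_Icc]
  calc _ ≤ ∫⁻ t in Icc (0 : ℝ) 1,
        r * ‖frameMap x₀ x₀ (extChartAt 𝕀 x₀ y - extChartAt 𝕀 x₀ x)‖ₑ := by
        apply setLIntegral_mono' measurableSet_Icc (fun t ht ↦ ?_)
        have hd : mfderivWithin 𝓘(ℝ, ℝ) 𝕀 ((extChartAt 𝕀 x₀).symm ∘ η) (Icc 0 1) t =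
            (mfderivWithin 𝓘(ℝ, 𝔼) 𝕀 (extChartAt 𝕀 x₀).symm (range 𝕀) (η t)) ∘L
              (mfderivWithin 𝓘(ℝ, ℝ) 𝓘(ℝ, 𝔼) η (Icc 0 1) t) := by
          apply mfderivWithin_comp
          · exact mdifferentiableWithinAt_extChartAt_symm (hδ _ (hη t ht)).1
          · exact η_smooth.mdifferentiableOn one_ne_zero t ht
          · intro s hs; simp
          · rw [uniqueMDiffWithinAt_iff_uniqueDiffWithinAt]
            exact uniqueDiffOn_Icc zero_lt_one t ht
        have hv : mfderivWithin 𝓘(ℝ, ℝ) 𝓘(ℝ, 𝔼) η (Icc 0 1) t (1 : ℝ) =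
            extChartAt 𝕀 x₀ y - extChartAt 𝕀 x₀ x := by
          rw [mfderivWithin_eq_fderivWithin, fderivWithin_eq_fderiv
            (uniqueDiffOn_Icc zero_lt_one _ ht) (ContinuousAffineMap.differentiableAt _)]
          exact fderiv_continuousLineMap_one _ _ _
        have hd1 : mfderivWithin 𝓘(ℝ, ℝ) 𝕀 ((extChartAt 𝕀 x₀).symm ∘ η) (Icc 0 1) t (1 : ℝ) =
            frameMap x₀ ((extChartAt 𝕀 x₀).symm (η t))
              (extChartAt 𝕀 x₀ y - extChartAt 𝕀 x₀ x) := by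
          have h1 := (DFunLike.congr_fun hd (1 : ℝ))
          refine h1.trans ?_
          have h2 := frameMap_symm_eq (hδ _ (hη t ht)).1
          exact (DFunLike.congr_fun h2.symm
            (mfderivWithin 𝓘(ℝ, ℝ) 𝓘(ℝ, 𝔼) η (Icc 0 1) t (1 : ℝ))).trans
            (congr_arg (frameMap x₀ ((extChartAt 𝕀 x₀).symm (η t))) hv)
        have h3 := (hδ _ (hη t ht)).2 (extChartAt 𝕀 x₀ y - extChartAt 𝕀 x₀ x)
        rw [← ENNReal.ofReal_le_ofReal_iff (by positivity), ENNReal.ofReal_mul (by positivity),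
          ofReal_norm, ofReal_norm, ENNReal.ofReal_coe_nnreal] at h3
        exact (le_of_eq (congr_arg (fun v : TangentSpace 𝕀 ((extChartAt 𝕀 x₀).symm (η t)) =>
          ‖v‖ₑ) hd1)).trans h3
    _ = _ := by simp

/-- Short distances are bounded below by the coordinate distance measured in the metric at the
centre of the chart: almost shortest paths between points near the centre stay near the centre. -/
lemma exists_nhds_le_edist [IsRiemannianManifold (𝓡 (n + 1)) M] (x₀ : M) {r : ℝ≥0} (hr : 1 < r) :
    ∃ U ∈ 𝓝 x₀, ∀ x ∈ U, ∀ y ∈ U,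
      ‖frameMap x₀ x₀ (extChartAt 𝕀 x₀ y - extChartAt 𝕀 x₀ x)‖ₑ ≤ r * edist x y := by
  have hN : ∀ᶠ y in 𝓝 x₀, y ∈ (chartAt 𝔼 x₀).source ∧
      ∀ u : TangentSpace 𝕀 y, ‖frameMap x₀ x₀ (coordMap x₀ y u)‖ ≤ r * ‖u‖ :=
    Filter.Eventually.and (chart_source_mem_nhds 𝔼 x₀)
      (eventually_norm_frameMap_coordMap_le x₀ (r := r) (by exact_mod_cast hr))
  obtain ⟨δ, δ0, hδ⟩ := EMetric.mem_nhds_iff.1 hN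
  obtain ⟨δ', δ'0, hδ'⟩ : ∃ δ' : ℝ≥0∞, 0 < δ' ∧ δ' + (δ' + δ') ≤ δ := by
    refine ⟨δ / 3, ENNReal.div_pos δ0.ne' (by simp), ?_⟩
    rw [← add_assoc, ENNReal.add_thirds]
  refine ⟨Metric.eball x₀ δ', Metric.eball_mem_nhds _ δ'0, fun x hx y hy => ?_⟩
  have hxy : edist x y < δ' + δ' :=
    (edist_triangle_right x y x₀).trans_lt (ENNReal.add_lt_add hx hy)
  suffices h : ∀ R ∈ Ioo (edist x y) (δ' + δ'),
      ‖frameMap x₀ x₀ (extChartAt 𝕀 x₀ y - extChartAt 𝕀 x₀ x)‖ₑ ≤ r * R by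
    have : (𝓝[>] (edist x y)).NeBot := nhdsGT_neBot_of_exists_gt ⟨_, hxy⟩
    refine ge_of_tendsto (x := 𝓝[>] (edist x y)) (f := fun R : ℝ≥0∞ => r * R) ?_
      (eventually_of_mem (Ioo_mem_nhdsGT hxy) h)
    exact (ENNReal.Tendsto.const_mul tendsto_id (Or.inr ENNReal.coe_ne_top)).mono_left
      nhdsWithin_le_nhds
  rintro R ⟨hR, hR'⟩
  rw [IsRiemannianManifold.out (I := 𝕀) x y] at hR
  obtain ⟨γ, hγ0, hγ1, hγ, hlen⟩ := exists_lt_of_riemannianEDist_lt hR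
  -- a path of length less than `2 δ'` starting in the ball of radius `δ'` stays in the good ball
  have hmem : ∀ t ∈ Icc (0 : ℝ) 1, γ t ∈ Metric.eball x₀ δ := by
    intro t ht
    have h1 : edist x (γ t) < δ' + δ' := by
      rw [IsRiemannianManifold.out (I := 𝕀) x (γ t)]
      refine (riemannianEDist_le_pathELength (hγ.mono (Icc_subset_Icc_right ht.2)) hγ0 rfl
        ht.1).trans_lt ?_
      exact (pathELength_mono le_rfl ht.2).trans_lt (hlen.trans hR')
    rw [Metric.mem_eball, edist_comm]
    refine lt_of_lt_of_le ((edist_triangle x₀ x (γ t)).trans_lt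
      (ENNReal.add_lt_add (by rw [edist_comm]; exact hx) h1)) hδ'
  -- The path in coordinates; the constant linear map `L` measures it in the metric at the centre.
  let c : ℝ → 𝔼 := extChartAt 𝕀 x₀ ∘ γ
  have hc : ContMDiffOn 𝓘(ℝ, ℝ) 𝓘(ℝ, 𝔼) 1 c (Icc 0 1) :=
    (contMDiffOn_extChartAt (n := 1) (I := 𝕀) (x := x₀)).comp hγ
      (fun t ht => (hδ (hmem t ht)).1)
  let L : 𝔼 →L[ℝ] 𝔼 :=
    (tangentIsometry x₀).toContinuousLinearEquiv.toContinuousLinearMap ∘L frameMap x₀ x₀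
  have hL : ∀ v, ‖L v‖ₑ = ‖frameMap x₀ x₀ v‖ₑ := fun v => by
    simp only [enorm, nnnorm]
    congr 1
    exact Subtype.ext ((tangentIsometry x₀).norm_map (frameMap x₀ x₀ v))
  have hLc : ContDiffOn ℝ 1 (L ∘ c) (Icc 0 1) :=
    L.contDiff.comp_contDiffOn (contMDiffOn_iff_contDiffOn.1 hc)
  rw [← hL, map_sub]
  have hx' : L (extChartAt 𝕀 x₀ x) = (L ∘ c) 0 := by simp [-extChartAt, c, hγ0]
  have hy' : L (extChartAt 𝕀 x₀ y) = (L ∘ c) 1 := by simp [-extChartAt, c, hγ1]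
  rw [hx', hy']
  refine (enorm_sub_le_lintegral_derivWithin_Icc_of_contDiffOn_Icc hLc zero_le_one).trans ?_
  refine le_trans ?_ (mul_le_mul_right hlen.le _)
  rw [pathELength_eq_lintegral_mfderivWithin_Icc, ← lintegral_const_mul' _ _ ENNReal.coe_ne_top]
  refine setLIntegral_mono' measurableSet_Icc (fun t ht ↦ ?_)
  have hu : UniqueMDiffWithinAt 𝓘(ℝ, ℝ) (Icc (0 : ℝ) 1) t := by
    rw [uniqueMDiffWithinAt_iff_uniqueDiffWithinAt]
    exact uniqueDiffOn_Icc zero_lt_one t ht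
  have hd : mfderivWithin 𝓘(ℝ, ℝ) 𝓘(ℝ, 𝔼) c (Icc 0 1) t =
      (mfderiv 𝕀 𝓘(ℝ, 𝔼) (extChartAt 𝕀 x₀) (γ t)) ∘L
        (mfderivWithin 𝓘(ℝ, ℝ) 𝕀 γ (Icc 0 1) t) := by
    apply mfderiv_comp_mfderivWithin
    · exact mdifferentiableAt_extChartAt (hδ (hmem t ht)).1
    · exact hγ.mdifferentiableOn one_ne_zero t ht
    · exact hu
  rw [← TangentBundle.continuousLinearMapAt_trivializationAt (hδ (hmem t ht)).1] at hd
  have hd1 : derivWithin (L ∘ c) (Icc 0 1) t =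
      L (coordMap x₀ (γ t) (mfderivWithin 𝓘(ℝ, ℝ) 𝕀 γ (Icc 0 1) t (1 : ℝ))) := by
    have hcd : DifferentiableWithinAt ℝ c (Icc 0 1) t :=
      (contMDiffOn_iff_contDiffOn.1 hc).differentiableOn one_ne_zero t ht
    have h1 : HasDerivWithinAt (L ∘ c) (L (derivWithin c (Icc 0 1) t)) (Icc 0 1) t :=
      L.hasFDerivAt.comp_hasDerivWithinAt t hcd.hasDerivWithinAt
    rw [h1.derivWithin (uniqueDiffOn_Icc zero_lt_one t ht), ← fderivWithin_derivWithin,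
      ← mfderivWithin_eq_fderivWithin]
    exact congr_arg L (DFunLike.congr_fun hd (1 : ℝ))
  rw [hd1, hL]
  have h3 := (hδ (hmem t ht)).2 (mfderivWithin 𝓘(ℝ, ℝ) 𝕀 γ (Icc 0 1) t (1 : ℝ))
  rw [← ENNReal.ofReal_le_ofReal_iff (by positivity), ENNReal.ofReal_mul (by positivity),
    ofReal_norm, ofReal_norm, ENNReal.ofReal_coe_nnreal] at h3
  exact h3

lemma coordMap_self (x₀ : M) (v : TangentSpace 𝕀 x₀) : coordMap x₀ x₀ v = v := by
  have h := TangentBundle.continuousLinearMapAt_trivializationAt (𝕜 := ℝ) (I := 𝕀)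
    (mem_chart_source 𝔼 x₀)
  rw [mfderiv_extChartAt_self] at h
  exact DFunLike.congr_fun h v

lemma frameMap_self (x₀ : M) (v : 𝔼) : frameMap x₀ x₀ v = v := by
  have := frameMap_coordMap (mem_chart_source 𝔼 x₀) (v : TangentSpace 𝕀 x₀)
  exact (congr_arg (frameMap x₀ x₀) (coordMap_self x₀ v)).symm.trans this

/-- A `C^1` map whose derivative at `x₀` is isometric is almost isometric near `x₀`. -/
lemma exists_nhds_edist_le_of_isometric_mfderiv [IsRiemannianManifold (𝓡 (n + 1)) M] {x₀ : M}
    {F : M → 𝔼} {L : TangentSpace 𝕀 x₀ →L[ℝ] 𝔼} (hL : ∀ v, ‖L v‖ = ‖v‖)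
    (hF : ContMDiffAt 𝕀 𝓘(ℝ, 𝔼) 1 F x₀) (hFL : HasMFDerivAt 𝕀 𝓘(ℝ, 𝔼) F x₀ L)
    {r : ℝ≥0} (hr : 1 < r) :
    ∃ U ∈ 𝓝 x₀, ∀ x ∈ U, ∀ y ∈ U, edist x y ≤ r * edist (F x) (F y) ∧
      edist (F x) (F y) ≤ r * edist x y := by
  obtain ⟨s, hs1, hsr⟩ : ∃ s : ℝ≥0, 1 < s ∧ s * s = r := by
    refine ⟨NNReal.sqrt r, by simpa using NNReal.sqrt_lt_sqrt.2 hr, NNReal.mul_self_sqrt r⟩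
  obtain ⟨U₁, hU₁, h₁⟩ := exists_nhds_edist_le (n := n) x₀ hs1
  obtain ⟨U₂, hU₂, h₂⟩ := exists_nhds_le_edist (n := n) x₀ hs1
  set L' : 𝔼 →L[ℝ] 𝔼 := L with hL'
  have hnorm : ∀ v : 𝔼, ‖frameMap x₀ x₀ v‖ = ‖L' v‖ := fun v => by
    rw [frameMap_self]; exact (hL v).symm
  have hu1 : ContDiffAt ℝ 1 (F ∘ (extChartAt 𝕀 x₀).symm) (extChartAt 𝕀 x₀ x₀) := by
    have h := (contMDiffAt_iff.1 hF).2
    simp only [ModelWithCorners.range_eq_univ, contDiffWithinAt_univ] at h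
    exact h
  have hu2 : HasFDerivAt (F ∘ (extChartAt 𝕀 x₀).symm) L' (extChartAt 𝕀 x₀ x₀) := by
    have h := hFL.2
    simp only [ModelWithCorners.range_eq_univ] at h
    exact (hasFDerivWithinAt_univ (f := F ∘ (extChartAt 𝕀 x₀).symm)).1 h
  have hu : HasStrictFDerivAt (F ∘ (extChartAt 𝕀 x₀).symm) L' (extChartAt 𝕀 x₀ x₀) :=
    hu1.hasStrictFDerivAt' hu2 one_ne_zero
  -- the derivative is bounded below, so the error of linearization is small relative to `L'`
  obtain ⟨C, hC0, hC⟩ : ∃ C : ℝ, 0 < C ∧ ∀ v : 𝔼, ‖v‖ ≤ C * ‖L' v‖ := by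
    refine ⟨‖coordMap (n := n) x₀ x₀‖ + 1, by positivity, fun v => ?_⟩
    calc ‖v‖ = ‖coordMap x₀ x₀ (frameMap x₀ x₀ v)‖ := by
          rw [coordMap_frameMap (mem_chart_source _ _)]
      _ ≤ ‖coordMap (n := n) x₀ x₀‖ * ‖frameMap x₀ x₀ v‖ := ContinuousLinearMap.le_opNorm _ _
      _ ≤ _ := by rw [hnorm]; gcongr; linarith
  have hs1' : (1 : ℝ) < s := by exact_mod_cast hs1
  have hs0 : (0 : ℝ) < s := by linarith
  set κ : ℝ := (s - 1) / s with hκ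
  have hκ0 : 0 < κ := div_pos (by linarith) hs0
  have hκ1 : (1 - κ) * s = 1 := by rw [hκ]; field_simp; ring
  have hκ2 : 1 + κ ≤ s := by
    have : κ ≤ s - 1 := div_le_self (by linarith) hs1'.le
    linarith
  have hlin : ∀ᶠ p : 𝔼 × 𝔼 in 𝓝 (extChartAt 𝕀 x₀ x₀, extChartAt 𝕀 x₀ x₀),
      ‖(F ∘ (extChartAt 𝕀 x₀).symm) p.1 - (F ∘ (extChartAt 𝕀 x₀).symm) p.2 - L' (p.1 - p.2)‖ ≤
        (κ / C) * ‖p.1 - p.2‖ :=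
    hu.isLittleO.def (div_pos hκ0 hC0)
  rw [nhds_prod_eq] at hlin
  obtain ⟨t, ht, hlin⟩ := mem_prod_self_iff.1 hlin
  refine ⟨U₁ ∩ U₂ ∩ ((extChartAt 𝕀 x₀).source ∩ extChartAt 𝕀 x₀ ⁻¹' t),
    inter_mem (inter_mem hU₁ hU₂)
    (inter_mem (extChartAt_source_mem_nhds x₀) ((continuousAt_extChartAt x₀).preimage_mem_nhds ht)),
    ?_⟩
  rintro x ⟨⟨hx1, hx2⟩, hxs, hxt⟩ y ⟨⟨hy1, hy2⟩, hys, hyt⟩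
  have e1 := h₁ x hx1 y hy1
  have e2 := h₂ x hx2 y hy2
  have e3 := hlin (mk_mem_prod hyt hxt)
  simp only [mem_ofPred_eq, Function.comp_apply, (extChartAt 𝕀 x₀).left_inv hxs,
    (extChartAt 𝕀 x₀).left_inv hys] at e3
  set w := extChartAt 𝕀 x₀ y - extChartAt 𝕀 x₀ x with hw
  have e4 : ‖F y - F x - L' w‖ ≤ κ * ‖L' w‖ := by
    refine e3.trans ?_
    calc κ / C * ‖w‖ ≤ κ / C * (C * ‖L' w‖) := by gcongr; exact hC w
      _ = κ * ‖L' w‖ := by field_simp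
  have hnorm' : ‖frameMap x₀ x₀ w‖ₑ = ‖L' w‖ₑ := by
    rw [← ofReal_norm, ← ofReal_norm, hnorm]
  rw [hnorm'] at e1 e2
  have e5 : ‖F y - F x‖ₑ ≤ s * ‖L' w‖ₑ := by
    rw [← ofReal_norm, ← ofReal_norm, ← ENNReal.ofReal_coe_nnreal,
      ← ENNReal.ofReal_mul (by positivity)]
    apply ENNReal.ofReal_le_ofReal
    have : ‖F y - F x‖ ≤ ‖F y - F x - L' w‖ + ‖L' w‖ := by
      simpa using norm_add_le (F y - F x - L' w) (L' w)
    nlinarith [norm_nonneg (L' w)]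
  have e6 : ‖L' w‖ₑ ≤ s * ‖F y - F x‖ₑ := by
    rw [← ofReal_norm, ← ofReal_norm, ← ENNReal.ofReal_coe_nnreal,
      ← ENNReal.ofReal_mul (by positivity)]
    apply ENNReal.ofReal_le_ofReal
    have : ‖L' w‖ ≤ ‖F y - F x‖ + ‖F y - F x - L' w‖ := by
      simpa using norm_sub_le (F y - F x) (F y - F x - L' w)
    have h7 : (1 - κ) * ‖L' w‖ ≤ ‖F y - F x‖ := by linarith
    calc ‖L' w‖ = s * ((1 - κ) * ‖L' w‖) := by rw [← mul_assoc, mul_comm (s : ℝ), hκ1, one_mul]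
      _ ≤ _ := by gcongr
  rw [edist_comm (F x), edist_eq_enorm_sub, ← hsr, ENNReal.coe_mul, mul_assoc, mul_assoc]
  exact ⟨e1.trans (by gcongr), e5.trans (by gcongr)⟩

section HausdorffComparison

variable {X Y : Type*} [EMetricSpace X] [MeasurableSpace X] [BorelSpace X]
  [EMetricSpace Y] [MeasurableSpace Y] [BorelSpace Y]

lemma euclideanHausdorffMeasure_image_le {f : X → Y} {s : Set X} {K : ℝ≥0} (d : ℕ)
    (h : ∀ x ∈ s, ∀ y ∈ s, edist (f x) (f y) ≤ K * edist x y) :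
    (μHE[d] : Measure Y) (f '' s) ≤ (K : ℝ≥0∞) ^ d * (μHE[d] : Measure X) s := by
  have := LipschitzOnWith.hausdorffMeasure_image_le (K := K) (f := f) (s := s)
    (fun x hx y hy => h x hx y hy) (d := d) (by positivity)
  rw [Measure.euclideanHausdorffMeasure_def, Measure.euclideanHausdorffMeasure_def,
    Measure.smul_apply, Measure.smul_apply, ENNReal.smul_def, ENNReal.smul_def, smul_eq_mul,
    smul_eq_mul, mul_left_comm]
  rw [ENNReal.rpow_natCast] at this
  gcongr

lemma euclideanHausdorffMeasure_le_image {f : X → Y} {s : Set X} {K : ℝ≥0} (d : ℕ)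
    (h : ∀ x ∈ s, ∀ y ∈ s, edist x y ≤ K * edist (f x) (f y)) :
    (μHE[d] : Measure X) s ≤ (K : ℝ≥0∞) ^ d * (μHE[d] : Measure Y) (f '' s) := by
  rcases s.eq_empty_or_nonempty with rfl | ⟨x₁, -⟩
  · simp
  have : Nonempty X := ⟨x₁⟩
  have hinj : InjOn f s := fun x hx y hy hxy => by
    have := h x hx y hy
    rw [hxy, edist_self, mul_zero] at this
    exact edist_le_zero.1 this
  have h1 : Function.invFunOn f s '' (f '' s) = s := hinj.invFunOn_image Subset.rfl
  conv_lhs => rw [← h1]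
  refine euclideanHausdorffMeasure_image_le d ?_
  rintro _ ⟨x, hx, rfl⟩ _ ⟨y, hy, rfl⟩
  rw [hinj.leftInvOn_invFunOn hx, hinj.leftInvOn_invFunOn hy]
  exact h x hx y hy

end HausdorffComparison

/-! ### The Riemannian volume in coordinates -/

/-- An inequality `α ≤ r β` between set functions that holds near each point of `U` for each `r > 1`
gives `α ≤ β` in `U`, if `α` is countably subadditive and `β` is countably superadditive. -/
lemma le_of_forall_nhds_le {X : Type*} [TopologicalSpace X] [SecondCountableTopology X]
    [MeasurableSpace X] [BorelSpace X] {α β : Set X → ℝ≥0∞} {U : Set X}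
    (hα : ∀ A : ℕ → Set X, (∀ k, MeasurableSet (A k)) → Pairwise (Function.onFun Disjoint A) →
      α (⋃ k, A k) ≤ ∑' k, α (A k))
    (hβ : ∀ A : ℕ → Set X, (∀ k, MeasurableSet (A k)) → Pairwise (Function.onFun Disjoint A) →
      ∑' k, β (A k) ≤ β (⋃ k, A k))
    (hα0 : α ∅ = 0)
    (h : ∀ x ∈ U, ∀ r : ℝ≥0, 1 < r → ∃ V ∈ 𝓝 x, ∀ A ⊆ V ∩ U, MeasurableSet A → α A ≤ r * β A)
    {A : Set X} (hA : MeasurableSet A) (hAU : A ⊆ U) : α A ≤ β A := by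
  suffices h' : ∀ r : ℝ≥0, 1 < r → α A ≤ r * β A by
    have : Tendsto (fun r : ℝ≥0 => (r : ℝ≥0∞) * β A) (𝓝[>] 1) (𝓝 (β A)) := by
      conv => enter [3, 1]; rw [← one_mul (β A)]
      refine ENNReal.Tendsto.mul_const ?_ (Or.inl one_ne_zero)
      exact (ENNReal.tendsto_coe.2 (tendsto_id (α := ℝ≥0) (x := 𝓝 1))).mono_left nhdsWithin_le_nhds
    exact ge_of_tendsto this (eventually_of_mem self_mem_nhdsWithin h')
  intro r hr
  choose! V hV hVA using fun x hx => h x hx r hr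
  -- Decompose `A` into countably many disjoint pieces on each of which the local inequality holds.
  obtain ⟨t, htU, htc, hcov⟩ := TopologicalSpace.countable_cover_nhdsWithin
    (s := U) (f := fun x => interior (V x))
    (fun x hx => mem_nhdsWithin_of_mem_nhds (interior_mem_nhds.2 (hV x hx)))
  rcases t.eq_empty_or_nonempty with rfl | hne
  · have : A = ∅ := by
      have := hAU.trans hcov
      simpa using this
    simp [this, hα0]
  obtain ⟨e, he⟩ := htc.exists_eq_range hne
  let W : ℕ → Set X := disjointed fun k => interior (V (e k))
  have hW : ∀ k, MeasurableSet (W k) :=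
    fun k => MeasurableSet.disjointed (fun k => isOpen_interior.measurableSet) k
  have hAW : ⋃ k, A ∩ W k = A := by
    rw [← inter_iUnion, iUnion_disjointed, inter_eq_left]
    refine (hAU.trans hcov).trans ?_
    rw [he]
    simp
  have hd : Pairwise (Function.onFun Disjoint fun k => A ∩ W k) := fun i j hij =>
    ((disjoint_disjointed _) hij).mono inter_subset_right inter_subset_right
  have h1 := hα (fun k => A ∩ W k) (fun k => hA.inter (hW k)) hd
  have h2 := hβ (fun k => A ∩ W k) (fun k => hA.inter (hW k)) hd
  rw [hAW] at h1 h2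
  refine h1.trans (le_trans ?_ (mul_le_mul_right h2 _))
  rw [← ENNReal.tsum_mul_left]
  refine ENNReal.tsum_le_tsum fun k => ?_
  refine hVA (e k) (htU (by rw [he]; exact mem_range_self k)) _ ?_ (hA.inter (hW k))
  exact subset_inter ((inter_subset_right.trans (disjointed_subset _ k)).trans interior_subset)
    (inter_subset_left.trans hAU)

/-- If `μ ≤ r ν` holds near each point of the set `U` for each `r > 1`, then `μ ≤ ν` in `U`. -/
lemma measure_le_of_forall_nhds {X : Type*} [TopologicalSpace X] [SecondCountableTopology X]
    [MeasurableSpace X] [BorelSpace X] {μ ν : Measure X} {U : Set X}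
    (h : ∀ x ∈ U, ∀ r : ℝ≥0, 1 < r → ∃ V ∈ 𝓝 x, ∀ A ⊆ V ∩ U, MeasurableSet A → μ A ≤ r * ν A)
    {A : Set X} (hA : MeasurableSet A) (hAU : A ⊆ U) : μ A ≤ ν A :=
  le_of_forall_nhds_le (α := μ) (β := ν) (fun A _ _ => measure_iUnion_le A)
    (fun _ hA hd => (measure_iUnion hd hA).ge) measure_empty h hA hAU

end Riemannian

section Density

variable {n : ℕ} {M : Type*} [MetricSpace M]
    [ChartedSpace (EuclideanSpace ℝ (Fin (n + 1))) M] [IsManifold (𝓡 (n + 1)) ∞ M]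
    [RiemannianBundle (fun x : M => TangentSpace (𝓡 (n + 1)) x)]
    [IsContMDiffRiemannianBundle (𝓡 (n + 1)) ∞ (EuclideanSpace ℝ (Fin (n + 1)))
      (fun x : M => TangentSpace (𝓡 (n + 1)) x)]

local notation "𝔼" => EuclideanSpace ℝ (Fin (n + 1))
local notation "𝕀" => 𝓡 (n + 1)

/-- The coordinate frame of the preferred chart at `x₀`, seen in an orthonormal basis of the tangent
space at `x`. -/
def orthoFrameMap (x₀ x : M) :
    EuclideanSpace ℝ (Fin (n + 1)) →L[ℝ] EuclideanSpace ℝ (Fin (n + 1)) :=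
  (tangentIsometry x).toContinuousLinearEquiv.toContinuousLinearMap ∘L frameMap x₀ x

/-- The density `√(det g)` of the Riemannian volume in the preferred chart at `x₀`. -/
def chartDensity (x₀ : M) (z : EuclideanSpace ℝ (Fin (n + 1))) : ℝ :=
  |LinearMap.det (orthoFrameMap (n := n) x₀ ((extChartAt (𝓡 (n + 1)) x₀).symm z) :
    EuclideanSpace ℝ (Fin (n + 1)) →ₗ[ℝ] EuclideanSpace ℝ (Fin (n + 1)))|

/-- The coordinate vector fields are smooth. -/
lemma contMDiffOn_frameMap (x₀ : M) (v : 𝔼) :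
    ContMDiffOn 𝕀 (𝕀).tangent ∞ (fun x => (⟨x, frameMap x₀ x v⟩ : TangentBundle 𝕀 M))
      (chartAt 𝔼 x₀).source := by
  have h := (trivializationAt 𝔼 (TangentSpace 𝕀) x₀).contMDiffOn_symm (n := ∞) (IB := 𝕀)
  have h2 : ContMDiffOn 𝕀 ((𝕀).prod 𝓘(ℝ, 𝔼)) ∞ (fun x : M => (x, v)) (chartAt 𝔼 x₀).source :=
    contMDiffOn_id.prodMk contMDiffOn_const
  have h3 := h.comp h2 (fun x hx => by
    rw [mem_preimage, Trivialization.mem_target]; simpa using hx)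
  refine h3.congr fun x hx => ?_
  simp only [Function.comp_apply]
  have hb : x ∈ (trivializationAt 𝔼 (TangentSpace 𝕀) x₀).baseSet := by simpa using hx
  rw [Trivialization.symmL_apply, ← Trivialization.mk_symm _ hb]
  exact hb

lemma frameMap_injective {x₀ x : M} (hx : x ∈ (chartAt 𝔼 x₀).source) :
    Function.Injective (frameMap (n := n) x₀ x) := fun v w h => by
  rw [← coordMap_frameMap hx v, h, coordMap_frameMap hx]

lemma symm_mem_chart_source {x₀ : M} {z : 𝔼} (hz : z ∈ (extChartAt 𝕀 x₀).target) :
    (extChartAt 𝕀 x₀).symm z ∈ (chartAt 𝔼 x₀).source := by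
  rw [← extChartAt_source 𝕀]; exact (extChartAt 𝕀 x₀).map_target hz

lemma chartDensity_pos (x₀ : M) {z : 𝔼} (hz : z ∈ (extChartAt 𝕀 x₀).target) :
    0 < chartDensity x₀ z := by
  rw [chartDensity, abs_pos, Ne, LinearMap.det_eq_zero_iff_ker_ne_bot, not_not]
  refine LinearMap.ker_eq_bot.2 fun v w h => ?_
  exact frameMap_injective (symm_mem_chart_source hz) ((tangentIsometry _).injective h)

lemma contDiffOn_chartDensity (x₀ : M) :
    ContDiffOn ℝ ∞ (chartDensity (n := n) x₀) (extChartAt 𝕀 x₀).target := by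
  let b := EuclideanSpace.basisFun (Fin (n + 1)) ℝ
  have hsq : ∀ z, chartDensity x₀ z ^ 2 =
      (Matrix.gram ℝ fun i => frameMap x₀ ((extChartAt 𝕀 x₀).symm z) (b i)).det := fun z => by
    have := (orthoFrameMap x₀ ((extChartAt 𝕀 x₀).symm z)).toLinearMap.normDet_sq_eq_det_gram b
    rw [LinearMap.normDet_eq_abs_det] at this
    refine Eq.trans (b := (Matrix.gram ℝ fun i =>
      orthoFrameMap x₀ ((extChartAt 𝕀 x₀).symm z) (b i)).det) this (congr_arg Matrix.det ?_)
    ext i j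
    simp only [Matrix.gram_apply]
    exact (tangentIsometry _).inner_map_map _ _
  have hdet : ContDiffOn ℝ ∞ (fun z => chartDensity x₀ z ^ 2) (extChartAt 𝕀 x₀).target := by
    simp_rw [hsq, Matrix.det_apply]
    refine ContDiffOn.sum fun σ _ => ContDiffOn.const_smul _ (contDiffOn_prod fun i _ => ?_)
    simp only [Matrix.gram_apply]
    rw [← contMDiffOn_iff_contDiffOn]
    have hs : ∀ i, ContMDiffOn 𝓘(ℝ, 𝔼) (𝕀).tangent ∞ (fun z =>
        (⟨(extChartAt 𝕀 x₀).symm z, frameMap x₀ ((extChartAt 𝕀 x₀).symm z) (b i)⟩ :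
          TangentBundle 𝕀 M)) (extChartAt 𝕀 x₀).target := fun i =>
      (contMDiffOn_frameMap x₀ (b i)).comp (contMDiffOn_extChartAt_symm x₀)
        (fun z hz => symm_mem_chart_source hz)
    exact ContMDiffOn.inner_bundle (hs _) (hs _)
  refine (hdet.sqrt fun z hz => (pow_pos (chartDensity_pos x₀ hz) 2).ne').congr fun z hz => ?_
  exact (Real.sqrt_sq (chartDensity_pos x₀ hz).le).symm

lemma hasMFDerivAt_extChartAt_coordMap {x₀ x : M} (hx : x ∈ (chartAt 𝔼 x₀).source) :
    HasMFDerivAt 𝕀 𝓘(ℝ, 𝔼) (extChartAt 𝕀 x₀) x (coordMap (n := n) x₀ x) := by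
  have h1 := (mdifferentiableAt_extChartAt (I := 𝕀) hx).hasMFDerivAt
  rwa [← TangentBundle.continuousLinearMapAt_trivializationAt hx] at h1

variable [IsRiemannianManifold (𝓡 (n + 1)) M] [MeasurableSpace M] [BorelSpace M]

/-- The measure with density `√(det g)` in the chart at `x₀`, moved to the manifold. -/
def chartMeasure (x₀ : M) : Measure M :=
  Measure.map (extChartAt (𝓡 (n + 1)) x₀).symm
    ((volume.restrict (extChartAt (𝓡 (n + 1)) x₀).target).withDensity
      fun z => ENNReal.ofReal (chartDensity x₀ z))

lemma measurableSet_extChartAt_target (x₀ : M) : MeasurableSet (extChartAt 𝕀 x₀).target :=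
  (isOpen_extChartAt_target x₀).measurableSet

lemma aemeasurable_extChartAt_symm (x₀ : M) :
    AEMeasurable (extChartAt 𝕀 x₀).symm (volume.restrict (extChartAt 𝕀 x₀).target) :=
  (continuousOn_extChartAt_symm x₀).aemeasurable (measurableSet_extChartAt_target x₀)

lemma aemeasurable_chartDensity (x₀ : M) : AEMeasurable (chartDensity (n := n) x₀)
    (volume.restrict (extChartAt 𝕀 x₀).target) :=
  (contDiffOn_chartDensity x₀).continuousOn.aemeasurable (measurableSet_extChartAt_target x₀)

lemma measurableSet_image_extChartAt {x₀ : M} {A : Set M} (hA : MeasurableSet A)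
    (hAs : A ⊆ (extChartAt 𝕀 x₀).source) : MeasurableSet (extChartAt 𝕀 x₀ '' A) := by
  have h : extChartAt 𝕀 x₀ '' A = (extChartAt 𝕀 x₀).target ∩ (extChartAt 𝕀 x₀).symm ⁻¹' A := by
    rw [(extChartAt 𝕀 x₀).image_eq_target_inter_inv_preimage hAs]
  rw [h]
  have h1 := (measurableSet_extChartAt_target (n := n) x₀).subtype_image
    ((continuousOn_extChartAt_symm x₀).domRestrict.measurable hA)
  rwa [← Subtype.image_preimage_coe]

lemma chartMeasure_apply {x₀ : M} {A : Set M} (hA : MeasurableSet A)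
    (hAs : A ⊆ (extChartAt 𝕀 x₀).source) : chartMeasure (n := n) x₀ A =
      ∫⁻ z in extChartAt 𝕀 x₀ '' A, ENNReal.ofReal (chartDensity x₀ z) := by
  have hm : AEMeasurable (extChartAt 𝕀 x₀).symm
      ((volume.restrict (extChartAt 𝕀 x₀).target).withDensity
        fun z => ENNReal.ofReal (chartDensity x₀ z)) :=
    (aemeasurable_extChartAt_symm x₀).mono_ac (withDensity_absolutelyContinuous _ _)
  rw [chartMeasure, Measure.map_apply_of_aemeasurable hm hA, withDensity_apply',
    Measure.restrict_restrict₀' (measurableSet_extChartAt_target x₀).nullMeasurableSet,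
    (extChartAt 𝕀 x₀).image_eq_target_inter_inv_preimage hAs, inter_comm]

/-- Near `x₁`, the composition of the chart at `x₀` with a suitable linear map is almost isometric,
and the determinant of that linear map is the density at `x₁`. -/
lemma exists_linear_almost_isometric (x₀ : M) {x₁ : M} (hx₁ : x₁ ∈ (extChartAt 𝕀 x₀).source)
    {r : ℝ≥0} (hr : 1 < r) :
    ∃ B : 𝔼 →L[ℝ] 𝔼, |LinearMap.det (B : 𝔼 →ₗ[ℝ] 𝔼)| = chartDensity x₀ (extChartAt 𝕀 x₀ x₁) ∧
      ∃ U ∈ 𝓝 x₁, ∀ x ∈ U, ∀ y ∈ U,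
        edist x y ≤ r * edist (B (extChartAt 𝕀 x₀ x)) (B (extChartAt 𝕀 x₀ y)) ∧
        edist (B (extChartAt 𝕀 x₀ x)) (B (extChartAt 𝕀 x₀ y)) ≤ r * edist x y := by
  have hc : x₁ ∈ (chartAt 𝔼 x₀).source := by rwa [← extChartAt_source 𝕀]
  let B : 𝔼 →L[ℝ] 𝔼 := orthoFrameMap x₀ x₁
  have hF : ContMDiffAt 𝕀 𝓘(ℝ, 𝔼) 1 (fun x => B (extChartAt 𝕀 x₀ x)) x₁ :=
    B.contMDiff.contMDiffAt.comp x₁ (contMDiffAt_extChartAt' hc)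
  have hFL := (B.hasMFDerivAt (x := extChartAt 𝕀 x₀ x₁)).comp x₁
    (hasMFDerivAt_extChartAt_coordMap hc)
  refine ⟨B, ?_, exists_nhds_edist_le_of_isometric_mfderiv (fun v => ?_) hF hFL hr⟩
  · rw [chartDensity, (extChartAt 𝕀 x₀).left_inv hx₁]
  · exact ((tangentIsometry x₁).norm_map _).trans (congr_arg norm (frameMap_coordMap hc v))

/-- The Hausdorff measure of the Riemannian distance has density `√(det g)` in each chart: both
measures agree near each point up to factors arbitrarily close to `1`. -/
theorem riemVol_restrict_chart [SecondCountableTopology M] (x₀ : M) :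
    (riemVol n).restrict (extChartAt 𝕀 x₀).source = chartMeasure (n := n) x₀ := by
  have key : ∀ x ∈ (extChartAt 𝕀 x₀).source, ∀ r : ℝ≥0, 1 < r → ∃ V ∈ 𝓝 x,
      ∀ A ⊆ V ∩ (extChartAt 𝕀 x₀).source, MeasurableSet A →
        riemVol n A ≤ r * chartMeasure (n := n) x₀ A ∧
        chartMeasure (n := n) x₀ A ≤ r * riemVol n A := by
    intro x hx r hr
    -- The loss is `s ^ (n + 1)` from the almost isometry and `s` from the variation of the density.
    obtain ⟨s, hs1, hsr⟩ : ∃ s : ℝ≥0, 1 < s ∧ s ^ (n + 1) * s = r := by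
      refine ⟨r ^ (1 / ((n : ℝ) + 2)), NNReal.one_lt_rpow hr (by positivity), ?_⟩
      rw [← pow_succ, ← NNReal.rpow_natCast, ← NNReal.rpow_mul]
      have : (1 / ((n : ℝ) + 2)) * ((n + 1 + 1 : ℕ) : ℝ) = 1 := by
        push_cast; field_simp; ring
      rw [this, NNReal.rpow_one]
    obtain ⟨B, hB, U, hU, hUB⟩ := exists_linear_almost_isometric x₀ hx hs1
    set ρ₁ := chartDensity x₀ (extChartAt 𝕀 x₀ x) with hρ₁
    have hx' : extChartAt 𝕀 x₀ x ∈ (extChartAt 𝕀 x₀).target := (extChartAt 𝕀 x₀).map_source hx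
    have hρ₁0 : 0 < ρ₁ := chartDensity_pos x₀ hx'
    have hs1' : (1 : ℝ) < s := by exact_mod_cast hs1
    have hcont : ContinuousAt (fun y => chartDensity x₀ (extChartAt 𝕀 x₀ y)) x :=
      ContinuousAt.comp (g := chartDensity x₀)
        ((contDiffOn_chartDensity x₀).continuousOn.continuousAt
          ((isOpen_extChartAt_target x₀).mem_nhds hx')) (continuousAt_extChartAt' hx)
    -- The density is continuous, so that near `x` it is almost constant.
    have hW : ∀ᶠ y in 𝓝 x, chartDensity x₀ (extChartAt 𝕀 x₀ y) < s * ρ₁ ∧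
        ρ₁ < s * chartDensity x₀ (extChartAt 𝕀 x₀ y) := by
      refine (hcont.eventually (gt_mem_nhds (by nlinarith))).and
        ((hcont.const_mul (s : ℝ)).eventually (lt_mem_nhds ?_))
      change ρ₁ < s * ρ₁
      nlinarith
    refine ⟨U ∩ {y | chartDensity x₀ (extChartAt 𝕀 x₀ y) < s * ρ₁ ∧
        ρ₁ < s * chartDensity x₀ (extChartAt 𝕀 x₀ y)}, inter_mem hU hW, fun A hAV hA => ?_⟩
    have hAs : A ⊆ (extChartAt 𝕀 x₀).source := fun y hy => (hAV hy).2
    have himg : (μHE[n + 1] : Measure 𝔼) ((fun y => B (extChartAt 𝕀 x₀ y)) '' A) =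
        ENNReal.ofReal ρ₁ * volume (extChartAt 𝕀 x₀ '' A) := by
      rw [EuclideanSpace.euclideanHausdorffMeasure_eq_volume, ← hB]
      rw [show (fun y => B (extChartAt 𝕀 x₀ y)) '' A = B '' (extChartAt 𝕀 x₀ '' A) by
        rw [image_image]]
      exact Measure.addHaar_image_continuousLinearMap _ B _
    have hmeas := measurableSet_image_extChartAt hA hAs
    have h1 : riemVol n A ≤ (s : ℝ≥0∞) ^ (n + 1) *
        (ENNReal.ofReal ρ₁ * volume (extChartAt 𝕀 x₀ '' A)) := by
      rw [← himg]
      exact euclideanHausdorffMeasure_le_image (n + 1)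
        fun y hy z hz => (hUB y (hAV hy).1.1 z (hAV hz).1.1).1
    have h2 : ENNReal.ofReal ρ₁ * volume (extChartAt 𝕀 x₀ '' A) ≤
        (s : ℝ≥0∞) ^ (n + 1) * riemVol n A := by
      rw [← himg]
      exact euclideanHausdorffMeasure_image_le (n + 1)
        fun y hy z hz => (hUB y (hAV hy).1.1 z (hAV hz).1.1).2
    have h3 : ENNReal.ofReal ρ₁ * volume (extChartAt 𝕀 x₀ '' A) ≤
        s * chartMeasure (n := n) x₀ A := by
      rw [chartMeasure_apply hA hAs, ← setLIntegral_const,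
        ← lintegral_const_mul' _ _ ENNReal.coe_ne_top]
      refine setLIntegral_mono' hmeas ?_
      rintro _ ⟨y, hy, rfl⟩
      rw [← ENNReal.ofReal_coe_nnreal, ← ENNReal.ofReal_mul (by positivity)]
      exact ENNReal.ofReal_le_ofReal (hAV hy).1.2.2.le
    have h4 : chartMeasure (n := n) x₀ A ≤
        s * (ENNReal.ofReal ρ₁ * volume (extChartAt 𝕀 x₀ '' A)) := by
      rw [chartMeasure_apply hA hAs, ← setLIntegral_const,
        ← lintegral_const_mul' _ _ ENNReal.coe_ne_top]
      refine setLIntegral_mono' hmeas ?_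
      rintro _ ⟨y, hy, rfl⟩
      rw [← ENNReal.ofReal_coe_nnreal, ← ENNReal.ofReal_mul (by positivity)]
      exact ENNReal.ofReal_le_ofReal (hAV hy).1.2.1.le
    rw [← hsr]
    push_cast
    constructor
    · exact h1.trans (by rw [mul_assoc]; gcongr)
    · refine h4.trans ?_
      rw [mul_comm ((s : ℝ≥0∞) ^ (n + 1)), mul_assoc]
      gcongr
  ext A hA
  rw [Measure.restrict_apply hA]
  -- The measure in coordinates is carried by the domain of the chart.
  have h0 : chartMeasure (n := n) x₀ A =
      chartMeasure (n := n) x₀ (A ∩ (extChartAt 𝕀 x₀).source) := by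
    have h1 : chartMeasure (n := n) x₀ (extChartAt 𝕀 x₀).sourceᶜ = 0 := by
      have hm : AEMeasurable (extChartAt 𝕀 x₀).symm
          ((volume.restrict (extChartAt 𝕀 x₀).target).withDensity
            fun z => ENNReal.ofReal (chartDensity x₀ z)) :=
        (aemeasurable_extChartAt_symm x₀).mono_ac (withDensity_absolutelyContinuous _ _)
      rw [chartMeasure, Measure.map_apply_of_aemeasurable hm
        (isOpen_extChartAt_source (I := 𝕀) x₀).measurableSet.compl]
      refine withDensity_absolutelyContinuous _ _ ?_
      rw [Measure.restrict_apply₀' (measurableSet_extChartAt_target x₀).nullMeasurableSet]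
      refine measure_mono_null (t := ∅) (subset_empty_iff.2 ?_) measure_empty
      refine eq_empty_of_forall_notMem fun z hz => hz.1 ((extChartAt 𝕀 x₀).map_target hz.2)
    exact (measure_inter_conull' (measure_mono_null (fun z hz => hz.2) h1)).symm
  have hAs := hA.inter (isOpen_extChartAt_source (I := 𝕀) x₀).measurableSet
  rw [h0]
  refine le_antisymm ?_ ?_
  · exact measure_le_of_forall_nhds (fun x hx r hr =>
      (key x hx r hr).imp fun V hV => ⟨hV.1, fun A h1 h2 => (hV.2 A h1 h2).1⟩) hAs
        inter_subset_right
  · exact measure_le_of_forall_nhds (fun x hx r hr =>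
      (key x hx r hr).imp fun V hV => ⟨hV.1, fun A h1 h2 => (hV.2 A h1 h2).2⟩) hAs
        inter_subset_right

end Density

/-! ### The coarea inequality -/

section Coarea

variable {n : ℕ} {M : Type*} [MetricSpace M]
    [ChartedSpace (EuclideanSpace ℝ (Fin (n + 1))) M] [IsManifold (𝓡 (n + 1)) ∞ M]
    [RiemannianBundle (fun x : M => TangentSpace (𝓡 (n + 1)) x)]
    [IsContMDiffRiemannianBundle (𝓡 (n + 1)) ∞ (EuclideanSpace ℝ (Fin (n + 1)))
      (fun x : M => TangentSpace (𝓡 (n + 1)) x)]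

local notation "𝔼" => EuclideanSpace ℝ (Fin (n + 1))
local notation "𝕀" => 𝓡 (n + 1)

/-- The derivative of a real function in the direction of a tangent vector, as a real number. -/
abbrev dirDeriv (f : M → ℝ) (x : M) (U : TangentSpace (𝓡 (n + 1)) x) : ℝ :=
  mfderiv (𝓡 (n + 1)) 𝓘(ℝ, ℝ) f x U

lemma mfderiv_eq_fderiv_coordMap {f : M → ℝ} {x₀ x : M} (hf : MDifferentiableAt 𝕀 𝓘(ℝ, ℝ) f x)
    (hx : x ∈ (chartAt 𝔼 x₀).source) (U : TangentSpace 𝕀 x) :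
    dirDeriv f x U =
      fderiv ℝ (f ∘ (extChartAt 𝕀 x₀).symm) (extChartAt 𝕀 x₀ x) (coordMap x₀ x U) := by
  have hxs : x ∈ (extChartAt 𝕀 x₀).source := by rwa [extChartAt_source]
  have hinv := (extChartAt 𝕀 x₀).left_inv hxs
  have h1 : MDifferentiableAt 𝓘(ℝ, 𝔼) 𝓘(ℝ, ℝ) (f ∘ (extChartAt 𝕀 x₀).symm)
      (extChartAt 𝕀 x₀ x) := by
    refine MDifferentiableAt.comp (I' := 𝕀) _ (by rwa [hinv]) ?_
    exact ((contMDiffOn_extChartAt_symm (n := 1) x₀).contMDiffAt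
      ((isOpen_extChartAt_target x₀).mem_nhds ((extChartAt 𝕀 x₀).map_source hxs))).mdifferentiableAt
      one_ne_zero
  have h2 := h1.hasMFDerivAt.comp x (hasMFDerivAt_extChartAt_coordMap hx)
  have h3 : (f ∘ (extChartAt 𝕀 x₀).symm) ∘ extChartAt 𝕀 x₀ =ᶠ[𝓝 x] f := by
    filter_upwards [extChartAt_source_mem_nhds' hxs] with y hy
    simp only [Function.comp_apply, (extChartAt 𝕀 x₀).left_inv hy]
  have h4 := (h2.congr_of_eventuallyEq h3.symm).mfderiv
  rw [dirDeriv, h4, mfderiv_eq_fderiv]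
  rfl

lemma contDiffOn_comp_extChartAt_symm {f : M → ℝ} (hf : ContMDiff 𝕀 𝓘(ℝ, ℝ) ∞ f) (x₀ : M) :
    ContDiffOn ℝ ∞ (f ∘ (extChartAt 𝕀 x₀).symm) (extChartAt 𝕀 x₀).target := by
  rw [← contMDiffOn_iff_contDiffOn]
  exact hf.comp_contMDiffOn (contMDiffOn_extChartAt_symm x₀)

lemma mfderiv_eq_zero_iff {f : M → ℝ} {x₀ x : M} (hf : MDifferentiableAt 𝕀 𝓘(ℝ, ℝ) f x)
    (hx : x ∈ (chartAt 𝔼 x₀).source) : mfderiv 𝕀 𝓘(ℝ, ℝ) f x = 0 ↔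
      fderiv ℝ (f ∘ (extChartAt 𝕀 x₀).symm) (extChartAt 𝕀 x₀ x) = 0 := by
  constructor
  · intro h
    ext v
    have h1 := mfderiv_eq_fderiv_coordMap hf hx (frameMap x₀ x v)
    rw [coordMap_frameMap hx, dirDeriv, h] at h1
    exact h1.symm
  · intro h
    ext U
    have h1 := mfderiv_eq_fderiv_coordMap hf hx U
    rw [h] at h1
    exact h1

lemma continuousAt_fderiv_comp_extChartAt_symm {f : M → ℝ} (hf : ContMDiff 𝕀 𝓘(ℝ, ℝ) ∞ f)
    {x₀ x : M} (hx : x ∈ (extChartAt 𝕀 x₀).source) :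
    ContinuousAt (fun x => fderiv ℝ (f ∘ (extChartAt 𝕀 x₀).symm) (extChartAt 𝕀 x₀ x)) x := by
  refine ContinuousAt.comp (g := fderiv ℝ (f ∘ (extChartAt 𝕀 x₀).symm)) ?_
    (continuousAt_extChartAt' hx)
  exact ((contDiffOn_comp_extChartAt_symm hf x₀).continuousOn_fderiv_of_isOpen
    (isOpen_extChartAt_target x₀) (by simp)).continuousAt
      ((isOpen_extChartAt_target x₀).mem_nhds ((extChartAt 𝕀 x₀).map_source hx))

lemma isOpen_mfderiv_ne_zero {f : M → ℝ} (hf : ContMDiff 𝕀 𝓘(ℝ, ℝ) ∞ f) :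
    IsOpen {x | mfderiv 𝕀 𝓘(ℝ, ℝ) f x ≠ 0} := by
  rw [isOpen_iff_mem_nhds]
  intro x hx
  have hfd : ∀ x, MDifferentiableAt 𝕀 𝓘(ℝ, ℝ) f x := fun x => hf.mdifferentiableAt (by simp)
  rw [mem_ofPred_eq, Ne, mfderiv_eq_zero_iff (hfd x) (mem_chart_source 𝔼 x)] at hx
  filter_upwards [(continuousAt_fderiv_comp_extChartAt_symm hf
    (mem_extChartAt_source x)).eventually_ne hx,
    extChartAt_source_mem_nhds (I := 𝕀) x] with y hy hy'
  rw [extChartAt_source] at hy'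
  rwa [Ne, mfderiv_eq_zero_iff (hfd y) hy']

lemma hasMFDerivAt_prodMk_space {E₁ E₂ : Type*} [NormedAddCommGroup E₁] [NormedSpace ℝ E₁]
    [NormedAddCommGroup E₂] [NormedSpace ℝ E₂] {G : M → E₁} {H : M → E₂} {x : M}
    {G' : TangentSpace 𝕀 x →L[ℝ] E₁} {H' : TangentSpace 𝕀 x →L[ℝ] E₂}
    (hG : HasMFDerivAt 𝕀 𝓘(ℝ, E₁) G x G') (hH : HasMFDerivAt 𝕀 𝓘(ℝ, E₂) H x H') :
    HasMFDerivAt 𝕀 𝓘(ℝ, E₁ × E₂) (fun y => (G y, H y)) x (G'.prod H') :=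
  ⟨hG.1.prodMk hH.1, hG.2.prodMk hH.2⟩

/-- Near `x₀`, the norm of the differential of `f` is at most `r` times a bound for it at `x₀`. -/
lemma eventually_mfderiv_le {f : M → ℝ} (hf : ContMDiff 𝕀 𝓘(ℝ, ℝ) ∞ f) (x₀ : M) {l r : ℝ}
    (hl : 0 < l) (hr : 1 < r)
    (hlf : ∀ U : TangentSpace 𝕀 x₀, dirDeriv f x₀ U ≤ l * ‖U‖) :
    ∀ᶠ x in 𝓝 x₀, ∀ U : TangentSpace 𝕀 x, ‖U‖ ≤ 1 →
      dirDeriv f x U ≤ r * l := by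
  obtain ⟨s, hs1, hsr⟩ := exists_between hr
  have hfd : ∀ x, MDifferentiableAt 𝕀 𝓘(ℝ, ℝ) f x := fun x => hf.mdifferentiableAt (by simp)
  let C' : TangentSpace 𝕀 x₀ →L[ℝ] 𝔼 := coordMap (n := n) x₀ x₀
  let K : ℝ := ‖C'‖
  have hK0 : 0 ≤ K := norm_nonneg C'
  have hε : 0 < l * (r - s) / (K * s + 1) := by
    have : 0 < r - s := by linarith
    positivity
  let D : 𝔼 → 𝔼 →L[ℝ] ℝ := fderiv ℝ (f ∘ (extChartAt 𝕀 x₀).symm)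
  have hDc : ContinuousAt (fun x => D (extChartAt 𝕀 x₀ x)) x₀ := by
    exact continuousAt_fderiv_comp_extChartAt_symm hf (mem_extChartAt_source x₀)
  filter_upwards [hDc.eventually (Metric.ball_mem_nhds _ hε),
    eventually_norm_frameMap_coordMap_le (n := n) x₀ hs1,
    extChartAt_source_mem_nhds (I := 𝕀) x₀] with x h1 h2 h3 U hU
  rw [extChartAt_source] at h3
  -- Compare the differentials at `x` and at `x₀` on vectors with the same coordinates.
  set u : 𝔼 := coordMap x₀ x U with hu
  rw [mfderiv_eq_fderiv_coordMap (hfd x) h3 U]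
  have h4 : ‖frameMap x₀ x₀ u‖ ≤ s := (h2 U).trans (by nlinarith)
  have h5 : D (extChartAt 𝕀 x₀ x₀) u ≤ l * s := by
    have h6 := hlf (frameMap x₀ x₀ u)
    rw [mfderiv_eq_fderiv_coordMap (hfd x₀) (mem_chart_source _ _),
      coordMap_frameMap (mem_chart_source _ _)] at h6
    exact h6.trans (by gcongr)
  have h7 : ‖u‖ ≤ K * s := by
    have h8 := C'.le_opNorm (frameMap x₀ x₀ u)
    have h9 : C' (frameMap x₀ x₀ u) = u := coordMap_frameMap (mem_chart_source _ _) u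
    rw [h9] at h8
    exact h8.trans (by gcongr)
  have h10 : (D (extChartAt 𝕀 x₀ x) - D (extChartAt 𝕀 x₀ x₀)) u ≤
      l * (r - s) / (K * s + 1) * (K * s) := by
    refine (Real.le_norm_self _).trans ((ContinuousLinearMap.le_opNorm _ _).trans ?_)
    gcongr
    rw [dist_eq_norm] at h1
    exact h1.le
  have h11 : l * (r - s) / (K * s + 1) * (K * s) ≤ l * (r - s) := by
    rw [div_mul_eq_mul_div, div_le_iff₀ (by positivity)]
    have : 0 ≤ l * (r - s) := mul_nonneg hl.le (by linarith)
    nlinarith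
  rw [sub_apply] at h10
  change D (extChartAt 𝕀 x₀ x) u ≤ r * l
  linarith

variable [MeasurableSpace M] [BorelSpace M] [IsRiemannianManifold (𝓡 (n + 1)) M]

lemma riemVol_eq_setLIntegral [SecondCountableTopology M] {x₀ : M} {A : Set M}
    (hA : MeasurableSet A) (hAs : A ⊆ (extChartAt 𝕀 x₀).source) :
    riemVol n A = ∫⁻ z in extChartAt 𝕀 x₀ '' A, ENNReal.ofReal (chartDensity x₀ z) := by
  rw [← chartMeasure_apply hA hAs, ← riemVol_restrict_chart, Measure.restrict_apply hA,
    inter_eq_left.2 hAs]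

instance isLocallyFiniteMeasure_riemVol [SecondCountableTopology M] :
    IsLocallyFiniteMeasure (riemVol n : Measure M) := by
  refine ⟨fun x => ?_⟩
  have hc : ContinuousAt (chartDensity x) (extChartAt 𝕀 x x) :=
    (contDiffOn_chartDensity x).continuousOn.continuousAt (extChartAt_target_mem_nhds x)
  obtain ⟨ε, hε, hB⟩ := Metric.nhds_basis_closedBall.mem_iff.1 (Filter.inter_mem
    (extChartAt_target_mem_nhds (I := 𝕀) x)
    (hc.eventually (gt_mem_nhds (lt_add_one (chartDensity x (extChartAt 𝕀 x x))))))
  set B := Metric.closedBall (extChartAt 𝕀 x x) ε with hBdef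
  set A : Set M := (extChartAt 𝕀 x).source ∩ extChartAt 𝕀 x ⁻¹' (Metric.ball (extChartAt 𝕀 x x) ε)
  have hAo : IsOpen A :=
    (continuousOn_extChartAt x).isOpen_inter_preimage (isOpen_extChartAt_source x)
      Metric.isOpen_ball
  refine ⟨A, hAo.mem_nhds ⟨mem_extChartAt_source x, Metric.mem_ball_self hε⟩, ?_⟩
  rw [riemVol_eq_setLIntegral hAo.measurableSet inter_subset_left]
  have hAB : extChartAt 𝕀 x '' A ⊆ B := by
    rintro _ ⟨y, hy, rfl⟩
    exact Metric.ball_subset_closedBall hy.2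
  refine (lintegral_mono_set hAB).trans_lt ?_
  refine (setLIntegral_mono' Metric.isClosed_closedBall.measurableSet
    (g := fun _ => ENNReal.ofReal (chartDensity x (extChartAt 𝕀 x x) + 1))
    fun z hz => ENNReal.ofReal_le_ofReal (hB hz).2.le).trans_lt ?_
  rw [setLIntegral_const]
  exact ENNReal.mul_lt_top ENNReal.ofReal_lt_top (isCompact_closedBall _ _).measure_lt_top

instance isOpenPosMeasure_riemVol [SecondCountableTopology M] :
    (riemVol n : Measure M).IsOpenPosMeasure := by
  refine ⟨fun U hU ⟨x, hx⟩ h0 => ?_⟩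
  set A : Set M := (extChartAt 𝕀 x).source ∩ U
  have hAo : IsOpen A := (isOpen_extChartAt_source x).inter hU
  have h1 : riemVol n A = 0 := measure_mono_null inter_subset_right h0
  have himg := (extChartAt 𝕀 x).image_eq_target_inter_inv_preimage
    (s := A) (inter_subset_left)
  -- The image of the part of `U` in the chart is open, and the density is positive.
  have hio : IsOpen (extChartAt 𝕀 x '' A) := by
    rw [himg]
    exact (continuousOn_extChartAt_symm x).isOpen_inter_preimage (isOpen_extChartAt_target x) hAo
  rw [riemVol_eq_setLIntegral hAo.measurableSet inter_subset_left,
    setLIntegral_eq_zero_iff' hio.measurableSet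
      (((aemeasurable_chartDensity x).mono_measure (Measure.restrict_mono
        (by rw [himg]; exact inter_subset_left) le_rfl)).ennreal_ofReal)] at h1
  have h2 : volume (extChartAt 𝕀 x '' A) = 0 := by
    refine measure_mono_null (fun z hz => ?_) h1
    intro hz0
    have h3 : z ∈ (extChartAt 𝕀 x).target := by rw [himg] at hz; exact hz.1
    exact absurd (hz0 hz) (ENNReal.ofReal_pos.2 (chartDensity_pos x h3)).ne'
  have h2' := (hio.measure_eq_zero_iff (volume : Measure 𝔼)).1 h2
  have h4 := mem_image_of_mem (extChartAt 𝕀 x) (show x ∈ A from ⟨mem_extChartAt_source x, hx⟩)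
  rw [h2'] at h4
  exact h4

lemma setIntegral_chart_source [SecondCountableTopology M] (x₀ : M) {g : M → ℝ}
    (hg : Measurable g) :
    ∫ x in (extChartAt 𝕀 x₀).source, g x ∂(riemVol n) =
      ∫ z in (extChartAt 𝕀 x₀).target, chartDensity x₀ z * g ((extChartAt 𝕀 x₀).symm z) := by
  have hm : AEMeasurable (extChartAt 𝕀 x₀).symm
      ((volume.restrict (extChartAt 𝕀 x₀).target).withDensity
        fun z => ENNReal.ofReal (chartDensity x₀ z)) :=
    (aemeasurable_extChartAt_symm x₀).mono_ac (withDensity_absolutelyContinuous _ _)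
  rw [riemVol_restrict_chart, chartMeasure, integral_map hm hg.aestronglyMeasurable,
    integral_withDensity_eq_integral_toReal_smul₀ (aemeasurable_chartDensity x₀).ennreal_ofReal
      (by simp)]
  refine setIntegral_congr_fun (measurableSet_extChartAt_target x₀) fun z hz => ?_
  simp only [smul_eq_mul, ENNReal.toReal_ofReal (chartDensity_pos x₀ hz).le]

/-- The coarea inequality near a regular point, up to a factor close to `1`. -/
lemma exists_nhds_coarea_le {f : M → ℝ} (hf : ContMDiff 𝕀 𝓘(ℝ, ℝ) ∞ f) {x₀ : M}
    (hx₀ : mfderiv 𝕀 𝓘(ℝ, ℝ) f x₀ ≠ 0) {X : ∀ x : M, TangentSpace 𝕀 x} (hX : ∀ x, ‖X x‖ ≤ 1)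
    {r : ℝ≥0} (hr : 1 < r) :
    ∃ V ∈ 𝓝 x₀, ∀ A ⊆ V, MeasurableSet A →
      ∫⁻ x in A, ENNReal.ofReal (dirDeriv f x (X x)) ∂(riemVol n) ≤
        r * ∫⁻ s : ℝ, (μHE[n] : Measure M) (A ∩ f ⁻¹' {s}) := by
  -- The factor `s` is lost once for the differential, `n + 1` times for the volume and `n` times
  -- for the area.
  obtain ⟨s, hs1, hsr⟩ : ∃ s : ℝ≥0, 1 < s ∧ s ^ (2 * n + 2) = r := by
    refine ⟨r ^ (1 / ((2 * n + 2 : ℕ) : ℝ)), NNReal.one_lt_rpow hr (by positivity), ?_⟩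
    rw [← NNReal.rpow_natCast, ← NNReal.rpow_mul, one_div_mul_cancel (by positivity),
      NNReal.rpow_one]
  let df : 𝔼 →L[ℝ] ℝ := mfderiv 𝕀 𝓘(ℝ, ℝ) f x₀
  -- the gradient of `f` at `x₀`, in an orthonormal basis
  obtain ⟨w, hw⟩ : ∃ w : 𝔼, ∀ U : TangentSpace 𝕀 x₀, df U = inner ℝ w (tangentIsometry x₀ U) := by
    let g : 𝔼 →L[ℝ] ℝ := (mfderiv 𝕀 𝓘(ℝ, ℝ) f x₀) ∘L
      ((tangentIsometry (n := n) x₀).symm.toContinuousLinearEquiv : 𝔼 →L[ℝ] TangentSpace 𝕀 x₀)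
    refine ⟨(InnerProductSpace.toDual ℝ 𝔼).symm g, fun U => ?_⟩
    rw [InnerProductSpace.toDual_symm_apply]
    exact congr_arg df ((tangentIsometry x₀).symm_apply_apply U).symm
  have hw0 : w ≠ 0 := by
    rintro rfl
    exact hx₀ (ContinuousLinearMap.ext fun U => (hw U).trans (inner_zero_left _))
  set l : ℝ := ‖w‖ with hl
  have hl0 : 0 < l := norm_pos_iff.2 hw0
  let B : 𝔼 →L[ℝ] 𝔼 := orthoFrameMap x₀ x₀
  set v : 𝔼 := (l ^ 2)⁻¹ • w with hv
  have hwv : inner ℝ w v = 1 := by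
    rw [hv, inner_smul_right, real_inner_self_eq_norm_sq]
    exact inv_mul_cancel₀ (by positivity)
  have hv0 : v ≠ 0 := by rintro h; rw [h, inner_zero_right] at hwv; exact zero_ne_one hwv
  -- The map `F` is the chart at `x₀`, corrected such that `f` becomes linear: its derivative at
  -- `x₀` is an isometry, and it maps the level sets of `f` to parallel hyperplanes.
  let F : M → 𝔼 := fun x => B (extChartAt 𝕀 x₀ x) +
    (f x - inner ℝ w (B (extChartAt 𝕀 x₀ x))) • v
  have hwF : ∀ x, inner ℝ w (F x) = f x := fun x => by
    simp only [F]
    rw [inner_add_right, inner_smul_right, hwv]; ring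
  have hc : x₀ ∈ (chartAt 𝔼 x₀).source := mem_chart_source _ _
  have hG : ContMDiffAt 𝕀 𝓘(ℝ, 𝔼) 1 (fun x => B (extChartAt 𝕀 x₀ x)) x₀ :=
    B.contMDiff.contMDiffAt.comp x₀ (contMDiffAt_extChartAt' hc)
  have hGL : HasMFDerivAt 𝕀 𝓘(ℝ, 𝔼) (fun x => B (extChartAt 𝕀 x₀ x)) x₀
      (B ∘L coordMap (n := n) x₀ x₀) := (B.hasMFDerivAt (x := extChartAt 𝕀 x₀ x₀)).comp x₀
    (hasMFDerivAt_extChartAt_coordMap hc)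
  have hf1 : ContMDiffAt 𝕀 𝓘(ℝ, ℝ) 1 f x₀ := hf.contMDiffAt.of_le (by simp)
  -- `F` is a function of the chart and of `f`
  let T : 𝔼 × ℝ →L[ℝ] 𝔼 := ContinuousLinearMap.fst ℝ 𝔼 ℝ +
    (ContinuousLinearMap.snd ℝ 𝔼 ℝ - (innerSL ℝ w) ∘L ContinuousLinearMap.fst ℝ 𝔼 ℝ).smulRight v
  have hFT : F = fun x => T (B (extChartAt 𝕀 x₀ x), f x) := rfl
  have hF : ContMDiffAt 𝕀 𝓘(ℝ, 𝔼) 1 F x₀ := by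
    rw [hFT]
    exact T.contMDiff.contMDiffAt.comp x₀ (hG.prodMk_space hf1)
  have hFL : HasMFDerivAt 𝕀 𝓘(ℝ, 𝔼) F x₀
      (T ∘L ((B ∘L coordMap (n := n) x₀ x₀).prod (mfderiv 𝕀 𝓘(ℝ, ℝ) f x₀))) := by
    have h1 := hasMFDerivAt_prodMk_space hGL (hf1.mdifferentiableAt one_ne_zero).hasMFDerivAt
    have h2 := T.hasMFDerivAt (x := (B (extChartAt 𝕀 x₀ x₀), f x₀))
    rw [hFT]
    exact HasMFDerivAt.comp (g := T) x₀ h2 h1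
  have hBc : ∀ U : TangentSpace 𝕀 x₀, B (coordMap x₀ x₀ U) = tangentIsometry x₀ U := fun U =>
    congr_arg (tangentIsometry x₀) (frameMap_coordMap hc U)
  obtain ⟨U, hU, hUF⟩ := exists_nhds_edist_le_of_isometric_mfderiv (n := n) (x₀ := x₀) (F := F)
    (L := T ∘L ((B ∘L coordMap (n := n) x₀ x₀).prod (mfderiv 𝕀 𝓘(ℝ, ℝ) f x₀)))
    (fun U => by
      have : T (B (coordMap x₀ x₀ U), df U) = tangentIsometry x₀ U := by
        rw [hBc, hw]
        simp [T]
      exact (congr_arg norm this).trans ((tangentIsometry x₀).norm_map U)) hF hFL hs1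
  have hdf : ∀ U : TangentSpace 𝕀 x₀, dirDeriv f x₀ U ≤ l * ‖U‖ := fun U => by
    refine (hw U).le.trans ((real_inner_le_norm _ _).trans ?_)
    rw [(tangentIsometry x₀).norm_map]
  have hev := eventually_mfderiv_le hf x₀ hl0 (r := s) (by exact_mod_cast hs1) hdf
  refine ⟨U ∩ ({x | ∀ U : TangentSpace 𝕀 x, ‖U‖ ≤ 1 → dirDeriv f x U ≤ (s : ℝ) * l} ∩
    (extChartAt 𝕀 x₀).source), inter_mem hU (inter_mem hev (extChartAt_source_mem_nhds x₀)),
    fun A hAV hA => ?_⟩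
  have hAs : A ⊆ (extChartAt 𝕀 x₀).source := fun x hx => (hAV hx).2.2
  have hinj : InjOn F A := fun x hx y hy hxy => by
    have := (hUF x (hAV hx).1 y (hAV hy).1).1
    rw [hxy, edist_self, mul_zero] at this
    exact edist_le_zero.1 this
  have hFA : MeasurableSet (F '' A) := by
    have h1 : F '' A = (F ∘ (extChartAt 𝕀 x₀).symm) '' (extChartAt 𝕀 x₀ '' A) := by
      rw [image_image]
      exact image_congr fun x hx => by
        simp only [Function.comp_apply, (extChartAt 𝕀 x₀).left_inv (hAs hx)]
    have hsub : extChartAt 𝕀 x₀ '' A ⊆ (extChartAt 𝕀 x₀).target := by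
      rintro _ ⟨x, hx, rfl⟩; exact (extChartAt 𝕀 x₀).map_source (hAs hx)
    have hsym : ∀ z ∈ extChartAt 𝕀 x₀ '' A, (extChartAt 𝕀 x₀).symm z ∈ A := by
      rintro _ ⟨x, hx, rfl⟩; rwa [(extChartAt 𝕀 x₀).left_inv (hAs hx)]
    rw [h1]
    refine (measurableSet_image_extChartAt hA hAs).image_of_continuousOn_injOn ?_ ?_
    · have hFc : ContinuousOn F (extChartAt 𝕀 x₀).source := by
        have h2 := B.continuous.comp_continuousOn (continuousOn_extChartAt (I := 𝕀) x₀)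
        exact T.continuous.comp_continuousOn (h2.prodMk hf.continuous.continuousOn)
      exact hFc.comp ((continuousOn_extChartAt_symm x₀).mono hsub) fun z hz => hAs (hsym z hz)
    · exact hinj.comp ((extChartAt 𝕀 x₀).symm.injOn.mono hsub) hsym
  have hslice : ∀ t : ℝ,
      F '' A ∩ (AffineSubspace.mk' (t • v +ᵥ (0 : 𝔼)) (Submodule.span ℝ {v})ᗮ : Set 𝔼) =
      F '' (A ∩ f ⁻¹' {t}) := fun t => by
    have h1 : ∀ y : 𝔼, y ∈ (AffineSubspace.mk' (t • v +ᵥ (0 : 𝔼)) (Submodule.span ℝ {v})ᗮ : Set 𝔼) ↔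
        inner ℝ w y = t := fun y => by
      rw [SetLike.mem_coe, AffineSubspace.mem_mk',
        Submodule.mem_orthogonal_singleton_iff_inner_right]
      have h2 : inner ℝ v (y -ᵥ (t • v +ᵥ (0 : 𝔼))) = (l ^ 2)⁻¹ * (inner ℝ w y - t) := by
        rw [vsub_eq_sub, vadd_eq_add, add_zero, inner_sub_right, inner_smul_right]
        nth_rewrite 1 2 [hv]
        rw [inner_smul_left, inner_smul_left, hwv]
        simp; ring
      rw [h2, mul_eq_zero, or_iff_right (by positivity), sub_eq_zero]
    ext y
    constructor
    · rintro ⟨⟨x, hx, rfl⟩, h2⟩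
      rw [h1, hwF] at h2
      exact ⟨x, ⟨hx, h2⟩, rfl⟩
    · rintro ⟨x, ⟨hx, h2⟩, rfl⟩
      exact ⟨⟨x, hx, rfl⟩, (h1 _).2 ((hwF x).trans h2)⟩
  -- The coarea formula for a linear function, that is, Fubini in `ℝ^(n+1)`.
  have hvol : (μHE[n + 1] : Measure 𝔼) (F '' A) =
      ENNReal.ofReal l⁻¹ * ∫⁻ t : ℝ, (μHE[n] : Measure 𝔼) (F '' (A ∩ f ⁻¹' {t})) := by
    have h1 := EuclideanGeometry.euclideanHausdorffMeasure_eq_lintegral (0 : 𝔼) hv0 hFA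
    rw [finrank_euclideanSpace_fin, Nat.add_sub_cancel] at h1
    have h2 : ‖v‖ = l⁻¹ := by
      rw [hv, norm_smul, ← hl, norm_inv, norm_pow, Real.norm_of_nonneg hl0.le]
      field_simp
    rw [h1, ← ofReal_norm, h2]
    simp_rw [hslice]
  calc ∫⁻ x in A, ENNReal.ofReal (dirDeriv f x (X x)) ∂(riemVol n)
      ≤ ∫⁻ x in A, ENNReal.ofReal (s * l) ∂(riemVol n) :=
        setLIntegral_mono' hA fun x hx => ENNReal.ofReal_le_ofReal ((hAV hx).2.1 _ (hX x))
    _ = s * ENNReal.ofReal l * riemVol n A := by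
        rw [setLIntegral_const, ENNReal.ofReal_mul (by positivity), ENNReal.ofReal_coe_nnreal]
    _ ≤ s * ENNReal.ofReal l * ((s : ℝ≥0∞) ^ (n + 1) * (μHE[n + 1] : Measure 𝔼) (F '' A)) := by
        gcongr
        exact euclideanHausdorffMeasure_le_image (n + 1)
          fun x hx y hy => (hUF x (hAV hx).1 y (hAV hy).1).1
    _ ≤ s * ENNReal.ofReal l * ((s : ℝ≥0∞) ^ (n + 1) * (ENNReal.ofReal l⁻¹ *
          ((s : ℝ≥0∞) ^ n * ∫⁻ t : ℝ, (μHE[n] : Measure M) (A ∩ f ⁻¹' {t})))) := by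
        have h1 : ∀ t : ℝ, (μHE[n] : Measure 𝔼) (F '' (A ∩ f ⁻¹' {t})) ≤
            (s : ℝ≥0∞) ^ n * (μHE[n] : Measure M) (A ∩ f ⁻¹' {t}) := fun t =>
          euclideanHausdorffMeasure_image_le n
            fun x hx y hy => (hUF x (hAV hx.1).1 y (hAV hy.1).1).2
        rw [hvol, ← lintegral_const_mul' ((s : ℝ≥0∞) ^ n) _ (by simp)]
        have h2 := lintegral_mono (μ := volume) h1
        gcongr
    _ = (ENNReal.ofReal l * ENNReal.ofReal l⁻¹) * ((s : ℝ≥0∞) ^ (2 * n + 2) *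
          ∫⁻ t : ℝ, (μHE[n] : Measure M) (A ∩ f ⁻¹' {t})) := by ring
    _ = r * ∫⁻ t : ℝ, (μHE[n] : Measure M) (A ∩ f ⁻¹' {t}) := by
        rw [← ENNReal.ofReal_mul hl0.le, mul_inv_cancel₀ hl0.ne', ENNReal.ofReal_one, one_mul,
          ← hsr]
        norm_cast

/-- The integral of a superadditive family, without measurability. -/
lemma tsum_lintegral_le_lintegral_tsum {α : Type*} [MeasurableSpace α] (μ : Measure α)
    (g : ℕ → α → ℝ≥0∞) : ∑' k, ∫⁻ a, g k a ∂μ ≤ ∫⁻ a, ∑' k, g k a ∂μ := by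
  have : ∀ s : Finset ℕ, ∑ k ∈ s, ∫⁻ a, g k a ∂μ ≤ ∫⁻ a, ∑ k ∈ s, g k a ∂μ := fun s => by
    induction s using Finset.induction_on with
    | empty => simp
    | insert i s hi ih =>
      simp only [Finset.sum_insert hi]
      exact (add_le_add_right ih _).trans (le_lintegral_add _ _)
  rw [ENNReal.tsum_eq_iSup_sum]
  exact iSup_le fun s => (this s).trans (lintegral_mono fun a => ENNReal.sum_le_tsum s)

/-- The coarea inequality. -/
lemma lintegral_mfderiv_le_lintegral_level [SecondCountableTopology M] {f : M → ℝ}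
    (hf : ContMDiff 𝕀 𝓘(ℝ, ℝ) ∞ f)
    {X : ∀ x : M, TangentSpace 𝕀 x} (hX : ∀ x, ‖X x‖ ≤ 1) {A : Set M} (hA : MeasurableSet A) :
    ∫⁻ x in A, ENNReal.ofReal (dirDeriv f x (X x)) ∂(riemVol n) ≤
        ∫⁻ s : ℝ, (μHE[n] : Measure M) (A ∩ f ⁻¹' {s}) := by
  -- Only the open set of regular points contributes.
  set R : Set M := {x | mfderiv 𝕀 𝓘(ℝ, ℝ) f x ≠ 0} with hR
  have hRm : MeasurableSet R := (isOpen_mfderiv_ne_zero hf).measurableSet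
  have hcrit : ∫⁻ x in A \ R, ENNReal.ofReal (dirDeriv f x (X x)) ∂(riemVol n) = 0 := by
    rw [← lintegral_zero (μ := (riemVol n).restrict (A \ R))]
    refine setLIntegral_congr_fun (hA.diff hRm) fun x hx => ?_
    have : mfderiv 𝕀 𝓘(ℝ, ℝ) f x = 0 := by simpa [hR] using hx.2
    rw [dirDeriv, this]
    exact ENNReal.ofReal_zero
  rw [← lintegral_inter_add_sdiff _ A hRm, hcrit, add_zero]
  refine le_trans ?_ (lintegral_mono fun s => measure_mono
    (inter_subset_inter_left _ (inter_subset_left (t := R))))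
  refine le_of_forall_nhds_le (U := R)
    (α := fun A => ∫⁻ x in A, ENNReal.ofReal (dirDeriv f x (X x)) ∂(riemVol n))
    (β := fun A => ∫⁻ s : ℝ, (μHE[n] : Measure M) (A ∩ f ⁻¹' {s}))
    (fun A hA hd => lintegral_iUnion_le _ _) (fun A hA hd => ?_) (by simp) (fun x hx r hr => ?_)
    (hA.inter hRm) inter_subset_right
  · refine (tsum_lintegral_le_lintegral_tsum _ _).trans (lintegral_mono fun s => ?_)
    have hs : MeasurableSet (f ⁻¹' {s}) := hf.continuous.measurable (measurableSet_singleton s)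
    rw [iUnion_inter, measure_iUnion (fun i j hij => (hd hij).mono inter_subset_left
      inter_subset_left) fun k => (hA k).inter hs]
  · obtain ⟨V, hV, h⟩ := exists_nhds_coarea_le hf hx hX hr
    exact ⟨V, hV, fun A hAV hA => h A (hAV.trans inter_subset_left) hA⟩

end Coarea

/-! ### The area of level sets in small balls -/

section Levels

variable {n : ℕ}

local notation "𝔼" => EuclideanSpace ℝ (Fin (n + 1))
local notation "𝕀" => 𝓡 (n + 1)

/-- The projection of Euclidean space that forgets the coordinate number `i`. -/
def dropCoord (i : Fin (n + 1)) (x : EuclideanSpace ℝ (Fin (n + 1))) : EuclideanSpace ℝ (Fin n) :=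
  WithLp.toLp 2 fun j => x (i.succAbove j)

lemma dropCoord_sub (i : Fin (n + 1)) (x y : 𝔼) :
    dropCoord i (x - y) = dropCoord i x - dropCoord i y := rfl

lemma norm_sub_smul_single (i : Fin (n + 1)) (w : 𝔼) :
    ‖w - w i • (EuclideanSpace.single i (1 : ℝ) : 𝔼)‖ = ‖dropCoord i w‖ := by
  rw [EuclideanSpace.norm_eq, EuclideanSpace.norm_eq, Fin.sum_univ_succAbove _ i]
  congr 1
  simp [dropCoord]

lemma norm_dropCoord_le (i : Fin (n + 1)) (w : 𝔼) : ‖dropCoord i w‖ ≤ ‖w‖ := by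
  rw [EuclideanSpace.norm_eq, EuclideanSpace.norm_eq, Fin.sum_univ_succAbove _ i]
  refine Real.sqrt_le_sqrt ?_
  simp only [dropCoord]
  nlinarith [sq_nonneg ‖w i‖]

/-- If on a convex set the differential of `u` is controlled by its value on a coordinate vector,
then each level set is there a Lipschitz graph over the other coordinates. -/
lemma norm_sub_le_of_level_eq {u : 𝔼 → ℝ} {d : 𝔼 → 𝔼 →L[ℝ] ℝ} {D : Set 𝔼} (hD : Convex ℝ D)
    (hu : ∀ x ∈ D, HasFDerivAt u (d x) x) {i : Fin (n + 1)} {C : ℝ}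
    (h0 : ∀ x ∈ D, d x (EuclideanSpace.single i 1) ≠ 0)
    (h : ∀ x ∈ D, ‖d x‖ ≤ C * |d x (EuclideanSpace.single i 1)|) {y z : 𝔼} (hy : y ∈ D)
    (hz : z ∈ D) (hyz : u y = u z) : ‖y - z‖ ≤ (1 + C) * ‖dropCoord i y - dropCoord i z‖ := by
  set w := y - z with hw
  have hγ : ∀ t ∈ Icc (0 : ℝ) 1, z + t • w ∈ D := fun t ht =>
    hD.add_smul_sub_mem hz hy ht
  have hg : ∀ t ∈ Icc (0 : ℝ) 1, HasDerivAt (fun t : ℝ => u (z + t • w)) (d (z + t • w) w) t :=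
    fun t ht => by
      have h1 : HasDerivAt (fun t : ℝ => z + t • w) w t := by
        simpa using ((hasDerivAt_id t).smul_const w).const_add z
      exact (hu _ (hγ t ht)).comp_hasDerivAt t h1
  -- By Rolle's theorem, `d x w = 0` for some `x` on the segment from `z` to `y`.
  obtain ⟨t, ht, h1⟩ := exists_hasDerivAt_eq_zero (f := fun t : ℝ => u (z + t • w))
    (f' := fun t => d (z + t • w) w) zero_lt_one
    (fun t ht => (hg t ht).continuousAt.continuousWithinAt) (by simp [hw, hyz])
    fun t ht => hg t (Ioo_subset_Icc_self ht)
  have hx := hγ t (Ioo_subset_Icc_self ht)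
  set x := z + t • w
  set e : 𝔼 := EuclideanSpace.single i 1 with he
  have h2 : w i * d x e = - d x (w - w i • e) := by
    rw [map_sub, map_smul, h1, smul_eq_mul]
    ring
  have h3 : |w i| * |d x e| ≤ C * |d x e| * ‖dropCoord i w‖ := by
    rw [← abs_mul, h2, abs_neg, ← norm_sub_smul_single]
    exact ((d x).le_opNorm _).trans (by gcongr; exact h x hx)
  have h4 : |w i| ≤ C * ‖dropCoord i w‖ := by
    have := abs_pos.2 (h0 x hx)
    nlinarith
  calc ‖w‖ = ‖w i • e + (w - w i • e)‖ := by rw [add_sub_cancel]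
    _ ≤ ‖w i • e‖ + ‖w - w i • e‖ := norm_add_le _ _
    _ = |w i| + ‖dropCoord i w‖ := by
      rw [norm_sub_smul_single, norm_smul, he, PiLp.norm_single, norm_one, mul_one,
        Real.norm_eq_abs]
    _ ≤ _ := by rw [← dropCoord_sub, ← hw]; linarith

/-- Some partial derivative is comparable to the norm of the differential. -/
lemma exists_norm_le_mul_apply_single (T : 𝔼 →L[ℝ] ℝ) :
    ∃ i, ‖T‖ ≤ (n + 1) * |T (EuclideanSpace.single i 1)| := by
  have h1 : ‖T‖ ≤ ∑ i, |T (EuclideanSpace.single i 1)| := by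
    refine T.opNorm_le_bound (Finset.sum_nonneg fun _ _ => abs_nonneg _) fun x => ?_
    have hx : x = ∑ i, x i • (EuclideanSpace.single i (1 : ℝ) : 𝔼) := by
      have := ((EuclideanSpace.basisFun (Fin (n + 1)) ℝ).sum_repr x).symm
      simpa only [EuclideanSpace.basisFun_repr, EuclideanSpace.basisFun_apply] using this
    conv_lhs => rw [hx, map_sum]
    rw [Finset.sum_mul]
    refine (norm_sum_le _ _).trans (Finset.sum_le_sum fun i _ => ?_)
    rw [map_smul, norm_smul, mul_comm]
    gcongr
    · exact (Real.norm_eq_abs _).le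
    · exact PiLp.norm_apply_le x i
  obtain ⟨i, -, hi⟩ := Finset.exists_max_image Finset.univ
    (fun i : Fin (n + 1) => |T (EuclideanSpace.single i 1)|) Finset.univ_nonempty
  refine ⟨i, h1.trans ((Finset.sum_le_card_nsmul _ _ _ fun j hj => hi j hj).trans_eq ?_)⟩
  simp

/-- Near a point that is not a degenerate critical point of `u`, the level sets of `u` are covered
by boundedly many Lipschitz graphs over coordinate hyperplanes. At a nondegenerate critical point
`p` with Hessian `A`, there is one graph for each coordinate vector `e` and each sign, in the convex
cone of all `x` with `κ |x - p| ≤ ± A (x - p) e`. -/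
lemma exists_nhds_level_graphs {u : 𝔼 → ℝ} {U : Set 𝔼} (hU : IsOpen U) (hu : ContDiffOn ℝ ∞ u U)
    {p : 𝔼} (hp : p ∈ U) (hp' : fderiv ℝ u p = 0 → ∀ v : 𝔼,
      (∀ w, fderiv ℝ (fderiv ℝ u) p v w = 0) → v = 0) :
    ∃ W ∈ 𝓝 p, ∃ L : ℝ≥0, ∃ D : Fin (n + 1) → Bool → Set 𝔼, W ⊆ insert p (⋃ i, ⋃ b, D i b) ∧
      ∀ i b, ∀ y ∈ D i b, ∀ z ∈ D i b, u y = u z →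
        ‖y - z‖ ≤ L * ‖dropCoord i y - dropCoord i z‖ := by
  have hd : ∀ x ∈ U, HasFDerivAt u (fderiv ℝ u x) x := fun x hx =>
    ((hu.contDiffAt (hU.mem_nhds hx)).differentiableAt (by simp)).hasFDerivAt
  have hdd : ContDiffOn ℝ 1 (fderiv ℝ u) U := hu.fderiv_of_isOpen hU (by norm_cast)
  have hn : (0 : ℝ) < n + 1 := by positivity
  by_cases hcrit : fderiv ℝ u p = 0
  · set A := fderiv ℝ (fderiv ℝ u) p with hA
    have hAd : HasFDerivAt (fderiv ℝ u) A p :=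
      ((hdd.contDiffAt (hU.mem_nhds hp)).differentiableAt (by simp)).hasFDerivAt
    have hker : LinearMap.ker (A : 𝔼 →ₗ[ℝ] (𝔼 →L[ℝ] ℝ)) = ⊥ := by
      rw [LinearMap.ker_eq_bot']
      exact fun v hv => hp' hcrit v fun w => by
        have : A v = 0 := hv
        rw [this]; rfl
    obtain ⟨K, hK, hK'⟩ := LinearMap.exists_antilipschitzWith _ hker
    have hK2 : ∀ v, ‖v‖ ≤ K * ‖A v‖ := fun v => by
      simpa using hK'.le_mul_dist v 0
    have hK0 : (0 : ℝ) < K := by exact_mod_cast hK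
    -- As `K` bounds the inverse of the Hessian, the cones with this `κ` cover everything but `p`.
    set κ : ℝ := 1 / (K * (n + 1)) with hκdef
    have hκ : 0 < κ := by positivity
    have hev := (hAd.isLittleO.def (half_pos hκ)).and (hU.mem_nhds hp)
    obtain ⟨r, hr, hball⟩ := Metric.eventually_nhds_iff_ball.1 hev
    let σ : Bool → ℝ := fun b => if b then 1 else -1
    have hσ : ∀ b, |σ b| = 1 := fun b => by cases b <;> simp [σ]
    let D : Fin (n + 1) → Bool → Set 𝔼 := fun i b => {x | x ∈ Metric.ball p r ∧
      κ * ‖x - p‖ ≤ σ b * A (x - p) (EuclideanSpace.single i 1) ∧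
      0 < σ b * A (x - p) (EuclideanSpace.single i 1)}
    refine ⟨Metric.ball p r, Metric.ball_mem_nhds p hr,
      (1 + (‖A‖ + κ / 2) / (κ / 2)).toNNReal, D, fun x hx => ?_, ?_⟩
    · rw [mem_insert_iff]
      by_cases hxp : x = p
      · exact Or.inl hxp
      right
      obtain ⟨i, hi⟩ := exists_norm_le_mul_apply_single (A (x - p))
      have hx0 : 0 < ‖x - p‖ := norm_pos_iff.2 (sub_ne_zero.2 hxp)
      have h1 : κ * ‖x - p‖ ≤ |A (x - p) (EuclideanSpace.single i 1)| := by
        rw [hκdef, one_div_mul_eq_div, div_le_iff₀ (by positivity)]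
        refine (hK2 (x - p)).trans ?_
        calc _ ≤ (K : ℝ) * ((n + 1) * |A (x - p) (EuclideanSpace.single i 1)|) := by gcongr
          _ = _ := by ring
      have h2 : 0 < |A (x - p) (EuclideanSpace.single i 1)| := (by positivity :
        0 < κ * ‖x - p‖).trans_le h1
      simp only [mem_iUnion]
      rcases abs_cases (A (x - p) (EuclideanSpace.single i 1)) with ⟨h3, -⟩ | ⟨h3, -⟩
      · rw [h3] at h1 h2
        exact ⟨i, true, hx, h1.trans_eq (one_mul _).symm, h2.trans_eq (one_mul _).symm⟩
      · rw [h3] at h1 h2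
        exact ⟨i, false, hx, h1.trans_eq (neg_one_mul _).symm, h2.trans_eq (neg_one_mul _).symm⟩
    · intro i b y hy z hz hyz
      rw [Real.coe_toNNReal _ (by positivity)]
      -- In the cone, the derivative in the direction of the coordinate vector dominates the
      -- differential, since `du` differs from the linear map `A (· - p)` by at most `κ / 2 |· -
      -- p|`.
      have key : ∀ x ∈ D i b, κ / 2 * ‖x - p‖ ≤ |fderiv ℝ u x (EuclideanSpace.single i 1)| ∧
          0 < ‖x - p‖ ∧ ‖fderiv ℝ u x‖ ≤ (‖A‖ + κ / 2) * ‖x - p‖ := fun x hx => by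
        have h1 := (hball x hx.1).1
        rw [hcrit, sub_zero] at h1
        have h2 : |(fderiv ℝ u x - A (x - p)) (EuclideanSpace.single i 1)| ≤ κ / 2 * ‖x - p‖ := by
          refine ((fderiv ℝ u x - A (x - p)).le_opNorm _).trans ?_
          rwa [PiLp.norm_single, norm_one, mul_one]
        have h3 : κ * ‖x - p‖ ≤ |A (x - p) (EuclideanSpace.single i 1)| := by
          refine hx.2.1.trans ((le_abs_self _).trans_eq ?_)
          rw [abs_mul, hσ, one_mul]
        refine ⟨?_, ?_, ?_⟩
        · rw [sub_apply] at h2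
          have := abs_sub_abs_le_abs_sub (A (x - p) (EuclideanSpace.single i 1))
            (fderiv ℝ u x (EuclideanSpace.single i 1))
          rw [abs_sub_comm] at this
          linarith
        · rw [norm_pos_iff]
          intro h0
          have := hx.2.2
          rw [h0] at this
          simp at this
        · have h4 : ‖fderiv ℝ u x‖ ≤ ‖fderiv ℝ u x - A (x - p)‖ + ‖A (x - p)‖ := by
            simpa using norm_add_le (fderiv ℝ u x - A (x - p)) (A (x - p))
          have h5 := A.le_opNorm (x - p)
          linarith
      refine norm_sub_le_of_level_eq (d := fderiv ℝ u) (D := D i b) ?_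
        (fun x hx => hd x (hball x hx.1).2) (fun x hx h0 => ?_) (fun x hx => ?_)
        hy hz hyz
      · have hc1 : Convex ℝ {x : 𝔼 | κ * ‖x - p‖ ≤
            σ b * A (x - p) (EuclideanSpace.single i 1)} := by
          intro x hx y hy s t hs ht hst
          simp only [mem_ofPred_eq] at hx hy ⊢
          have e : s • x + t • y - p = s • (x - p) + t • (y - p) := by
            have : p = (s + t) • p := by rw [hst, one_smul]
            nth_rw 1 [this]
            module
          rw [e, map_add, map_smul, map_smul, add_apply, smul_apply, smul_apply, smul_eq_mul,
            smul_eq_mul]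
          have h1 : ‖s • (x - p) + t • (y - p)‖ ≤ s * ‖x - p‖ + t * ‖y - p‖ := by
            refine (norm_add_le _ _).trans_eq ?_
            rw [norm_smul, norm_smul, Real.norm_of_nonneg hs, Real.norm_of_nonneg ht]
          nlinarith [mul_le_mul_of_nonneg_left h1 hκ.le]
        have hc2 : Convex ℝ {x : 𝔼 | 0 < σ b * A (x - p) (EuclideanSpace.single i 1)} := by
          have : {x : 𝔼 | 0 < σ b * A (x - p) (EuclideanSpace.single i 1)} =
              {x : 𝔼 | σ b * A p (EuclideanSpace.single i 1) <
                (σ b • (ContinuousLinearMap.apply ℝ ℝ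
                  (EuclideanSpace.single i (1 : ℝ) : 𝔼)).comp A) x} := by
            ext x
            simp [mul_sub]
          rw [this]
          exact convex_halfSpace_gt (ContinuousLinearMap.toLinearMap _).isLinear _
        exact (convex_ball p r).inter (hc1.inter hc2)
      · obtain ⟨h1, h2, -⟩ := key x hx
        rw [h0, abs_zero] at h1
        exact absurd (by positivity : 0 < κ / 2 * ‖x - p‖) h1.not_gt
      · obtain ⟨h1, -, h2⟩ := key x hx
        refine h2.trans ?_
        calc (‖A‖ + κ / 2) * ‖x - p‖ = (‖A‖ + κ / 2) / (κ / 2) * (κ / 2 * ‖x - p‖) := by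
              field_simp
          _ ≤ _ := by gcongr
  · obtain ⟨i, hi⟩ := exists_norm_le_mul_apply_single (fderiv ℝ u p)
    have hpos : 0 < ‖fderiv ℝ u p‖ := norm_pos_iff.2 hcrit
    set m := ‖fderiv ℝ u p‖ with hm
    have hcont : ContinuousAt (fderiv ℝ u) p := (hdd.contDiffAt (hU.mem_nhds hp)).continuousAt
    have hev := (hcont.eventually (Metric.closedBall_mem_nhds _
      (by positivity : 0 < m / (2 * (n + 1))))).and (hU.mem_nhds hp)
    obtain ⟨r, hr, hball⟩ := Metric.eventually_nhds_iff_ball.1 hev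
    refine ⟨Metric.ball p r, Metric.ball_mem_nhds p hr, (1 + 4 * (n + 1)),
      fun j _ => {x | x ∈ Metric.ball p r ∧ j = i}, fun x hx => ?_, ?_⟩
    · rw [mem_insert_iff]
      right
      simp only [mem_iUnion]
      exact ⟨i, true, hx, rfl⟩
    · rintro j - y ⟨hy, rfl⟩ z ⟨hz, -⟩ hyz
      push_cast
      have key : ∀ x ∈ Metric.ball p r, 0 < |fderiv ℝ u x (EuclideanSpace.single j 1)| ∧
          ‖fderiv ℝ u x‖ ≤ 4 * (n + 1) * |fderiv ℝ u x (EuclideanSpace.single j 1)| :=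
        fun x hx => by
          have h1 := (hball x hx).1
          rw [dist_eq_norm] at h1
          have h2 : |(fderiv ℝ u x - fderiv ℝ u p) (EuclideanSpace.single j 1)| ≤
              m / (2 * (n + 1)) := by
            refine ((fderiv ℝ u x - fderiv ℝ u p).le_opNorm _).trans ?_
            rwa [PiLp.norm_single, norm_one, mul_one]
          have h3 : m / (n + 1) ≤ |fderiv ℝ u p (EuclideanSpace.single j 1)| := by
            rw [div_le_iff₀ hn, mul_comm]
            exact hi
          have h4 : m / (n + 1) = 2 * (m / (2 * (n + 1))) := by field_simp
          have h5 := abs_sub_abs_le_abs_sub (fderiv ℝ u p (EuclideanSpace.single j 1))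
            (fderiv ℝ u x (EuclideanSpace.single j 1))
          rw [abs_sub_comm, ← sub_apply] at h5
          have h6 : ‖fderiv ℝ u x‖ ≤ ‖fderiv ℝ u x - fderiv ℝ u p‖ + m := by
            simpa using norm_add_le (fderiv ℝ u x - fderiv ℝ u p) (fderiv ℝ u p)
          have h7 : 0 < m / (2 * (n + 1)) := by positivity
          have h8 : m / (2 * (n + 1)) * (2 * (n + 1)) = m := by field_simp
          refine ⟨by linarith, ?_⟩
          have h9 : m / (2 * (n + 1)) ≤ |fderiv ℝ u x (EuclideanSpace.single j 1)| := by linarith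
          have h10 : m / (2 * (n + 1)) ≤ m := div_le_self hpos.le (by linarith)
          nlinarith
      exact norm_sub_le_of_level_eq (d := fderiv ℝ u) (convex_ball p r)
        (fun x hx => hd x (hball x hx).2) (fun x hx => abs_pos.1 (key x hx).1)
        (fun x hx => (key x hx).2) hy hz hyz

/-- A bi-Lipschitz graph over `ℝⁿ` meets a ball of radius `ρ` in a set of measure at most a constant
times `ρ ^ n`. -/
lemma measure_graph_inter_ball_le {Y : Type*} [MetricSpace Y] [MeasurableSpace Y] [BorelSpace Y]
    {S : Set Y} {P : Y → EuclideanSpace ℝ (Fin n)} {L K : ℝ≥0}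
    (h1 : ∀ y ∈ S, ∀ z ∈ S, edist y z ≤ L * edist (P y) (P z))
    (h2 : ∀ y ∈ S, ∀ z ∈ S, edist (P y) (P z) ≤ K * edist y z) (q : Y) {ρ : ℝ} (hρ : 0 < ρ) :
    (μHE[n] : Measure Y) (S ∩ Metric.ball q ρ) ≤ ((L : ℝ≥0∞) ^ n * ENNReal.ofReal (K * 2) ^ n *
      volume (Metric.ball (0 : EuclideanSpace ℝ (Fin n)) 1)) * ENNReal.ofReal ρ ^ n := by
  rcases (S ∩ Metric.ball q ρ).eq_empty_or_nonempty with h0 | ⟨y, hyS, hyq⟩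
  · rw [h0, measure_empty]
    exact zero_le
  have h3 : P '' (S ∩ Metric.ball q ρ) ⊆ Metric.closedBall (P y) (K * 2 * ρ) := by
    rintro _ ⟨z, ⟨hz, hzq⟩, rfl⟩
    have h4 := h2 z hz y hyS
    rw [edist_nndist, edist_nndist, ← ENNReal.coe_mul, ENNReal.coe_le_coe,
      ← NNReal.coe_le_coe] at h4
    push_cast at h4
    have h5 : dist z y ≤ 2 * ρ := by
      have := dist_triangle_right z y q
      rw [Metric.mem_ball] at hyq hzq
      linarith
    rw [Metric.mem_closedBall, mul_assoc]
    exact h4.trans (by gcongr)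
  calc (μHE[n] : Measure Y) (S ∩ Metric.ball q ρ)
      ≤ (L : ℝ≥0∞) ^ n * (μHE[n] : Measure _) (P '' (S ∩ Metric.ball q ρ)) :=
        euclideanHausdorffMeasure_le_image n fun y hy z hz => h1 y hy.1 z hz.1
    _ ≤ (L : ℝ≥0∞) ^ n * volume (Metric.closedBall (P y) (K * 2 * ρ)) := by
        rw [EuclideanSpace.euclideanHausdorffMeasure_eq_volume]
        gcongr
    _ = _ := by
        rw [Measure.addHaar_closedBall _ _ (by positivity), finrank_euclideanSpace_fin, mul_pow,
          ENNReal.ofReal_mul (by positivity), ENNReal.ofReal_pow (by positivity),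
          ENNReal.ofReal_pow hρ.le]
        ring

variable {M : Type*} [MetricSpace M]
    [ChartedSpace (EuclideanSpace ℝ (Fin (n + 1))) M] [IsManifold (𝓡 (n + 1)) ∞ M]
    [RiemannianBundle (fun x : M => TangentSpace (𝓡 (n + 1)) x)]
    [IsContMDiffRiemannianBundle (𝓡 (n + 1)) ∞ (EuclideanSpace ℝ (Fin (n + 1)))
      (fun x : M => TangentSpace (𝓡 (n + 1)) x)] [IsRiemannianManifold (𝓡 (n + 1)) M]
    [MeasurableSpace M] [BorelSpace M]

/-- The charts are locally bi-Lipschitz. -/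
lemma exists_nhds_edist_extChartAt_le (x₀ : M) : ∃ W ∈ 𝓝 x₀, ∃ L : ℝ≥0, ∀ x ∈ W, ∀ y ∈ W,
    edist x y ≤ L * edist (extChartAt 𝕀 x₀ x) (extChartAt 𝕀 x₀ y) ∧
      edist (extChartAt 𝕀 x₀ x) (extChartAt 𝕀 x₀ y) ≤ L * edist x y := by
  obtain ⟨U, hU, h1⟩ := exists_nhds_edist_le (n := n) x₀ one_lt_two
  obtain ⟨V, hV, h2⟩ := exists_nhds_le_edist (n := n) x₀ one_lt_two
  let F : 𝔼 →L[ℝ] TangentSpace 𝕀 x₀ := frameMap x₀ x₀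
  let G : TangentSpace 𝕀 x₀ →L[ℝ] 𝔼 := coordMap (n := n) x₀ x₀
  refine ⟨U ∩ V, inter_mem hU hV, 2 * ‖F‖₊ + 2 * ‖G‖₊, fun x hx y hy => ⟨?_, ?_⟩⟩
  · have e1 : ‖F (extChartAt 𝕀 x₀ y - extChartAt 𝕀 x₀ x)‖ₑ ≤
        ‖F‖₊ * edist (extChartAt 𝕀 x₀ x) (extChartAt 𝕀 x₀ y) := by
      rw [edist_comm, edist_eq_enorm_sub]
      exact F.le_opENorm _
    refine (h1 x hx.1 y hy.1).trans ((mul_le_mul_right e1 _).trans ?_)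
    rw [← mul_assoc]
    gcongr
    push_cast
    exact le_self_add
  · have e1 : ‖G (F (extChartAt 𝕀 x₀ y - extChartAt 𝕀 x₀ x))‖ₑ ≤
        ‖G‖₊ * ‖F (extChartAt 𝕀 x₀ y - extChartAt 𝕀 x₀ x)‖ₑ := G.le_opENorm _
    rw [show G (F (extChartAt 𝕀 x₀ y - extChartAt 𝕀 x₀ x)) =
      extChartAt 𝕀 x₀ y - extChartAt 𝕀 x₀ x from coordMap_frameMap (mem_chart_source 𝔼 x₀) _] at e1
    rw [edist_comm, edist_eq_enorm_sub]
    refine e1.trans ((mul_le_mul_right (h2 x hx.2 y hy.2) _).trans ?_)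
    rw [← mul_assoc]
    gcongr
    push_cast
    rw [mul_comm (2 : ℝ≥0∞) ‖G‖₊]
    exact le_add_self

/-- Near each point, the area of the level sets of a Morse function in balls is at most a constant
times the power of the radius. -/
lemma IsMorse.exists_nhds_measure_level_le {f : M → ℝ} (hf : IsMorse n f) (x₀ : M) :
    ∃ W ∈ 𝓝 x₀, ∃ C : ℝ≥0∞, C ≠ ⊤ ∧ ∀ (c : ℝ) (q : M) (ρ : ℝ), 0 < ρ →
      (μHE[n] : Measure M) (f ⁻¹' {c} ∩ W ∩ Metric.ball q ρ) ≤ C * ENNReal.ofReal ρ ^ n := by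
  obtain ⟨W₁, hW₁, K, hK⟩ := exists_nhds_edist_extChartAt_le (n := n) x₀
  obtain ⟨W₂, hW₂, L, D, hcov, hD⟩ := exists_nhds_level_graphs
    (isOpen_extChartAt_target (I := 𝕀) x₀) (contDiffOn_comp_extChartAt_symm hf.1 x₀)
    (mem_extChartAt_target (I := 𝕀) x₀) fun h => hf.2 x₀
      ((mfderiv_eq_zero_iff (hf.1.mdifferentiableAt (by simp)) (mem_chart_source 𝔼 x₀)).2 h)
  let W := W₁ ∩ (extChartAt 𝕀 x₀ ⁻¹' W₂ ∩ (extChartAt 𝕀 x₀).source)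
  let V := volume (Metric.ball (0 : EuclideanSpace ℝ (Fin n)) 1)
  let C₀ : ℝ≥0∞ := ((K * L : ℝ≥0) : ℝ≥0∞) ^ n * ENNReal.ofReal (K * 2) ^ n * V
  have hV : V ≠ ⊤ := measure_ball_lt_top.ne
  have hC₀ : C₀ ≠ ⊤ := by finiteness
  have hleft : ∀ x ∈ W, (f ∘ (extChartAt 𝕀 x₀).symm) (extChartAt 𝕀 x₀ x) = f x := fun x hx => by
    rw [Function.comp_apply, (extChartAt 𝕀 x₀).left_inv hx.2.2]
  -- The pieces of a level set: its graphs in the chart, and the centre of the chart.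
  have key : ∀ (q : M) (ρ : ℝ), 0 < ρ → ∀ (i : Fin (n + 1)) (S : Set M), S ⊆ W →
      (∀ y ∈ S, ∀ z ∈ S, ‖extChartAt 𝕀 x₀ y - extChartAt 𝕀 x₀ z‖ ≤
        L * ‖dropCoord i (extChartAt 𝕀 x₀ y) - dropCoord i (extChartAt 𝕀 x₀ z)‖) →
      (μHE[n] : Measure M) (S ∩ Metric.ball q ρ) ≤ C₀ * ENNReal.ofReal ρ ^ n := by
    intro q ρ hρ i S hS h
    refine measure_graph_inter_ball_le (P := fun x => dropCoord i (extChartAt 𝕀 x₀ x))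
      (fun y hy z hz => ?_) (fun y hy z hz => ?_) q hρ
    · refine (hK y (hS hy).1 z (hS hz).1).1.trans ?_
      rw [ENNReal.coe_mul, mul_assoc]
      gcongr
      rw [edist_eq_enorm_sub, edist_eq_enorm_sub, enorm_eq_nnnorm, enorm_eq_nnnorm,
        ← ENNReal.coe_mul, ENNReal.coe_le_coe]
      exact h y hy z hz
    · refine le_trans ?_ (hK y (hS hy).1 z (hS hz).1).2
      rw [edist_eq_enorm_sub, edist_eq_enorm_sub, enorm_le_iff_norm_le, ← dropCoord_sub]
      exact norm_dropCoord_le _ _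
  refine ⟨W, inter_mem hW₁ (inter_mem ((continuousAt_extChartAt x₀).preimage_mem_nhds hW₂)
    (extChartAt_source_mem_nhds x₀)), C₀ + ∑ i : Fin (n + 1), ∑ b : Bool, C₀,
    ENNReal.add_ne_top.2 ⟨hC₀, (ENNReal.sum_lt_top.2 fun _ _ => ENNReal.sum_lt_top.2
      fun _ _ => hC₀.lt_top).ne⟩,
    fun c q ρ hρ => ?_⟩
  let S : Fin (n + 1) → Bool → Set M := fun i b => f ⁻¹' {c} ∩ W ∩ extChartAt 𝕀 x₀ ⁻¹' D i b
  let S₀ : Set M := W ∩ extChartAt 𝕀 x₀ ⁻¹' {extChartAt 𝕀 x₀ x₀}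
  have hsub : f ⁻¹' {c} ∩ W ∩ Metric.ball q ρ ⊆ (S₀ ∩ Metric.ball q ρ) ∪
      ⋃ i, ⋃ b, S i b ∩ Metric.ball q ρ := by
    rintro x ⟨⟨hxc, hxW⟩, hxq⟩
    rcases hcov hxW.2.1 with h | h
    · exact Or.inl ⟨⟨hxW, h⟩, hxq⟩
    · right
      simp only [mem_iUnion] at h ⊢
      obtain ⟨i, b, h⟩ := h
      exact ⟨i, b, ⟨⟨hxc, hxW⟩, h⟩, hxq⟩
  -- The centre of the chart costs the same bound, as a graph consisting of one point.
  calc (μHE[n] : Measure M) (f ⁻¹' {c} ∩ W ∩ Metric.ball q ρ)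
      ≤ (μHE[n] : Measure M) (S₀ ∩ Metric.ball q ρ) +
          ∑ i, ∑ b, (μHE[n] : Measure M) (S i b ∩ Metric.ball q ρ) := by
        refine (measure_mono hsub).trans ((measure_union_le _ _).trans ?_)
        gcongr
        refine (measure_iUnion_fintype_le _ _).trans (Finset.sum_le_sum fun i _ => ?_)
        exact measure_iUnion_fintype_le _ _
    _ ≤ C₀ * ENNReal.ofReal ρ ^ n + ∑ i : Fin (n + 1), ∑ b : Bool, C₀ * ENNReal.ofReal ρ ^ n := by
        refine add_le_add (key q ρ hρ 0 S₀ inter_subset_left fun y hy z hz => ?_)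
          (Finset.sum_le_sum fun i _ => Finset.sum_le_sum fun b _ =>
            key q ρ hρ i (S i b) (fun x hx => hx.1.2) fun y hy z hz => ?_)
        · rw [(hy.2 : extChartAt 𝕀 x₀ y = _), (hz.2 : extChartAt 𝕀 x₀ z = _)]
          simp
        · refine hD i b _ hy.2 _ hz.2 ?_
          rw [hleft y hy.1.2, hleft z hz.1.2, (hy.1.1 : f y = c), (hz.1.1 : f z = c)]
    _ = _ := by simp only [Finset.sum_mul, add_mul]

/-- The area of the level sets of a Morse function in balls is at most a constant times the power
of the radius. -/
lemma IsMorse.exists_measure_level_le [CompactSpace M] {f : M → ℝ} (hf : IsMorse n f) :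
    ∃ C : ℝ≥0∞, C ≠ ⊤ ∧ ∀ (c : ℝ) (q : M) (ρ : ℝ), 0 < ρ →
      (μHE[n] : Measure M) (f ⁻¹' {c} ∩ Metric.ball q ρ) ≤ C * ENNReal.ofReal ρ ^ n := by
  choose W hW C hC h using hf.exists_nhds_measure_level_le
  obtain ⟨t, ht⟩ := CompactSpace.elim_nhds_subcover W hW
  refine ⟨∑ x ∈ t, C x, (ENNReal.sum_lt_top.2 fun x _ => (hC x).lt_top).ne, fun c q ρ hρ => ?_⟩
  have hsub : f ⁻¹' {c} ∩ Metric.ball q ρ ⊆ ⋃ x ∈ t, f ⁻¹' {c} ∩ W x ∩ Metric.ball q ρ := by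
    intro y hy
    have hy' : y ∈ ⋃ x ∈ t, W x := ht ▸ mem_univ y
    simp only [mem_iUnion] at hy' ⊢
    obtain ⟨x, hx, hyx⟩ := hy'
    exact ⟨x, hx, ⟨hy.1, hyx⟩, hy.2⟩
  refine (measure_mono hsub).trans ((measure_biUnion_finset_le _ _).trans ?_)
  rw [Finset.sum_mul]
  exact Finset.sum_le_sum fun x _ => h x c q ρ hρ

lemma IsMorse.maxLevelArea_lt_top [CompactSpace M] {f : M → ℝ} (hf : IsMorse n f) :
    maxLevelArea n f < ⊤ := by
  obtain ⟨C, hC, h⟩ := hf.exists_measure_level_le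
  rcases isEmpty_or_nonempty M with hM | ⟨⟨q⟩⟩
  · refine (iSup_le fun c => ?_ : maxLevelArea n f ≤ 0).trans_lt (by simp)
    rw [Set.eq_empty_of_isEmpty (f ⁻¹' {c}), measure_empty]
  obtain ⟨R, hR⟩ := (Metric.isBounded_of_compactSpace (s := (univ : Set M))).subset_ball q
  have hR' : univ ⊆ Metric.ball q (max R 1) := hR.trans (Metric.ball_subset_ball (le_max_left _ _))
  refine (iSup_le fun c => ?_ : maxLevelArea n f ≤ C * ENNReal.ofReal (max R 1) ^ n).trans_lt
    (by finiteness)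
  have hsub : f ⁻¹' {c} ⊆ f ⁻¹' {c} ∩ Metric.ball q (max R 1) := fun x hx => ⟨hx, hR' (mem_univ x)⟩
  exact (measure_mono hsub).trans (h c q _ (by positivity))

lemma IsMorse.riemVol_level [CompactSpace M] {f : M → ℝ} (hf : IsMorse n f) (c : ℝ) :
    riemVol n (f ⁻¹' {c}) = 0 :=
  (Measure.euclideanHausdorffMeasure_zero_or_top n.lt_succ_self _).resolve_right
    ((le_iSup (fun c : ℝ => (μHE[n] : Measure M) (f ⁻¹' {c})) c).trans_lt hf.maxLevelArea_lt_top).ne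

/-- In positive dimension of the level sets, their area does not concentrate at points. -/
lemma IsMorse.tendsto_measure_level [CompactSpace M] {f : M → ℝ} (hf : IsMorse n f) (hn : n ≠ 0) :
    Tendsto (fun r : ℝ => ⨆ (q : M) (c : ℝ), (μHE[n] : Measure M) (f ⁻¹' {c} ∩ Metric.ball q r))
      (𝓝[>] 0) (𝓝 0) := by
  obtain ⟨C, hC, h⟩ := hf.exists_measure_level_le
  have h1 : Tendsto (fun r : ℝ => C * ENNReal.ofReal r ^ n) (𝓝[>] 0) (𝓝 0) := by
    have h2 : Tendsto (fun r : ℝ => C * ENNReal.ofReal r ^ n) (𝓝 0)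
        (𝓝 (C * ENNReal.ofReal 0 ^ n)) :=
      ENNReal.Tendsto.const_mul (((ENNReal.continuous_pow n).comp
        ENNReal.continuous_ofReal).tendsto 0) (Or.inr hC)
    rw [ENNReal.ofReal_zero, zero_pow hn, mul_zero] at h2
    exact h2.mono_left nhdsWithin_le_nhds
  refine tendsto_of_tendsto_of_tendsto_of_le_of_le' tendsto_const_nhds h1
    (Eventually.of_forall fun _ => zero_le) ?_
  filter_upwards [self_mem_nhdsWithin] with r hr
  exact iSup₂_le fun q c => h c q r hr

end Levels

/-! ### Existence of Morse functions -/

section MorseExistence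

variable {n : ℕ}

local notation "𝔼" => EuclideanSpace ℝ (Fin (n + 1))
local notation "𝕀" => 𝓡 (n + 1)

/-- The vector of the partial derivatives that belong to a differential. -/
def gradientMap : (EuclideanSpace ℝ (Fin (n + 1)) →L[ℝ] ℝ) →L[ℝ] EuclideanSpace ℝ (Fin (n + 1)) :=
  LinearMap.toContinuousLinearMap
    { toFun := fun T => WithLp.toLp 2 fun i => T (EuclideanSpace.single i 1)
      map_add' := fun _ _ => rfl
      map_smul' := fun _ _ => rfl }

lemma gradientMap_apply (T : 𝔼 →L[ℝ] ℝ) (i : Fin (n + 1)) :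
    gradientMap T i = T (EuclideanSpace.single i 1) := rfl

lemma gradientMap_eq_zero_iff (T : 𝔼 →L[ℝ] ℝ) : gradientMap T = 0 ↔ T = 0 := by
  refine ⟨fun h => ?_, fun h => by rw [h, map_zero]⟩
  obtain ⟨i, hi⟩ := exists_norm_le_mul_apply_single T
  rw [← gradientMap_apply, h, PiLp.zero_apply, abs_zero, mul_zero] at hi
  exact norm_le_zero_iff.1 hi

/-- The determinant of a bilinear form on Euclidean space. -/
def hessianDet (B : EuclideanSpace ℝ (Fin (n + 1)) →L[ℝ] EuclideanSpace ℝ (Fin (n + 1)) →L[ℝ] ℝ) :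
    ℝ :=
  (gradientMap.comp B).det

lemma continuous_hessianDet : Continuous (hessianDet (n := n)) := by
  have h : Continuous fun A : 𝔼 →L[ℝ] 𝔼 => A.det := ContinuousLinearMap.continuous_det
  exact h.comp (continuous_const.clm_comp continuous_id)

lemma hessianDet_eq_zero_iff (B : 𝔼 →L[ℝ] 𝔼 →L[ℝ] ℝ) :
    hessianDet B = 0 ↔ ∃ v, v ≠ 0 ∧ ∀ w, B v w = 0 := by
  set A := gradientMap.comp B with hA
  have h1 : ∀ v, A v = 0 ↔ ∀ w, B v w = 0 := fun v => by
    rw [hA, ContinuousLinearMap.comp_apply, gradientMap_eq_zero_iff, ContinuousLinearMap.ext_iff]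
    rfl
  have h2 : hessianDet B = LinearMap.det (A : 𝔼 →ₗ[ℝ] 𝔼) := rfl
  simp_rw [h2, ← h1]
  constructor
  · intro h
    obtain ⟨v, hv, hv0⟩ := (Submodule.ne_bot_iff _).1 (LinearMap.bot_lt_ker_of_det_eq_zero h).ne'
    exact ⟨v, hv0, hv⟩
  · rintro ⟨v, hv0, hv⟩
    by_contra h
    have := (LinearMap.isUnit_iff_isUnit_det (A : 𝔼 →ₗ[ℝ] 𝔼)).2 (isUnit_iff_ne_zero.2 h)
    exact hv0 (((Module.End.isUnit_iff _).1 this).1 (hv.trans (map_zero _).symm))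

/-- The point `z` is not a degenerate critical point of `u`. -/
def IsNondegenerateAt (u : EuclideanSpace ℝ (Fin (n + 1)) → ℝ)
    (z : EuclideanSpace ℝ (Fin (n + 1))) : Prop :=
  fderiv ℝ u z = 0 → ∀ v, (∀ w, fderiv ℝ (fderiv ℝ u) z v w = 0) → v = 0

lemma isNondegenerateAt_iff {u : 𝔼 → ℝ} {z : 𝔼} : IsNondegenerateAt u z ↔
    (fderiv ℝ u z, hessianDet (fderiv ℝ (fderiv ℝ u) z)) ≠ 0 := by
  rw [Ne, Prod.mk_eq_zero, hessianDet_eq_zero_iff, IsNondegenerateAt]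
  push Not
  refine forall_congr' fun _ => forall_congr' fun v => ?_
  constructor
  · intro h hv
    by_contra! h0
    exact hv (h h0)
  · intro h h0
    by_contra hv
    obtain ⟨w, hw⟩ := h hv
    exact hw (h0 w)

section Perturbation

variable {u : EuclideanSpace ℝ (Fin (n + 1)) → ℝ}
  {g : Fin (n + 1) → EuclideanSpace ℝ (Fin (n + 1)) → ℝ} {U : Set (EuclideanSpace ℝ (Fin (n + 1)))}

lemma fderiv_sub_sum_mul (hU : IsOpen U) (hu : ContDiffOn ℝ ∞ u U)
    (hg : ∀ i, ContDiffOn ℝ ∞ (g i) U) (a : 𝔼) {z : 𝔼} (hz : z ∈ U) :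
    fderiv ℝ (fun z => u z - ∑ i, a i * g i z) z = fderiv ℝ u z - ∑ i, a i • fderiv ℝ (g i) z := by
  have h1 : HasFDerivAt u (fderiv ℝ u z) z :=
    ((hu.contDiffAt (hU.mem_nhds hz)).differentiableAt (by simp)).hasFDerivAt
  have h2 : ∀ i, HasFDerivAt (g i) (fderiv ℝ (g i) z) z := fun i =>
    (((hg i).contDiffAt (hU.mem_nhds hz)).differentiableAt (by simp)).hasFDerivAt
  exact (h1.sub (HasFDerivAt.fun_sum fun i _ => (h2 i).const_mul (a i))).fderiv

lemma fderiv_fderiv_sub_sum_mul (hU : IsOpen U) (hu : ContDiffOn ℝ ∞ u U)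
    (hg : ∀ i, ContDiffOn ℝ ∞ (g i) U) (a : 𝔼) {z : 𝔼} (hz : z ∈ U) :
    fderiv ℝ (fderiv ℝ (fun z => u z - ∑ i, a i * g i z)) z =
      fderiv ℝ (fderiv ℝ u) z - ∑ i, a i • fderiv ℝ (fderiv ℝ (g i)) z := by
  have hd : ∀ {v : 𝔼 → ℝ}, ContDiffOn ℝ ∞ v U →
      HasFDerivAt (fderiv ℝ v) (fderiv ℝ (fderiv ℝ v) z) z := fun hv =>
    (((hv.fderiv_of_isOpen (m := 1) hU (by norm_cast)).contDiffAt (hU.mem_nhds hz)).differentiableAt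
      (by simp)).hasFDerivAt
  have heq : fderiv ℝ (fun z => u z - ∑ i, a i * g i z) =ᶠ[𝓝 z]
      fun z => fderiv ℝ u z - ∑ i, a i • fderiv ℝ (g i) z := by
    filter_upwards [hU.mem_nhds hz] with y hy using fderiv_sub_sum_mul hU hu hg a hy
  rw [heq.fderiv_eq]
  exact ((hd hu).sub (HasFDerivAt.fun_sum fun i _ => (hd (hg i)).const_smul (a i))).fderiv

/-- Nondegeneracy is stable under small linear perturbations and small moves of the point. -/
lemma IsNondegenerateAt.eventually_sub (hU : IsOpen U) (hu : ContDiffOn ℝ ∞ u U)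
    (hg : ∀ i, ContDiffOn ℝ ∞ (g i) U) {p : 𝔼} (hp : p ∈ U) (h : IsNondegenerateAt u p) :
    ∀ᶠ q : 𝔼 × 𝔼 in 𝓝 (0, p), IsNondegenerateAt (fun z => u z - ∑ i, q.1 i * g i z) q.2 := by
  let F : 𝔼 × 𝔼 → (𝔼 →L[ℝ] ℝ) × ℝ := fun q =>
    (fderiv ℝ u q.2 - ∑ i, q.1 i • fderiv ℝ (g i) q.2,
      hessianDet (fderiv ℝ (fderiv ℝ u) q.2 - ∑ i, q.1 i • fderiv ℝ (fderiv ℝ (g i)) q.2))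
  have hc1 : ∀ {v : 𝔼 → ℝ}, ContDiffOn ℝ ∞ v U →
      ContinuousAt (fun q : 𝔼 × 𝔼 => fderiv ℝ v q.2) (0, p) := fun {v} hv =>
    ContinuousAt.comp (g := fderiv ℝ v) (f := Prod.snd) (x := ((0 : 𝔼), p))
      ((hv.fderiv_of_isOpen (m := 1) hU (by norm_cast)).contDiffAt
        (hU.mem_nhds hp)).continuousAt continuousAt_snd
  have hc2 : ∀ {v : 𝔼 → ℝ}, ContDiffOn ℝ ∞ v U →
      ContinuousAt (fun q : 𝔼 × 𝔼 => fderiv ℝ (fderiv ℝ v) q.2) (0, p) := fun {v} hv =>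
    ContinuousAt.comp (g := fderiv ℝ (fderiv ℝ v)) (f := Prod.snd) (x := ((0 : 𝔼), p))
      (((hv.fderiv_of_isOpen (m := 2) hU (by norm_cast)).fderiv_of_isOpen (m := 1) hU
        (by norm_cast)).contDiffAt (hU.mem_nhds hp)).continuousAt continuousAt_snd
  have hc3 : ∀ i, ContinuousAt (fun q : 𝔼 × 𝔼 => q.1 i) (0, p) := fun i => by fun_prop
  have hF : ContinuousAt F (0, p) := by
    refine ContinuousAt.prodMk ((hc1 hu).sub ?_) (continuous_hessianDet.continuousAt.comp
      ((hc2 hu).sub ?_))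
    · exact tendsto_finsetSum _ fun i _ => (hc3 i).smul (hc1 (hg i))
    · exact tendsto_finsetSum _ fun i _ => (hc3 i).smul (hc2 (hg i))
  have h0 : F (0, p) ≠ 0 := by
    have : F (0, p) = (fderiv ℝ u p, hessianDet (fderiv ℝ (fderiv ℝ u) p)) := by simp [F]
    rw [this]
    exact isNondegenerateAt_iff.1 h
  filter_upwards [hF.eventually_ne h0, continuousAt_snd.preimage_mem_nhds (hU.mem_nhds hp)]
    with q hq hqU
  rw [isNondegenerateAt_iff, fderiv_sub_sum_mul hU hu hg _ hqU,
    fderiv_fderiv_sub_sum_mul hU hu hg _ hqU]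
  exact hq

/-- Almost all linear perturbations of `u` have only nondegenerate critical points: the other ones
are the critical values of the gradient of `u`. -/
lemma volume_setOf_not_isNondegenerateAt (hU : IsOpen U) (hu : ContDiffOn ℝ ∞ u U)
    (hg : ∀ i, ∀ z ∈ U, g i z = z i) :
    volume {a : 𝔼 | ∃ z ∈ U, ¬ IsNondegenerateAt (fun z => u z - ∑ i, a i * g i z) z} = 0 := by
  let S : Set 𝔼 := {z ∈ U | hessianDet (fderiv ℝ (fderiv ℝ u) z) = 0}
  have hgd : ∀ i, ContDiffOn ℝ ∞ (g i) U := fun i => by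
    have : ContDiffOn ℝ ∞ (fun z : 𝔼 => z i) U := by fun_prop
    exact this.congr (hg i)
  have hg1 : ∀ i, ∀ z ∈ U, fderiv ℝ (g i) z = EuclideanSpace.proj i := fun i z hz => by
    have : g i =ᶠ[𝓝 z] (EuclideanSpace.proj i : 𝔼 →L[ℝ] ℝ) := by
      filter_upwards [hU.mem_nhds hz] with y hy using hg i y hy
    rw [this.fderiv_eq, ContinuousLinearMap.fderiv]
  have hg2 : ∀ i, ∀ z ∈ U, fderiv ℝ (fderiv ℝ (g i)) z = 0 := fun i z hz => by
    have : fderiv ℝ (g i) =ᶠ[𝓝 z] fun _ => (EuclideanSpace.proj i : 𝔼 →L[ℝ] ℝ) := by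
      filter_upwards [hU.mem_nhds hz] with y hy using hg1 i y hy
    rw [this.fderiv_eq, fderiv_const_apply]
  -- Sard's theorem for the gradient of `u`, whose derivative is the Hessian.
  have hsard : volume ((fun z => gradientMap (fderiv ℝ u z)) '' S) = 0 := by
    refine addHaar_image_eq_zero_of_det_fderivWithin_eq_zero (f' := fun z =>
      gradientMap.comp (fderiv ℝ (fderiv ℝ u) z)) volume (fun z hz => ?_) fun z hz => hz.2
    exact (gradientMap.hasFDerivAt.comp z
      (((hu.fderiv_of_isOpen (m := 1) hU (by norm_cast)).contDiffAt
        (hU.mem_nhds hz.1)).differentiableAt (by simp)).hasFDerivAt).hasFDerivWithinAt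
  refine measure_mono_null ?_ hsard
  rintro a ⟨z, hz, h⟩
  rw [isNondegenerateAt_iff, not_not, fderiv_sub_sum_mul hU hu hgd _ hz,
    fderiv_fderiv_sub_sum_mul hU hu hgd _ hz, Prod.mk_eq_zero, sub_eq_zero] at h
  simp only [hg2 _ z hz, smul_zero, Finset.sum_const_zero, sub_zero, hg1 _ z hz] at h
  refine ⟨z, ⟨hz, h.2⟩, ?_⟩
  simp only [h.1]
  ext i
  rw [gradientMap_apply]
  simp

end Perturbation

variable {M : Type*} [MetricSpace M]
    [ChartedSpace (EuclideanSpace ℝ (Fin (n + 1))) M] [IsManifold (𝓡 (n + 1)) ∞ M]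
    [RiemannianBundle (fun x : M => TangentSpace (𝓡 (n + 1)) x)]
    [IsContMDiffRiemannianBundle (𝓡 (n + 1)) ∞ (EuclideanSpace ℝ (Fin (n + 1)))
      (fun x : M => TangentSpace (𝓡 (n + 1)) x)]

/-- The Hessian at a critical point transforms as a bilinear form under a change of charts, so that
its nondegeneracy can be tested in any chart. -/
lemma IsNondegenerateAt.change_chart {f : M → ℝ} (hf : ContMDiff 𝕀 𝓘(ℝ, ℝ) ∞ f) {x₀ y : M}
    (hy : y ∈ (extChartAt 𝕀 x₀).source)
    (h : IsNondegenerateAt (f ∘ (extChartAt 𝕀 x₀).symm) (extChartAt 𝕀 x₀ y)) :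
    IsNondegenerateAt (f ∘ (extChartAt 𝕀 y).symm) (extChartAt 𝕀 y y) := by
  set u := f ∘ (extChartAt 𝕀 x₀).symm with hu
  set u₁ := f ∘ (extChartAt 𝕀 y).symm with hu₁
  set τ := extChartAt 𝕀 x₀ ∘ (extChartAt 𝕀 y).symm with hτ
  set σ := extChartAt 𝕀 y ∘ (extChartAt 𝕀 x₀).symm with hσ
  set z₁ := extChartAt 𝕀 y y with hz₁
  have hyy : y ∈ (extChartAt 𝕀 y).source := mem_extChartAt_source y
  have hsymm : (extChartAt 𝕀 y).symm z₁ = y := extChartAt_to_inv y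
  have hτz : τ z₁ = extChartAt 𝕀 x₀ y := by rw [hτ, Function.comp_apply, hsymm]
  have hτd : ContDiffAt ℝ ∞ τ z₁ := by
    rw [← contMDiffAt_iff_contDiffAt]
    refine ContMDiffAt.comp (I' := 𝕀) z₁ ?_ ((contMDiffOn_extChartAt_symm y).contMDiffAt
      (extChartAt_target_mem_nhds y))
    rw [hsymm]
    exact contMDiffAt_extChartAt' (by rwa [← extChartAt_source 𝕀])
  have hσd : ContDiffAt ℝ ∞ σ (τ z₁) := by
    rw [hτz, ← contMDiffAt_iff_contDiffAt]
    refine ContMDiffAt.comp (I' := 𝕀) _ ?_ ((contMDiffOn_extChartAt_symm x₀).contMDiffAt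
      (extChartAt_target_mem_nhds' ((extChartAt 𝕀 x₀).map_source hy)))
    rw [(extChartAt 𝕀 x₀).left_inv hy]
    exact contMDiffAt_extChartAt
  have hnear : ∀ᶠ z in 𝓝 z₁, z ∈ (extChartAt 𝕀 y).target ∧
      (extChartAt 𝕀 y).symm z ∈ (extChartAt 𝕀 x₀).source := by
    refine Filter.Eventually.and (extChartAt_target_mem_nhds y)
      ((continuousAt_extChartAt_symm y).preimage_mem_nhds ?_)
    rw [← hz₁, hsymm]
    exact extChartAt_source_mem_nhds' hy
  have hστ : σ ∘ τ =ᶠ[𝓝 z₁] id := by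
    filter_upwards [hnear] with z hz
    simp only [hσ, hτ, Function.comp_apply, (extChartAt 𝕀 x₀).left_inv hz.2,
      (extChartAt 𝕀 y).right_inv hz.1, id]
  have huτ : u₁ =ᶠ[𝓝 z₁] u ∘ τ := by
    filter_upwards [hnear] with z hz
    simp only [hu, hu₁, hτ, Function.comp_apply, (extChartAt 𝕀 x₀).left_inv hz.2]
  set T := fderiv ℝ τ z₁ with hT
  -- The derivative of the transition map is invertible.
  have hinj : Function.Injective T := by
    have h1 : (fderiv ℝ σ (τ z₁)).comp T = ContinuousLinearMap.id ℝ 𝔼 := by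
      rw [hT, ← fderiv_comp _ (hσd.differentiableAt (by simp)) (hτd.differentiableAt (by simp)),
        hστ.fderiv_eq, fderiv_id]
    intro v w hvw
    have := congrArg (fderiv ℝ σ (τ z₁)) hvw
    rwa [← ContinuousLinearMap.comp_apply, ← ContinuousLinearMap.comp_apply, h1] at this
  have hsurj : Function.Surjective T :=
    LinearMap.injective_iff_surjective (f := (T : 𝔼 →ₗ[ℝ] 𝔼)).1 hinj
  have hud : ContDiffAt ℝ ∞ u (τ z₁) := by
    rw [hτz]
    exact (contDiffOn_comp_extChartAt_symm hf x₀).contDiffAt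
      (extChartAt_target_mem_nhds' ((extChartAt 𝕀 x₀).map_source hy))
  have hD1 : fderiv ℝ u₁ =ᶠ[𝓝 z₁] fun z => (fderiv ℝ u (τ z)).comp (fderiv ℝ τ z) := by
    have e1 := hτd.continuousAt.eventually
      ((hud.of_le (m := 1) (by norm_cast)).eventually (by simp))
    filter_upwards [huτ.eventuallyEq_nhds,
      (hτd.of_le (m := 1) (by norm_cast)).eventually (by simp), e1] with z hz h1 h2
    rw [hz.fderiv_eq, fderiv_comp _ (h2.differentiableAt (by simp)) (h1.differentiableAt (by simp))]
  intro hcrit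
  have hcrit' : fderiv ℝ u (τ z₁) = 0 := by
    ext w
    obtain ⟨v, rfl⟩ := hsurj w
    have := hD1.eq_of_nhds
    rw [hcrit] at this
    exact (DFunLike.congr_fun this v).symm
  -- The term with the second derivative of `τ` vanishes, as the point is critical.
  have hD2 : ∀ v w, fderiv ℝ (fderiv ℝ u₁) z₁ v w = fderiv ℝ (fderiv ℝ u) (τ z₁) (T v) (T w) := by
    intro v w
    have hdu : HasFDerivAt (fderiv ℝ u) (fderiv ℝ (fderiv ℝ u) (τ z₁)) (τ z₁) :=
      ((hud.fderiv_right (m := 1) (by norm_cast)).differentiableAt (by simp)).hasFDerivAt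
    have hdτ : HasFDerivAt (fderiv ℝ τ) (fderiv ℝ (fderiv ℝ τ) z₁) z₁ :=
      ((hτd.fderiv_right (m := 1) (by norm_cast)).differentiableAt (by simp)).hasFDerivAt
    have h1 := (hdu.comp z₁ (hτd.differentiableAt (by simp)).hasFDerivAt).clm_comp hdτ
    have h2 := hD1.fderiv_eq.trans h1.fderiv
    rw [h2]
    show (fderiv ℝ u (τ z₁)) (fderiv ℝ (fderiv ℝ τ) z₁ v w) +
      fderiv ℝ (fderiv ℝ u) (τ z₁) (T v) (T w) = _
    rw [hcrit', zero_apply, zero_add]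
  intro v hv
  have h3 : T v = 0 := h (by rw [← hτz]; exact hcrit') (T v) fun w => by
    obtain ⟨w, rfl⟩ := hsurj w
    rw [← hτz, ← hD2]
    exact hv w
  exact hinj (h3.trans (map_zero T).symm)

/-- Adding a small generic linear combination of the coordinate functions of a chart, cut off far
from its centre, removes the degenerate critical points near the centre and creates none in a given
compact set that has none. -/
lemma exists_perturbation {f : M → ℝ} (hf : ContMDiff 𝕀 𝓘(ℝ, ℝ) ∞ f) {K : Set M}
    (hK : IsCompact K)
    (hfK : ∀ x ∈ K, IsNondegenerateAt (f ∘ (extChartAt 𝕀 x).symm) (extChartAt 𝕀 x x)) (x₀ : M)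
    (χ : SmoothBumpFunction 𝕀 x₀) {O : Set M} (hO : IsOpen O)
    (hOs : O ⊆ (extChartAt 𝕀 x₀).source) (hχ : ∀ x ∈ O, χ x = 1) :
    ∃ F : M → ℝ, ContMDiff 𝕀 𝓘(ℝ, ℝ) ∞ F ∧ ∀ x ∈ K ∪ O,
      IsNondegenerateAt (F ∘ (extChartAt 𝕀 x).symm) (extChartAt 𝕀 x x) := by
  let g : Fin (n + 1) → M → ℝ := fun i x => χ x • extChartAt 𝕀 x₀ x i
  have hg : ∀ i, ContMDiff 𝕀 𝓘(ℝ, ℝ) ∞ (g i) := fun i => by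
    refine χ.contMDiff_smul ?_
    have h1 : ContMDiffOn 𝕀 𝓘(ℝ, 𝔼) ∞ (extChartAt 𝕀 x₀) (chartAt 𝔼 x₀).source :=
      contMDiffOn_extChartAt
    exact ((EuclideanSpace.proj i : 𝔼 →L[ℝ] ℝ).contMDiff (n := ∞)).comp_contMDiffOn h1
  let F : 𝔼 → M → ℝ := fun a x => f x - ∑ i, a i * g i x
  have hF : ∀ a, ContMDiff 𝕀 𝓘(ℝ, ℝ) ∞ (F a) := fun a =>
    hf.sub (contMDiff_finsetSum fun i _ => contMDiff_const.mul (hg i))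
  have hcomp : ∀ a x, F a ∘ (extChartAt 𝕀 x).symm = fun z =>
      (f ∘ (extChartAt 𝕀 x).symm) z - ∑ i, a i * (g i ∘ (extChartAt 𝕀 x).symm) z := fun a x => rfl
  -- Nondegeneracy on the compact set `K` survives small perturbations.
  have hKev : ∀ᶠ a : 𝔼 in 𝓝 0, ∀ y ∈ K,
      IsNondegenerateAt (F a ∘ (extChartAt 𝕀 y).symm) (extChartAt 𝕀 y y) := by
    refine hK.eventually_forall_of_forall_eventually fun x hx => ?_
    have h1 := (hfK x hx).eventually_sub (isOpen_extChartAt_target x)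
      (contDiffOn_comp_extChartAt_symm hf x) (fun i => contDiffOn_comp_extChartAt_symm (hg i) x)
      (mem_extChartAt_target x)
    have h2 : Tendsto (fun q : 𝔼 × M => (q.1, extChartAt 𝕀 x q.2)) (𝓝 (0, x))
        (𝓝 (0, extChartAt 𝕀 x x)) :=
      (continuousAt_fst.prodMk (ContinuousAt.comp (g := extChartAt 𝕀 x) (f := Prod.snd)
        (x := ((0 : 𝔼), x)) (continuousAt_extChartAt x) continuousAt_snd))
    filter_upwards [h2.eventually h1, continuousAt_snd.preimage_mem_nhds
      (extChartAt_source_mem_nhds (I := 𝕀) x)] with q hq hqs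
    exact IsNondegenerateAt.change_chart (hF q.1) hqs hq
  -- On `O`, where the cutoff is `1`, almost every perturbation is good.
  have hnull : ∀ᵐ a : 𝔼, ∀ z ∈ (extChartAt 𝕀 x₀).target ∩ (extChartAt 𝕀 x₀).symm ⁻¹' O,
      IsNondegenerateAt (F a ∘ (extChartAt 𝕀 x₀).symm) z := by
    rw [ae_iff]
    push Not
    refine volume_setOf_not_isNondegenerateAt (g := fun i => g i ∘ (extChartAt 𝕀 x₀).symm)
      ((continuousOn_extChartAt_symm x₀).isOpen_inter_preimage (isOpen_extChartAt_target x₀) hO)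
      ((contDiffOn_comp_extChartAt_symm hf x₀).mono inter_subset_left) fun i z hz => ?_
    show χ _ • extChartAt 𝕀 x₀ _ i = z i
    rw [hχ _ hz.2, one_smul, (extChartAt 𝕀 x₀).right_inv hz.1]
  obtain ⟨a, ha, haK⟩ := (Filter.Eventually.and_frequently hKev
    (mem_closure_iff_frequently.1 (Measure.dense_of_ae hnull 0))).exists
  refine ⟨F a, hF a, fun x hx => ?_⟩
  rcases hx with hx | hx
  · exact ha x hx
  · refine IsNondegenerateAt.change_chart (hF a) (hOs hx) (haK _ ?_)
    exact ⟨(extChartAt 𝕀 x₀).map_source (hOs hx), by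
      rwa [mem_preimage, (extChartAt 𝕀 x₀).left_inv (hOs hx)]⟩

/-- There are Morse functions on closed manifolds. -/
lemma exists_isMorse [CompactSpace M] : ∃ f : M → ℝ, IsMorse n f := by
  have hloc : ∀ x₀ : M, ∃ (χ : SmoothBumpFunction 𝕀 x₀) (O : Set M), IsOpen O ∧ x₀ ∈ O ∧
      O ⊆ (extChartAt 𝕀 x₀).source ∧ ∀ x ∈ O, χ x = 1 := fun x₀ => by
    obtain ⟨χ⟩ : Nonempty (SmoothBumpFunction 𝕀 x₀) := inferInstance
    obtain ⟨O, hO, hOo, hx⟩ := eventually_nhds_iff.1 (Filter.Eventually.and χ.eventuallyEq_one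
      (extChartAt_source_mem_nhds (I := 𝕀) x₀))
    exact ⟨χ, O, hOo, hx, fun x hx => (hO x hx).2, fun x hx => (hO x hx).1⟩
  choose χ O hO hxO hOs hχ using hloc
  have hKloc : ∀ x₀ : M, ∃ K, K ∈ 𝓝 x₀ ∧ K ⊆ O x₀ ∧ IsCompact K := fun x₀ =>
    local_compact_nhds ((hO x₀).mem_nhds (hxO x₀))
  choose K hKn hKO hKc using hKloc
  obtain ⟨t, ht⟩ := CompactSpace.elim_nhds_subcover K hKn
  -- Starting from `0`, perturb in one chart after the other.
  have key : ∀ s : Finset M, ∃ f : M → ℝ, ContMDiff 𝕀 𝓘(ℝ, ℝ) ∞ f ∧ ∀ x ∈ ⋃ y ∈ s, K y,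
      IsNondegenerateAt (f ∘ (extChartAt 𝕀 x).symm) (extChartAt 𝕀 x x) := by
    classical
    intro s
    induction s using Finset.induction_on with
    | empty => exact ⟨fun _ => 0, contMDiff_const, by simp⟩
    | insert x₀ s hx₀ ih =>
      obtain ⟨f, hf, hfs⟩ := ih
      obtain ⟨F, hF, hFs⟩ := exists_perturbation hf (s.isCompact_biUnion fun y _ => hKc y) hfs x₀
        (χ x₀) (hO x₀) (hOs x₀) (hχ x₀)
      refine ⟨F, hF, fun x hx => hFs x ?_⟩
      rw [Finset.set_biUnion_insert] at hx
      exact hx.elim (fun h => Or.inr (hKO x₀ h)) Or.inl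
  obtain ⟨f, hf, hft⟩ := key t
  refine ⟨f, hf, fun x hx v hv => hft x (ht ▸ mem_univ x) ?_ v hv⟩
  exact (mfderiv_eq_zero_iff (hf.mdifferentiableAt (by simp)) (mem_chart_source 𝔼 x)).1 hx

end MorseExistence

/-! ### Divergence, perimeter and sublevel sets -/

section Perimeter

variable {n : ℕ} {M : Type*} [MetricSpace M]
    [ChartedSpace (EuclideanSpace ℝ (Fin (n + 1))) M] [IsManifold (𝓡 (n + 1)) ∞ M]
    [RiemannianBundle (fun x : M => TangentSpace (𝓡 (n + 1)) x)]
    [IsContMDiffRiemannianBundle (𝓡 (n + 1)) ∞ (EuclideanSpace ℝ (Fin (n + 1)))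
      (fun x : M => TangentSpace (𝓡 (n + 1)) x)]

local notation "𝔼" => EuclideanSpace ℝ (Fin (n + 1))
local notation "𝕀" => 𝓡 (n + 1)

/-- Smooth vector fields. -/
abbrev IsSmoothField (X : ∀ x : M, TangentSpace (𝓡 (n + 1)) x) : Prop :=
  ContMDiff (𝓡 (n + 1)) (𝓡 (n + 1)).tangent ∞
    (fun x => (⟨x, X x⟩ : TangentBundle (𝓡 (n + 1)) M))

lemma differentiableAt_comp_extChartAt_symm {f : M → ℝ} (hf : ContMDiff 𝕀 𝓘(ℝ, ℝ) ∞ f) {x₀ x : M}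
    (hx : x ∈ (extChartAt 𝕀 x₀).source) :
    DifferentiableAt ℝ (f ∘ (extChartAt 𝕀 x₀).symm) (extChartAt 𝕀 x₀ x) :=
  ((contDiffOn_comp_extChartAt_symm hf x₀).differentiableOn (by simp)).differentiableAt
    ((isOpen_extChartAt_target x₀).mem_nhds ((extChartAt 𝕀 x₀).map_source hx))

lemma dirDeriv_mul {f g : M → ℝ} (hf : ContMDiff 𝕀 𝓘(ℝ, ℝ) ∞ f) (hg : ContMDiff 𝕀 𝓘(ℝ, ℝ) ∞ g)
    (x : M) (U : TangentSpace 𝕀 x) :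
    dirDeriv (fun x => f x * g x) x U = f x * dirDeriv g x U + g x * dirDeriv f x U := by
  have hd : ∀ {f : M → ℝ}, ContMDiff 𝕀 𝓘(ℝ, ℝ) ∞ f → MDifferentiableAt 𝕀 𝓘(ℝ, ℝ) f x :=
    fun hf => hf.mdifferentiableAt (by simp)
  have hx : x ∈ (extChartAt 𝕀 x).source := mem_extChartAt_source x
  have hfg : ContMDiff 𝕀 𝓘(ℝ, ℝ) ∞ (fun x => f x * g x) := hf.mul hg
  rw [mfderiv_eq_fderiv_coordMap (hd hfg) (mem_chart_source 𝔼 x),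
    mfderiv_eq_fderiv_coordMap (hd hf) (mem_chart_source 𝔼 x),
    mfderiv_eq_fderiv_coordMap (hd hg) (mem_chart_source 𝔼 x)]
  have h1 := fderiv_mul (differentiableAt_comp_extChartAt_symm hf hx)
    (differentiableAt_comp_extChartAt_symm hg hx)
  have h2 : (fun x => f x * g x) ∘ (extChartAt 𝕀 x).symm =
      (f ∘ (extChartAt 𝕀 x).symm) * (g ∘ (extChartAt 𝕀 x).symm) := rfl
  rw [h2, h1]
  simp only [Function.comp_apply, (extChartAt 𝕀 x).left_inv hx, add_apply, smul_apply, smul_eq_mul]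

lemma dirDeriv_comp {f : M → ℝ} (hf : ContMDiff 𝕀 𝓘(ℝ, ℝ) ∞ f) {ζ : ℝ → ℝ} (hζ : ContDiff ℝ ∞ ζ)
    (x : M) (U : TangentSpace 𝕀 x) :
    dirDeriv (fun x => ζ (f x)) x U = deriv ζ (f x) * dirDeriv f x U := by
  have hx : x ∈ (extChartAt 𝕀 x).source := mem_extChartAt_source x
  have hζf : ContMDiff 𝕀 𝓘(ℝ, ℝ) ∞ (fun x => ζ (f x)) := hζ.contMDiff.comp hf
  rw [mfderiv_eq_fderiv_coordMap (hζf.mdifferentiableAt (by simp)) (mem_chart_source 𝔼 x),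
    mfderiv_eq_fderiv_coordMap (hf.mdifferentiableAt (by simp)) (mem_chart_source 𝔼 x)]
  have h2 : (fun x => ζ (f x)) ∘ (extChartAt 𝕀 x).symm = ζ ∘ (f ∘ (extChartAt 𝕀 x).symm) := rfl
  have h3 : DifferentiableAt ℝ ζ ((f ∘ (extChartAt 𝕀 x).symm) (extChartAt 𝕀 x x)) :=
    hζ.differentiable (by simp) _
  have h4 := h3.hasDerivAt.comp_hasFDerivAt _
    (differentiableAt_comp_extChartAt_symm hf hx).hasFDerivAt
  rw [h2, h4.fderiv]
  simp only [Function.comp_apply, (extChartAt 𝕀 x).left_inv hx, smul_apply, smul_eq_mul]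

lemma continuous_dirDeriv {f : M → ℝ} (hf : ContMDiff 𝕀 𝓘(ℝ, ℝ) ∞ f)
    {X : ∀ x : M, TangentSpace 𝕀 x} (hX : IsSmoothField X) :
    Continuous fun x => dirDeriv f x (X x) := by
  rw [continuous_iff_continuousAt]
  intro x₀
  have h1 : ContinuousAt (fun x => coordMap x₀ x (X x)) x₀ := by
    have := ((contMDiffAt_section x₀).1 (hX x₀)).continuousAt
    refine this.congr ?_
    filter_upwards [extChartAt_source_mem_nhds (I := 𝕀) x₀] with x hx
    rw [extChartAt_source] at hx
    rw [Trivialization.continuousLinearMapAt_apply, Trivialization.linearMapAt_apply,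
      if_pos (by simpa using hx)]
  have h2 := (continuousAt_fderiv_comp_extChartAt_symm hf (mem_extChartAt_source x₀)).clm_apply h1
  refine h2.congr ?_
  filter_upwards [extChartAt_source_mem_nhds (I := 𝕀) x₀] with x hx
  rw [extChartAt_source] at hx
  exact (mfderiv_eq_fderiv_coordMap (hf.mdifferentiableAt (by simp)) hx (X x)).symm

variable [IsRiemannianManifold (𝓡 (n + 1)) M] [MeasurableSpace M] [BorelSpace M] [CompactSpace M]
  [SecondCountableTopology M]

lemma integrable_of_continuous {h : M → ℝ} (hh : Continuous h) : Integrable h (riemVol n) :=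
  hh.integrable_of_hasCompactSupport (HasCompactSupport.of_compactSpace h)

lemma IsDivergence.integral_mul {X : ∀ x : M, TangentSpace 𝕀 x} {h : M → ℝ}
    (hh : IsDivergence n X h)
    {φ : M → ℝ} (hφ : ContMDiff 𝕀 𝓘(ℝ, ℝ) ∞ φ) :
    ∫ x, h x * φ x ∂(riemVol n) = - ∫ x, dirDeriv φ x (X x) ∂(riemVol n) := hh.2 φ hφ

/-- The test function `1` in the divergence theorem. -/
lemma IsDivergence.integral_eq_zero {X : ∀ x : M, TangentSpace 𝕀 x} {h : M → ℝ}
    (hh : IsDivergence n X h) : ∫ x, h x ∂(riemVol n) = 0 := by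
  have h1 := hh.integral_mul (φ := fun _ => 1) contMDiff_const
  simp only [mul_one, dirDeriv, mfderiv_const] at h1
  rw [h1, neg_eq_zero]
  exact integral_zero _ _

lemma IsDivergence.neg {X : ∀ x : M, TangentSpace 𝕀 x} {h : M → ℝ}
    (hh : IsDivergence n X h) : IsDivergence n (fun x => -X x) (fun x => -h x) := by
  refine ⟨hh.1.neg, fun φ hφ => ?_⟩
  have h1 := hh.integral_mul hφ
  simp only [neg_mul, integral_neg, h1, neg_inj]
  rw [← integral_neg]
  exact integral_congr_ae (Eventually.of_forall fun x => ((mfderiv 𝕀 𝓘(ℝ, ℝ) φ x).map_neg _).symm)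

lemma IsDivergence.add {X Y : ∀ x : M, TangentSpace 𝕀 x} {h k : M → ℝ} (hX : IsSmoothField X)
    (hY : IsSmoothField Y) (hh : IsDivergence n X h) (hk : IsDivergence n Y k) :
    IsDivergence n (fun x => X x + Y x) (fun x => h x + k x) := by
  refine ⟨hh.1.add hk.1, fun φ hφ => ?_⟩
  have h1 := hh.integral_mul hφ
  have h2 := hk.integral_mul hφ
  have e : ∀ x, (mfderiv 𝕀 𝓘(ℝ, ℝ) φ x (X x + Y x)) = dirDeriv φ x (X x) + dirDeriv φ x (Y x) :=
    fun x => (mfderiv 𝕀 𝓘(ℝ, ℝ) φ x).map_add _ _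
  simp only [add_mul]
  refine Eq.trans ?_ (congr_arg Neg.neg (integral_congr_ae (Eventually.of_forall e)).symm)
  rw [integral_add, integral_add, h1, h2, neg_add]
  · exact integrable_of_continuous (continuous_dirDeriv hφ hX)
  · exact integrable_of_continuous (continuous_dirDeriv hφ hY)
  · exact integrable_of_continuous (hh.1.mul hφ.continuous)
  · exact integrable_of_continuous (hk.1.mul hφ.continuous)

/-- The product rule `div(ηX) = η div X + dη(X)`. -/
lemma IsDivergence.smul {X : ∀ x : M, TangentSpace 𝕀 x} {h : M → ℝ} (hX : IsSmoothField X)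
    (hh : IsDivergence n X h) {η : M → ℝ} (hη : ContMDiff 𝕀 𝓘(ℝ, ℝ) ∞ η) :
    IsDivergence n (fun x => η x • X x) (fun x => η x * h x + dirDeriv η x (X x)) := by
  refine ⟨(hη.continuous.mul hh.1).add (continuous_dirDeriv hη hX), fun φ hφ => ?_⟩
  have hηφ : ContMDiff 𝕀 𝓘(ℝ, ℝ) ∞ (fun x => η x * φ x) := hη.mul hφ
  have h1 := hh.integral_mul hηφ
  have h2 : ∀ x, dirDeriv (fun x => η x * φ x) x (X x) =
      η x * dirDeriv φ x (X x) + φ x * dirDeriv η x (X x) := fun x => dirDeriv_mul hη hφ x _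
  have c1 : Integrable (fun x => η x * dirDeriv φ x (X x)) (riemVol n) :=
    integrable_of_continuous (hη.continuous.mul (continuous_dirDeriv hφ hX))
  have c2 : Integrable (fun x => φ x * dirDeriv η x (X x)) (riemVol n) :=
    integrable_of_continuous (hφ.continuous.mul (continuous_dirDeriv hη hX))
  have c3 : Integrable (fun x => h x * (η x * φ x)) (riemVol n) :=
    integrable_of_continuous (hh.1.mul (hη.continuous.mul hφ.continuous))
  have h3 : ∫ x, dirDeriv (fun x => η x * φ x) x (X x) ∂(riemVol n) =
      ∫ x, η x * dirDeriv φ x (X x) ∂(riemVol n) + ∫ x, φ x * dirDeriv η x (X x) ∂(riemVol n) := by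
    rw [← integral_add c1 c2]
    exact integral_congr_ae (Eventually.of_forall h2)
  have e : ∀ x, mfderiv 𝕀 𝓘(ℝ, ℝ) φ x (η x • X x) = η x * dirDeriv φ x (X x) :=
    fun x => (mfderiv 𝕀 𝓘(ℝ, ℝ) φ x).map_smul _ _
  have h5 : ∫ x, (η x * h x + dirDeriv η x (X x)) * φ x ∂(riemVol n) =
      ∫ x, h x * (η x * φ x) ∂(riemVol n) + ∫ x, φ x * dirDeriv η x (X x) ∂(riemVol n) := by
    rw [← integral_add c3 c2]
    congr 1
    ext x
    ring
  refine Eq.trans ?_ (congr_arg Neg.neg (integral_congr_ae (Eventually.of_forall e)).symm)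
  rw [h5]
  refine (congr_arg (· + _) (h1.trans (congr_arg Neg.neg h3))).trans ?_
  ring

/-- The divergence is unique. -/
lemma IsDivergence.ae_eq {X : ∀ x : M, TangentSpace 𝕀 x} {h k : M → ℝ}
    (hh : IsDivergence n X h) (hk : IsDivergence n X k) : h =ᵐ[riemVol n] k := by
  refine ae_eq_of_integral_contMDiff_smul_eq 𝕀
    (integrable_of_continuous hh.1).locallyIntegrable
    (integrable_of_continuous hk.1).locallyIntegrable fun g hg _ => ?_
  have h1 := (hh.integral_mul hg).trans (hk.integral_mul hg).symm
  simpa only [smul_eq_mul, mul_comm (g _)] using h1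

lemma ofReal_integral_le_perimeter {Ω U : Set M} {X : ∀ x : M, TangentSpace 𝕀 x} {h : M → ℝ}
    (hX : IsSmoothField X) (hU : closure {x | X x ≠ 0} ⊆ U) (hX1 : ∀ x, ‖X x‖ ≤ 1)
    (hh : IsDivergence n X h) : ENNReal.ofReal (∫ x in Ω, h x ∂(riemVol n)) ≤ perimeter n Ω U := by
  unfold perimeter
  exact le_iSup_of_le X (le_iSup_of_le h (le_iSup_of_le hX (le_iSup_of_le hU
    (le_iSup_of_le hX1 (le_iSup_of_le hh le_rfl)))))

lemma perimeter_le {Ω U : Set M} {C : ℝ≥0∞} (H : ∀ (X : ∀ x : M, TangentSpace 𝕀 x) (h : M → ℝ),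
    IsSmoothField X → closure {x | X x ≠ 0} ⊆ U → (∀ x, ‖X x‖ ≤ 1) → IsDivergence n X h →
    ENNReal.ofReal (∫ x in Ω, h x ∂(riemVol n)) ≤ C) : perimeter n Ω U ≤ C := by
  unfold perimeter
  exact iSup_le fun X => iSup_le fun h => iSup_le fun hX => iSup_le fun hU => iSup_le fun hX1 =>
    iSup_le fun hh => H X h hX hU hX1 hh

lemma perimeter_congr_ae {Ω Θ : Set M} (h : Ω =ᵐ[riemVol n] Θ) (U : Set M) :
    perimeter n Ω U = perimeter n Θ U := by
  unfold perimeter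
  simp_rw [setIntegral_congr_set h]

lemma isSmoothField_neg {X : ∀ x : M, TangentSpace 𝕀 x} (hX : IsSmoothField X) :
    IsSmoothField fun x => -X x :=
  hX.neg_section

lemma perimeter_compl_le {Ω : Set M} (hΩ : MeasurableSet Ω) (U : Set M) :
    perimeter n Ωᶜ U ≤ perimeter n Ω U := by
  refine perimeter_le fun X h hX hU hX1 hh => ?_
  have h1 : ∫ x in Ωᶜ, h x ∂(riemVol n) = ∫ x in Ω, -h x ∂(riemVol n) := by
    have := integral_add_compl hΩ (integrable_of_continuous (n := n) hh.1)
    rw [hh.integral_eq_zero] at this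
    rw [integral_neg]
    linarith
  rw [h1]
  exact ofReal_integral_le_perimeter (isSmoothField_neg hX)
    (by simpa only [ne_eq, neg_eq_zero] using hU)
    (fun x => by rw [norm_neg]; exact hX1 x) hh.neg

lemma perimeter_compl {Ω : Set M} (hΩ : MeasurableSet Ω) (U : Set M) :
    perimeter n Ωᶜ U = perimeter n Ω U := by
  refine le_antisymm (perimeter_compl_le hΩ U) ?_
  conv_lhs => rw [← compl_compl Ω]
  exact perimeter_compl_le hΩ.compl U

lemma perimeter_empty (U : Set M) : perimeter n (∅ : Set M) U = 0 := by
  refine le_antisymm (perimeter_le fun X h _ _ _ _ => ?_) zero_le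
  simp

lemma ofReal_integral_le_lintegral_ofReal {α : Type*} [MeasurableSpace α] (μ : Measure α)
    (g : α → ℝ) : ENNReal.ofReal (∫ x, g x ∂μ) ≤ ∫⁻ x, ENNReal.ofReal (g x) ∂μ := by
  by_cases hg : Integrable g μ
  · rw [integral_eq_lintegral_pos_part_sub_lintegral_neg_part hg]
    refine (ENNReal.ofReal_le_ofReal (sub_le_self _ ENNReal.toReal_nonneg)).trans ?_
    exact ENNReal.ofReal_toReal_le
  · simp [integral_undef hg]

/-- A smooth function with values in `[0, 1]` which increases from `0` at `c` to `1` at `c + ε`,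
and whose slope nowhere exceeds the mean slope `1 / ε` by more than the factor `1 + ε`. -/
lemma exists_smooth_step (c : ℝ) {ε : ℝ} (hε : 0 < ε) : ∃ ζ : ℝ → ℝ, ContDiff ℝ ∞ ζ ∧
    (∀ s, ζ s ∈ Icc (0 : ℝ) 1) ∧ (∀ s ≤ c, ζ s = 0) ∧ (∀ s, c + ε ≤ s → ζ s = 1) ∧
    (∀ s, 0 ≤ deriv ζ s ∧ deriv ζ s ≤ (1 + ε) / ε) ∧ ∀ s, deriv ζ s ≠ 0 → s ∈ Icc c (c + ε) := by
  have hlt : ε / (2 * (1 + ε)) < ε / 2 := by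
    rw [div_lt_div_iff₀ (by positivity) (by positivity)]
    nlinarith
  -- The derivative is a normalized bump on `[c, c + ε]` with a plateau on most of the interval.
  let b : ContDiffBump (c + ε / 2) := ⟨ε / (2 * (1 + ε)), ε / 2, by positivity, hlt⟩
  let g : ℝ → ℝ := b.normed volume
  have hg : ContDiff ℝ ∞ g := b.contDiff_normed
  have hg0 : ∀ s, 0 ≤ g s := fun s => b.nonneg_normed s
  have hgs : ∀ s, g s ≠ 0 → s ∈ Ioo c (c + ε) := fun s hs => by
    have : s ∈ Function.support g := hs
    rw [b.support_normed_eq, Real.ball_eq_Ioo] at this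
    constructor
    · have := this.1; simp only [b] at this; linarith
    · have := this.2; simp only [b] at this; linarith
  have hgb : ∀ s, g s ≤ (1 + ε) / ε := fun s => by
    refine (b.normed_le_div_measure_closedBall_rIn volume s).trans (le_of_eq ?_)
    rw [Real.volume_real_closedBall (by positivity)]
    simp only [b]
    field_simp
  let ζ : ℝ → ℝ := fun s => ∫ t in c..s, g t
  have hd : ∀ s, HasDerivAt ζ (g s) s := fun s =>
    intervalIntegral.integral_hasDerivAt_right (hg.continuous.intervalIntegrable _ _)
      hg.continuous.stronglyMeasurable.stronglyMeasurableAtFilter hg.continuous.continuousAt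
  have hderiv : deriv ζ = g := funext fun s => (hd s).deriv
  have hmono : Monotone ζ := monotone_of_deriv_nonneg (fun s => (hd s).differentiableAt)
    fun s => by rw [hderiv]; exact hg0 s
  have h0 : ∀ s ≤ c, ζ s = 0 := fun s hs => by
    refine intervalIntegral.integral_zero_ae (Eventually.of_forall fun t ht => ?_)
    by_contra hne
    have h1 := hgs t hne
    rw [uIoc_of_ge hs] at ht
    exact absurd h1.1 (not_lt.2 ht.2)
  have h1 : ∀ s, c + ε ≤ s → ζ s = 1 := fun s hs => by
    have h2 : ∫ t, g t = 1 := b.integral_normed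
    rw [← h2]
    change ∫ t in c..s, g t = _
    refine intervalIntegral.integral_eq_integral_of_support_subset fun t ht => ?_
    have := hgs t ht
    exact ⟨this.1, this.2.le.trans hs⟩
  refine ⟨ζ, ?_, fun s => ⟨?_, ?_⟩, h0, h1, fun s => ?_, fun s hs => ?_⟩
  · exact contDiff_infty_iff_deriv.2 ⟨fun s => (hd s).differentiableAt, by rwa [hderiv]⟩
  · rw [← h0 (min s c) (min_le_right _ _)]; exact hmono (min_le_left _ _)
  · rw [← h1 (max s (c + ε)) (le_max_right _ _)]; exact hmono (le_max_left _ _)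
  · rw [hderiv]; exact ⟨hg0 s, hgb s⟩
  · rw [hderiv] at hs; exact Ioo_subset_Icc_self (hgs s hs)

/-- Adding a sublevel set of a smooth function increases the perimeter at most by the largest area
of a level set. -/
theorem perimeter_union_sublevel_le {f : M → ℝ} (hf : ContMDiff 𝕀 𝓘(ℝ, ℝ) ∞ f) {Ω : Set M}
    (hΩ : MeasurableSet Ω) (c : ℝ) (U : Set M) :
    perimeter n (Ω ∪ {x | f x ≤ c}) U ≤
      perimeter n Ω U + ⨆ s : ℝ, (μHE[n] : Measure M) (f ⁻¹' {s} ∩ U) := by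
  set S : ℝ≥0∞ := ⨆ s : ℝ, (μHE[n] : Measure M) (f ⁻¹' {s} ∩ U) with hS
  refine perimeter_le fun X h hX hU hX1 hh => ?_
  have hB : MeasurableSet {x | f x ≤ c} := hf.continuous.measurable measurableSet_Iic
  obtain ⟨ε, -, hεpos, hεlim⟩ := exists_seq_strictAnti_tendsto (0 : ℝ)
  choose ζ hζ hζI hζ0 hζ1 hζd hζs using fun k => exists_smooth_step c (hεpos k)
  have hη : ∀ k, ContMDiff 𝕀 𝓘(ℝ, ℝ) ∞ (fun x => ζ k (f x)) := fun k => (hζ k).contMDiff.comp hf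
  have hint : Integrable h (riemVol n) := integrable_of_continuous hh.1
  -- `1_{Ω ∪ B}` is the limit of `1_Ω ζ(f) + (1 - ζ(f))`
  have hlim : Tendsto (fun k => ∫ x, (Ω.indicator (fun x => ζ k (f x) * h x) x +
      (h x - h x * ζ k (f x))) ∂(riemVol n)) atTop
      (𝓝 (∫ x, (Ω ∪ {x | f x ≤ c}).indicator h x ∂(riemVol n))) := by
    refine tendsto_integral_of_dominated_convergence (fun x => 2 * ‖h x‖) (fun k => ?_)
      (hint.norm.const_mul 2) (fun k => Eventually.of_forall fun x => ?_)
      (Eventually.of_forall fun x => ?_)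
    · have c1 := ((hη k).continuous.mul hh.1).measurable
      exact ((c1.indicator hΩ).add (hh.1.measurable.sub (hh.1.mul
        (hη k).continuous).measurable)).aestronglyMeasurable
    · have h1 := hζI k (f x)
      rw [two_mul]
      refine (norm_add_le _ _).trans (add_le_add ?_ ?_)
      · refine (norm_indicator_le_norm_self _ _).trans ?_
        rw [norm_mul, Real.norm_of_nonneg h1.1]
        exact mul_le_of_le_one_left (norm_nonneg _) h1.2
      · rw [show h x - h x * ζ k (f x) = (1 - ζ k (f x)) * h x by ring, norm_mul,
          Real.norm_of_nonneg (by linarith [h1.2])]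
        exact mul_le_of_le_one_left (norm_nonneg _) (by linarith [h1.1])
    · by_cases hx : f x ≤ c
      · rw [indicator_of_mem (by exact Or.inr hx)]
        refine tendsto_const_nhds.congr fun k => ?_
        by_cases hxΩ : x ∈ Ω <;> simp [hxΩ, hζ0 k _ hx]
      · have h2 : ∀ᶠ k in atTop, ε k < f x - c :=
          hεlim.eventually (gt_mem_nhds (by push Not at hx; linarith))
        refine tendsto_const_nhds.congr' ?_
        filter_upwards [h2] with k hk
        by_cases hxΩ : x ∈ Ω <;> simp [hxΩ, hx, hζ1 k (f x) (by linarith)]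
  rw [integral_indicator (hΩ.union hB)] at hlim
  have hlim2 : Tendsto (fun k => perimeter n Ω U + ENNReal.ofReal (1 + ε k) * S) atTop
      (𝓝 (perimeter n Ω U + S)) := by
    refine tendsto_const_nhds.add ?_
    conv => enter [3, 1]; rw [← one_mul S]
    refine ENNReal.Tendsto.mul_const ?_ (Or.inl one_ne_zero)
    rw [← ENNReal.ofReal_one]
    refine ENNReal.tendsto_ofReal ?_
    simpa using hεlim.const_add 1
  refine le_of_tendsto_of_tendsto' (ENNReal.tendsto_ofReal hlim) hlim2 fun k => ?_
  have hηX := continuous_dirDeriv (hη k) hX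
  -- The product rule for `div (ζ(f) X)` and `∫ div X = 0` leave the integral of `dζ(f)(X)` over the
  -- complement of `Ω`.
  have e1 : ∫ x, (Ω.indicator (fun x => ζ k (f x) * h x) x + (h x - h x * ζ k (f x))) ∂(riemVol n) =
      ∫ x in Ω, (ζ k (f x) * h x + dirDeriv (fun x => ζ k (f x)) x (X x)) ∂(riemVol n) +
      ∫ x in Ωᶜ, dirDeriv (fun x => ζ k (f x)) x (X x) ∂(riemVol n) := by
    have i1 : Integrable (fun x => ζ k (f x) * h x) (riemVol n) :=
      integrable_of_continuous ((hη k).continuous.mul hh.1)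
    have i2 : Integrable (fun x => h x * ζ k (f x)) (riemVol n) :=
      integrable_of_continuous (hh.1.mul (hη k).continuous)
    have i4 : Integrable (fun x => h x - h x * ζ k (f x)) (riemVol n) := hint.sub i2
    have i3 := integrable_of_continuous (n := n) hηX
    rw [integral_add (i1.indicator hΩ) i4, integral_sub hint i2, hh.integral_eq_zero,
      integral_indicator hΩ, integral_add i1.integrableOn i3.integrableOn, add_assoc,
      integral_add_compl hΩ i3, hh.integral_mul (hη k), zero_sub, neg_neg]
  rw [e1]
  -- The field `ζ(f) X` competes for the perimeter of `Ω`.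
  refine ENNReal.ofReal_add_le.trans (add_le_add ?_ ?_)
  · refine ofReal_integral_le_perimeter (X := fun x => ζ k (f x) • X x)
      ((hη k).smul_section hX) (Subset.trans (closure_mono ?_) hU)
      (fun x => ?_) (hh.smul hX (hη k))
    · intro x hx hx0
      exact hx (by rw [hx0, smul_zero])
    · rw [norm_smul, Real.norm_of_nonneg (hζI k _).1]
      exact mul_le_one₀ (hζI k _).2 (norm_nonneg _) (hX1 x)
  · -- the coarea inequality in the strip `c ≤ f ≤ c + ε`
    set A : Set M := Ωᶜ ∩ (f ⁻¹' Icc c (c + ε k) ∩ closure {x | X x ≠ 0}) with hA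
    have hAm : MeasurableSet A := hΩ.compl.inter
      ((hf.continuous.measurable measurableSet_Icc).inter isClosed_closure.measurableSet)
    have hpt : ∀ x ∈ Ωᶜ, ENNReal.ofReal (dirDeriv (fun x => ζ k (f x)) x (X x)) ≤
        ENNReal.ofReal ((1 + ε k) / ε k) *
          A.indicator (fun x => ENNReal.ofReal (dirDeriv f x (X x))) x := by
      intro x hxΩ
      rw [dirDeriv_comp hf (hζ k)]
      by_cases hxA : x ∈ A
      · rw [indicator_of_mem hxA, ENNReal.ofReal_mul (hζd k _).1]
        gcongr
        exact (hζd k _).2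
      · rw [indicator_of_notMem hxA, mul_zero]
        have : deriv (ζ k) (f x) * dirDeriv f x (X x) = 0 := by
          by_contra hne
          rw [mul_eq_zero, not_or] at hne
          refine hxA ⟨hxΩ, hζs k _ hne.1, subset_closure fun h0 => hne.2 ?_⟩
          rw [h0]
          exact (mfderiv 𝕀 𝓘(ℝ, ℝ) f x).map_zero
        rw [this, ENNReal.ofReal_zero]
    calc ENNReal.ofReal (∫ x in Ωᶜ, dirDeriv (fun x => ζ k (f x)) x (X x) ∂(riemVol n))
        ≤ ∫⁻ x in Ωᶜ, ENNReal.ofReal (dirDeriv (fun x => ζ k (f x)) x (X x)) ∂(riemVol n) :=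
          ofReal_integral_le_lintegral_ofReal _ _
      _ ≤ ∫⁻ x in Ωᶜ, ENNReal.ofReal ((1 + ε k) / ε k) *
            A.indicator (fun x => ENNReal.ofReal (dirDeriv f x (X x))) x ∂(riemVol n) :=
          setLIntegral_mono' hΩ.compl hpt
      _ ≤ ENNReal.ofReal ((1 + ε k) / ε k) *
            ∫⁻ x in A, ENNReal.ofReal (dirDeriv f x (X x)) ∂(riemVol n) := by
          rw [lintegral_const_mul' _ _ ENNReal.ofReal_ne_top]
          refine mul_le_mul_right ?_ _
          exact (setLIntegral_le_lintegral _ _).trans (lintegral_indicator hAm _).le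
      _ ≤ ENNReal.ofReal ((1 + ε k) / ε k) * (ENNReal.ofReal (ε k) * S) := by
          gcongr
          refine (lintegral_mfderiv_le_lintegral_level hf hX1 hAm).trans ?_
          have : ∀ s : ℝ, (μHE[n] : Measure M) (A ∩ f ⁻¹' {s}) ≤
              (Icc c (c + ε k)).indicator (fun _ => S) s := by
            intro s
            by_cases hs : s ∈ Icc c (c + ε k)
            · rw [indicator_of_mem hs]
              refine le_trans (measure_mono ?_)
                (le_iSup (fun s : ℝ => (μHE[n] : Measure M) (f ⁻¹' {s} ∩ U)) s)
              rintro x ⟨⟨-, -, hx⟩, hxs⟩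
              exact ⟨hxs, hU hx⟩
            · rw [indicator_of_notMem hs]
              refine le_of_eq (measure_mono_null (t := ∅) ?_ measure_empty)
              rintro x ⟨⟨-, hx, -⟩, hxs⟩
              rw [mem_preimage, mem_singleton_iff] at hxs
              exact hs (hxs ▸ hx)
          refine (lintegral_mono this).trans ?_
          rw [lintegral_indicator_const measurableSet_Icc, Real.volume_Icc, mul_comm]
          gcongr
          linarith
      _ = ENNReal.ofReal (1 + ε k) * S := by
          rw [← mul_assoc, ← ENNReal.ofReal_mul (by have := hεpos k; positivity),
            div_mul_cancel₀ _ (hεpos k).ne']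

end Perimeter

/-! ### Vector fields with support in a chart -/

section ChartFields

variable {n : ℕ} {M : Type*} [MetricSpace M]
    [ChartedSpace (EuclideanSpace ℝ (Fin (n + 1))) M] [IsManifold (𝓡 (n + 1)) ∞ M]

local notation "𝔼" => EuclideanSpace ℝ (Fin (n + 1))
local notation "𝕀" => 𝓡 (n + 1)

/-- A function on the target of the chart at `x₀`, seen as a function on `M` which vanishes outside
the domain of the chart. -/
def chartLift (x₀ : M) (w : EuclideanSpace ℝ (Fin (n + 1)) → ℝ) : M → ℝ :=
  (extChartAt (𝓡 (n + 1)) x₀).source.indicator fun x => w (extChartAt (𝓡 (n + 1)) x₀ x)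

lemma chartLift_of_mem {x₀ x : M} {w : 𝔼 → ℝ} (hx : x ∈ (extChartAt 𝕀 x₀).source) :
    chartLift x₀ w x = w (extChartAt 𝕀 x₀ x) := indicator_of_mem hx _

lemma chartLift_symm {x₀ : M} {w : 𝔼 → ℝ} {z : 𝔼} (hz : z ∈ (extChartAt 𝕀 x₀).target) :
    chartLift x₀ w ((extChartAt 𝕀 x₀).symm z) = w z := by
  rw [chartLift_of_mem ((extChartAt 𝕀 x₀).map_target hz), (extChartAt 𝕀 x₀).right_inv hz]

lemma chartLift_eq_zero {x₀ x : M} {w : 𝔼 → ℝ} {K : Set 𝔼} (hw : Function.support w ⊆ K)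
    (hx : x ∉ (extChartAt 𝕀 x₀).symm '' K) : chartLift x₀ w x = 0 := by
  by_contra h
  have hxs : x ∈ (extChartAt 𝕀 x₀).source := mem_of_indicator_ne_zero h
  rw [chartLift_of_mem hxs] at h
  exact hx ⟨_, hw h, (extChartAt 𝕀 x₀).left_inv hxs⟩

lemma isCompact_symm_image (x₀ : M) {K : Set 𝔼} (hK : IsCompact K)
    (hKt : K ⊆ (extChartAt 𝕀 x₀).target) : IsCompact ((extChartAt 𝕀 x₀).symm '' K) :=
  hK.image_of_continuousOn ((continuousOn_extChartAt_symm x₀).mono hKt)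

lemma symm_image_subset_source (x₀ : M) {K : Set 𝔼}
    (hKt : K ⊆ (extChartAt 𝕀 x₀).target) :
    (extChartAt 𝕀 x₀).symm '' K ⊆ (extChartAt 𝕀 x₀).source := by
  rintro _ ⟨z, hz, rfl⟩
  exact (extChartAt 𝕀 x₀).map_target (hKt hz)

lemma contMDiff_chartLift (x₀ : M) {w : 𝔼 → ℝ} {K : Set 𝔼} (hK : IsCompact K)
    (hKt : K ⊆ (extChartAt 𝕀 x₀).target) (hw : Function.support w ⊆ K)
    (hs : ContDiffOn ℝ ∞ w (extChartAt 𝕀 x₀).target) :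
    ContMDiff 𝕀 𝓘(ℝ, ℝ) ∞ (chartLift x₀ w) := by
  intro x
  by_cases hx : x ∈ (extChartAt 𝕀 x₀).source
  · have h1 : ContMDiffAt 𝕀 𝓘(ℝ, ℝ) ∞ (fun x => w (extChartAt 𝕀 x₀ x)) x := by
      refine ContMDiffAt.comp (I' := 𝓘(ℝ, 𝔼)) x ?_
        (contMDiffAt_extChartAt' (by rwa [← extChartAt_source 𝕀]))
      exact (hs.contDiffAt ((isOpen_extChartAt_target x₀).mem_nhds
        ((extChartAt 𝕀 x₀).map_source hx))).contMDiffAt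
    refine h1.congr_of_eventuallyEq ?_
    filter_upwards [extChartAt_source_mem_nhds' hx] with y hy
    exact chartLift_of_mem hy
  · have hc := isCompact_symm_image x₀ hK hKt
    have hxc : x ∈ ((extChartAt 𝕀 x₀).symm '' K)ᶜ := fun h => hx (symm_image_subset_source x₀ hKt h)
    refine (contMDiffAt_const (c := (0 : ℝ))).congr_of_eventuallyEq ?_
    filter_upwards [hc.isClosed.isOpen_compl.mem_nhds hxc] with y hy
    exact chartLift_eq_zero hw hy

variable
    [RiemannianBundle (fun x : M => TangentSpace (𝓡 (n + 1)) x)]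
    [IsContMDiffRiemannianBundle (𝓡 (n + 1)) ∞ (EuclideanSpace ℝ (Fin (n + 1)))
      (fun x : M => TangentSpace (𝓡 (n + 1)) x)]

/-- The vector field `(Y / ρ) ∂_v` of the chart at `x₀`, where `ρ` is the density of the volume: its
divergence is `∂_v Y / ρ`. -/
def chartField (x₀ : M) (v : EuclideanSpace ℝ (Fin (n + 1)))
    (Y : EuclideanSpace ℝ (Fin (n + 1)) → ℝ) (x : M) : TangentSpace (𝓡 (n + 1)) x :=
  chartLift x₀ (fun z => Y z / chartDensity x₀ z) x • frameMap x₀ x v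

lemma chartField_eq_zero {x₀ x : M} {v : 𝔼} {Y : 𝔼 → ℝ} {K : Set 𝔼} (hY : Function.support Y ⊆ K)
    (hx : x ∉ (extChartAt 𝕀 x₀).symm '' K) : chartField x₀ v Y x = 0 := by
  have h : Function.support (fun z => Y z / chartDensity x₀ z) ⊆ K := fun z hz =>
    hY fun h0 => hz (by simp only [h0, zero_div])
  rw [chartField, chartLift_eq_zero h hx, zero_smul]

lemma isSmoothField_chartField (x₀ : M) (v : 𝔼) {Y : 𝔼 → ℝ} {K : Set 𝔼} (hK : IsCompact K)
    (hKt : K ⊆ (extChartAt 𝕀 x₀).target) (hYK : Function.support Y ⊆ K)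
    (hY : ContDiffOn ℝ ∞ Y (extChartAt 𝕀 x₀).target) : IsSmoothField (chartField x₀ v Y) := by
  have h : Function.support (fun z => Y z / chartDensity x₀ z) ⊆ K := fun z hz =>
    hYK fun h0 => hz (by simp only [h0, zero_div])
  have hs : ContDiffOn ℝ ∞ (fun z => Y z / chartDensity x₀ z) (extChartAt 𝕀 x₀).target :=
    hY.div (contDiffOn_chartDensity x₀) fun z hz => (chartDensity_pos x₀ hz).ne'
  have hl := contMDiff_chartLift x₀ hK hKt h hs
  intro x
  by_cases hx : x ∈ (extChartAt 𝕀 x₀).source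
  · have hx' : x ∈ (chartAt 𝔼 x₀).source := by rwa [← extChartAt_source 𝕀]
    exact (hl x).smul_section ((contMDiffOn_frameMap x₀ v).contMDiffAt
      ((chartAt 𝔼 x₀).open_source.mem_nhds hx'))
  · have hc := isCompact_symm_image x₀ hK hKt
    have hxc : x ∈ ((extChartAt 𝕀 x₀).symm '' K)ᶜ := fun h => hx (symm_image_subset_source x₀ hKt h)
    have h0 : IsSmoothField (fun x : M => (0 : TangentSpace 𝕀 x)) := contMDiff_zeroSection _ _
    refine (h0 x).congr_of_eventuallyEq ?_
    filter_upwards [hc.isClosed.isOpen_compl.mem_nhds hxc] with y hy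
    rw [chartField_eq_zero hYK hy]

/-- On compact subsets of a chart, the fields `∂_v / ρ` are bounded by a multiple of `|v|`. -/
lemma exists_norm_frameMap_le (x₀ : M) {K : Set 𝔼} (hK : IsCompact K)
    (hKt : K ⊆ (extChartAt 𝕀 x₀).target) : ∃ C : ℝ, 0 < C ∧ ∀ z ∈ K, ∀ v : 𝔼,
      ‖frameMap x₀ ((extChartAt 𝕀 x₀).symm z) v‖ / chartDensity x₀ z ≤ C * ‖v‖ := by
  let b := EuclideanSpace.basisFun (Fin (n + 1)) ℝ
  have hcont : ∀ i, ContinuousOn (fun z => ‖frameMap x₀ ((extChartAt 𝕀 x₀).symm z) (b i)‖ /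
      chartDensity x₀ z) (extChartAt 𝕀 x₀).target := by
    intro i
    have hs : ContMDiffOn 𝓘(ℝ, 𝔼) (𝕀).tangent ∞ (fun z =>
        (⟨(extChartAt 𝕀 x₀).symm z, frameMap x₀ ((extChartAt 𝕀 x₀).symm z) (b i)⟩ :
          TangentBundle 𝕀 M)) (extChartAt 𝕀 x₀).target :=
      (contMDiffOn_frameMap x₀ (b i)).comp (contMDiffOn_extChartAt_symm x₀)
        (fun z hz => symm_mem_chart_source hz)
    have h1 := (ContMDiffOn.inner_bundle hs hs).continuousOn
    refine ContinuousOn.div ((Real.continuous_sqrt.comp_continuousOn h1).congr fun z hz => ?_)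
      (contDiffOn_chartDensity x₀).continuousOn fun z hz => (chartDensity_pos x₀ hz).ne'
    rw [norm_eq_sqrt_real_inner]
    rfl
  choose C hC using fun i => hK.exists_bound_of_continuousOn ((hcont i).mono hKt)
  refine ⟨∑ i, |C i| + 1, by positivity, fun z hz v => ?_⟩
  have hρ := chartDensity_pos x₀ (hKt hz)
  have h1 : frameMap x₀ ((extChartAt 𝕀 x₀).symm z) v =
      ∑ i, v i • frameMap x₀ ((extChartAt 𝕀 x₀).symm z) (b i) := by
    conv_lhs => rw [← b.sum_repr v]
    rw [map_sum]
    simp only [map_smul]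
    rfl
  rw [h1, div_le_iff₀ hρ]
  refine (norm_sum_le _ _).trans ?_
  have h2 : ∀ i, ‖v i • frameMap x₀ ((extChartAt 𝕀 x₀).symm z) (b i)‖ ≤
      |C i| * (‖v‖ * chartDensity x₀ z) := fun i => by
    rw [norm_smul]
    have h3 := hC i z hz
    rw [norm_div, norm_norm, Real.norm_of_nonneg hρ.le, div_le_iff₀ hρ] at h3
    have h4 : ‖v i‖ ≤ ‖v‖ := PiLp.norm_apply_le v i
    calc _ ≤ ‖v‖ * (C i * chartDensity x₀ z) := by gcongr
      _ ≤ ‖v‖ * (|C i| * chartDensity x₀ z) := by gcongr; exact le_abs_self _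
      _ = _ := by ring
  refine (Finset.sum_le_sum fun i _ => h2 i).trans ?_
  rw [← Finset.sum_mul, add_mul, add_mul, mul_assoc]
  have : 0 ≤ 1 * ‖v‖ * chartDensity x₀ z := by positivity
  linarith

variable [IsRiemannianManifold (𝓡 (n + 1)) M] [MeasurableSpace M] [BorelSpace M]
  [SecondCountableTopology M]

/-- The part of the chart domain at `x₀` which lies in `A`, in coordinates. -/
abbrev chartSet (x₀ : M) (A : Set M) : Set (EuclideanSpace ℝ (Fin (n + 1))) :=
  (extChartAt (𝓡 (n + 1)) x₀).target ∩ (extChartAt (𝓡 (n + 1)) x₀).symm ⁻¹' A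

lemma measurableSet_chartSet (x₀ : M) {A : Set M} (hA : MeasurableSet A) :
    MeasurableSet (chartSet (n := n) x₀ A) := by
  have h1 := (measurableSet_extChartAt_target (n := n) x₀).subtype_image
    ((continuousOn_extChartAt_symm x₀).domRestrict.measurable hA)
  rwa [chartSet, ← Subtype.image_preimage_coe]

/-- Integrals of functions supported in a chart, in coordinates. -/
lemma setIntegral_chartLift (x₀ : M) {w : 𝔼 → ℝ} {A : Set M} (hA : MeasurableSet A) {u : M → ℝ}
    (hu : Measurable u) (hw : Measurable (chartLift x₀ w)) :
    ∫ x in A, chartLift x₀ w x * u x ∂(riemVol n) =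
      ∫ z in chartSet x₀ A,
        chartDensity x₀ z * (w z * u ((extChartAt 𝕀 x₀).symm z)) := by
  have hm := measurableSet_chartSet (n := n) x₀ hA
  have hS : MeasurableSet (extChartAt 𝕀 x₀).source := (isOpen_extChartAt_source x₀).measurableSet
  have h1 : ∀ x, A.indicator (fun x => chartLift x₀ w x * u x) x =
      (extChartAt 𝕀 x₀).source.indicator (A.indicator (fun x => chartLift x₀ w x * u x)) x := by
    intro x
    by_cases hx : x ∈ (extChartAt 𝕀 x₀).source
    · rw [indicator_of_mem hx]
    · rw [indicator_of_notMem hx, indicator_apply_eq_zero]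
      intro _
      rw [chartLift, indicator_of_notMem hx, zero_mul]
  have hm' : Measurable (A.indicator fun x => chartLift x₀ w x * u x) := (hw.mul hu).indicator hA
  rw [← integral_indicator hA]
  simp_rw [h1]
  rw [integral_indicator hS, setIntegral_chart_source x₀ hm']
  rw [← integral_indicator (measurableSet_extChartAt_target x₀), ← integral_indicator hm]
  congr 1
  ext z
  by_cases hz : z ∈ (extChartAt 𝕀 x₀).target
  · by_cases hzA : (extChartAt 𝕀 x₀).symm z ∈ A
    · rw [indicator_of_mem hz, indicator_of_mem hzA,
        indicator_of_mem (s := chartSet x₀ A) ⟨hz, hzA⟩,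
        chartLift_symm hz]
    · rw [indicator_of_mem hz, indicator_of_notMem hzA,
        indicator_of_notMem (s := chartSet x₀ A) fun h => hzA h.2, mul_zero]
  · rw [indicator_of_notMem hz, indicator_of_notMem (s := chartSet x₀ A) fun h => hz h.1]

lemma integrable_of_continuousOn_support {g : 𝔼 → ℝ} {K : Set 𝔼} (hK : IsCompact K)
    (hg : ContinuousOn g K) (hs : Function.support g ⊆ K) : Integrable g := by
  rw [← integrableOn_iff_integrable_of_support_subset hs]
  exact hg.integrableOn_compact hK

lemma support_fderiv_apply_subset_of_isCompact {Y : 𝔼 → ℝ} {K : Set 𝔼} (hK : IsCompact K)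
    (hYK : Function.support Y ⊆ K) (v : 𝔼) : Function.support (fun z => fderiv ℝ Y z v) ⊆ K := by
  intro z hz
  have h : z ∈ Function.support (fderiv ℝ Y) := fun h0 => hz (by simp only [h0, zero_apply])
  exact closure_minimal hYK hK.isClosed (support_fderiv_subset ℝ h)

/-- In the coordinates of the chart the divergence theorem for `(Y / ρ) ∂_v` is integration by
parts: the density `ρ` of the volume cancels. -/
lemma isDivergence_chartField [CompactSpace M] (x₀ : M) (v : 𝔼) {Y : 𝔼 → ℝ} {K : Set 𝔼}
    (hK : IsCompact K) (hKt : K ⊆ (extChartAt 𝕀 x₀).target) (hYK : Function.support Y ⊆ K)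
    (hY : ContDiff ℝ ∞ Y) : IsDivergence n (chartField x₀ v Y)
      (chartLift x₀ fun z => fderiv ℝ Y z v / chartDensity x₀ z) := by
  have hY' : ContDiff ℝ ∞ (fun z => fderiv ℝ Y z v) :=
    (hY.fderiv_right (m := ∞) (by simp)).clm_apply contDiff_const
  have hsY' := support_fderiv_apply_subset_of_isCompact hK hYK v
  have hs1 : Function.support (fun z => fderiv ℝ Y z v / chartDensity x₀ z) ⊆ K := fun z hz =>
    hsY' fun h0 => hz (by simp only [h0, zero_div])
  have hs2 : Function.support (fun z => Y z / chartDensity x₀ z) ⊆ K := fun z hz =>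
    hYK fun h0 => hz (by simp only [h0, zero_div])
  have hd1 : ContMDiff 𝕀 𝓘(ℝ, ℝ) ∞ (chartLift x₀ fun z => fderiv ℝ Y z v / chartDensity x₀ z) :=
    contMDiff_chartLift x₀ hK hKt hs1 (hY'.contDiffOn.div (contDiffOn_chartDensity x₀)
      fun z hz => (chartDensity_pos x₀ hz).ne')
  have hd2 : ContMDiff 𝕀 𝓘(ℝ, ℝ) ∞ (chartLift x₀ fun z => Y z / chartDensity x₀ z) :=
    contMDiff_chartLift x₀ hK hKt hs2 (hY.contDiffOn.div (contDiffOn_chartDensity x₀)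
      fun z hz => (chartDensity_pos x₀ hz).ne')
  refine ⟨hd1.continuous, fun φ hφ => ?_⟩
  set u : 𝔼 → ℝ := φ ∘ (extChartAt 𝕀 x₀).symm with hu
  have hus := contDiffOn_comp_extChartAt_symm hφ x₀
  have hud : ∀ z ∈ (extChartAt 𝕀 x₀).target, DifferentiableAt ℝ u z := fun z hz =>
    (hus.differentiableOn (by simp)).differentiableAt ((isOpen_extChartAt_target x₀).mem_nhds hz)
  have hufc : ContinuousOn (fun z => fderiv ℝ u z v) (extChartAt 𝕀 x₀).target :=
    (hus.continuousOn_fderiv_of_isOpen (isOpen_extChartAt_target x₀) (by simp)).clm_apply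
      continuousOn_const
  -- Both sides of the divergence theorem in coordinates.
  have hL : ∫ x, chartLift x₀ (fun z => fderiv ℝ Y z v / chartDensity x₀ z) x * φ x ∂(riemVol n) =
      ∫ z, fderiv ℝ Y z v * u z := by
    rw [← setIntegral_univ, setIntegral_chartLift x₀ MeasurableSet.univ hφ.continuous.measurable
      hd1.continuous.measurable, chartSet, preimage_univ, inter_univ,
      ← setIntegral_eq_integral_of_forall_compl_eq_zero (s := (extChartAt 𝕀 x₀).target)
        (f := fun z => fderiv ℝ Y z v * u z)]
    · refine setIntegral_congr_fun (measurableSet_extChartAt_target x₀) fun z hz => ?_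
      simp only [hu, Function.comp_apply]
      field_simp [(chartDensity_pos x₀ hz).ne']
    · intro z hz
      have : fderiv ℝ Y z v = 0 := by
        by_contra h
        exact hz (hKt (hsY' h))
      rw [this, zero_mul]
  have hR : ∫ x, dirDeriv φ x (chartField x₀ v Y x) ∂(riemVol n) = ∫ z, Y z * fderiv ℝ u z v := by
    have h1 : ∀ x, dirDeriv φ x (chartField x₀ v Y x) =
        chartLift x₀ (fun z => Y z / chartDensity x₀ z) x *
          chartLift x₀ (fun z => fderiv ℝ u z v) x := by
      intro x
      have h2 : dirDeriv φ x (chartField x₀ v Y x) =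
          chartLift x₀ (fun z => Y z / chartDensity x₀ z) x * dirDeriv φ x (frameMap x₀ x v) :=
        (mfderiv 𝕀 𝓘(ℝ, ℝ) φ x).map_smul _ _
      rw [h2]
      by_cases hx : x ∈ (extChartAt 𝕀 x₀).source
      · have hx' : x ∈ (chartAt 𝔼 x₀).source := by rwa [← extChartAt_source 𝕀]
        rw [mfderiv_eq_fderiv_coordMap (hφ.mdifferentiableAt (by simp)) hx', coordMap_frameMap hx',
          chartLift_of_mem (w := fun z => fderiv ℝ u z v) hx]
      · rw [chartLift, indicator_of_notMem hx, zero_mul, zero_mul]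
    have hm : Measurable (chartLift x₀ fun z => fderiv ℝ u z v) := by
      refine measurable_of_restrict_of_restrict_compl
        (isOpen_extChartAt_source (I := 𝕀) x₀).measurableSet ?_ ?_
      · have h3 : ContinuousOn (chartLift x₀ fun z => fderiv ℝ u z v) (extChartAt 𝕀 x₀).source :=
          (hufc.comp (continuousOn_extChartAt x₀) fun x hx => (extChartAt 𝕀 x₀).map_source hx).congr
            fun x hx => chartLift_of_mem hx
        exact h3.domRestrict.measurable
      · have : (extChartAt 𝕀 x₀).sourceᶜ.domRestrict (chartLift x₀ fun z => fderiv ℝ u z v) =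
            fun _ => 0 := by
          ext ⟨x, hx⟩
          exact (indicator_of_notMem hx _ : chartLift x₀ (fun z => fderiv ℝ u z v) x = 0)
        rw [this]
        exact measurable_const
    simp_rw [h1]
    rw [← setIntegral_univ, setIntegral_chartLift x₀ MeasurableSet.univ hm
      hd2.continuous.measurable, chartSet, preimage_univ, inter_univ,
      ← setIntegral_eq_integral_of_forall_compl_eq_zero (s := (extChartAt 𝕀 x₀).target)
        (f := fun z => Y z * fderiv ℝ u z v)]
    · refine setIntegral_congr_fun (measurableSet_extChartAt_target x₀) fun z hz => ?_
      simp only [chartLift_symm hz]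
      field_simp [(chartDensity_pos x₀ hz).ne']
    · intro z hz
      have : Y z = 0 := by
        by_contra h
        exact hz (hKt (hYK h))
      rw [this, zero_mul]
  rw [hL]
  refine Eq.trans ?_ (congr_arg Neg.neg hR).symm
  have hts : tsupport Y ⊆ K := closure_minimal hYK hK.isClosed
  rw [integral_mul_fderiv_eq_neg_fderiv_mul_of_integrable, neg_neg]
  · refine integrable_of_continuousOn_support hK
      (hY'.continuous.continuousOn.mul (hus.continuousOn.mono hKt)) fun z hz => hsY' fun h0 => hz ?_
    simp only [h0, zero_mul]
  · refine integrable_of_continuousOn_support hK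
      (hY.continuous.continuousOn.mul (hufc.mono hKt)) fun z hz => hYK fun h0 => hz ?_
    simp only [h0, zero_mul]
  · refine integrable_of_continuousOn_support hK
      (hY.continuous.continuousOn.mul (hus.continuousOn.mono hKt)) fun z hz => hYK fun h0 => hz ?_
    simp only [h0, zero_mul]
  · exact fun z _ => hY.differentiable (by simp) z
  · exact fun z hz => hud z (hKt (hts hz))

/-- The perimeter bounds the distributional derivative of the indicator function in a chart. -/
lemma exists_integral_fderiv_le_perimeter [CompactSpace M] (x₀ : M) {K : Set 𝔼} (hK : IsCompact K)
    (hKt : K ⊆ (extChartAt 𝕀 x₀).target) : ∃ C : ℝ, 0 < C ∧ ∀ (A U : Set M) (L : Set 𝔼) (P : ℝ≥0)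
      (Y : 𝔼 → ℝ) (v : 𝔼), MeasurableSet A → IsCompact L → L ⊆ K →
      (extChartAt 𝕀 x₀).symm '' L ⊆ U → perimeter n A U ≤ P →
      ContDiff ℝ ∞ Y → Function.support Y ⊆ L → (∀ z, |Y z| ≤ 1) →
      ∫ z in chartSet x₀ A, fderiv ℝ Y z v ≤ C * ‖v‖ * P := by
  obtain ⟨C, hC, hCK⟩ := exists_norm_frameMap_le x₀ hK hKt
  refine ⟨C, hC, fun A U L P Y v hA hL hLK hKU hP hY hYL hY1 => ?_⟩
  have hYK := hYL.trans hLK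
  rcases eq_or_ne v 0 with rfl | hv
  · simp
  have hv0 : 0 < C * ‖v‖ := by positivity
  -- Scaled such that the chart field has length at most `1`.
  let Z : 𝔼 → ℝ := fun z => (C * ‖v‖)⁻¹ * Y z
  have hZ : ContDiff ℝ ∞ Z := contDiff_const.mul hY
  have hZL : Function.support Z ⊆ L := fun z hz => hYL fun h0 => hz (by simp only [Z, h0, mul_zero])
  have hZK := hZL.trans hLK
  have hdiv := isDivergence_chartField x₀ v hK hKt hZK hZ
  have h1 := ofReal_integral_le_perimeter (Ω := A) (U := U)
    (isSmoothField_chartField x₀ v hK hKt hZK hZ.contDiffOn) ?_ ?_ hdiv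
  · have h2 := h1.trans hP
    rw [ENNReal.ofReal_le_iff_le_toReal ENNReal.coe_ne_top, ENNReal.coe_toReal] at h2
    have h3 := setIntegral_chartLift x₀ (w := fun z => fderiv ℝ Z z v / chartDensity x₀ z) hA
      (u := fun _ => 1) measurable_const hdiv.1.measurable
    simp only [mul_one] at h3
    rw [h3] at h2
    have h4 : ∫ z in chartSet x₀ A, chartDensity x₀ z * (fderiv ℝ Z z v / chartDensity x₀ z) =
        (C * ‖v‖)⁻¹ * ∫ z in chartSet x₀ A, fderiv ℝ Y z v := by
      rw [← integral_const_mul]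
      refine setIntegral_congr_fun (measurableSet_chartSet x₀ hA) fun z hz => ?_
      have h5 : fderiv ℝ Z z = (C * ‖v‖)⁻¹ • fderiv ℝ Y z :=
        fderiv_const_mul (hY.differentiable (by simp) z) _
      simp only [h5, smul_apply, smul_eq_mul]
      field_simp [(chartDensity_pos x₀ hz.1).ne']
    rw [h4, inv_mul_le_iff₀ hv0] at h2
    exact h2
  · refine closure_minimal (fun x hx => ?_)
      (isCompact_symm_image x₀ hL (hLK.trans hKt)).isClosed |>.trans hKU
    by_contra h
    exact hx (chartField_eq_zero hZL h)
  · intro x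
    by_cases hx : x ∈ (extChartAt 𝕀 x₀).symm '' K
    · obtain ⟨z, hz, rfl⟩ := hx
      rw [chartField, chartLift_symm (hKt hz), norm_smul, norm_div, Real.norm_eq_abs,
        Real.norm_of_nonneg (chartDensity_pos x₀ (hKt hz)).le, div_mul_eq_mul_div, mul_div_assoc,
        abs_mul, abs_of_pos (inv_pos.2 hv0)]
      have h1 := hCK z hz v
      calc (C * ‖v‖)⁻¹ * |Y z| * (‖frameMap x₀ ((extChartAt 𝕀 x₀).symm z) v‖ / chartDensity x₀ z)
          ≤ (C * ‖v‖)⁻¹ * 1 * (C * ‖v‖) := by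
            gcongr
            exacts [div_nonneg (norm_nonneg _) (chartDensity_pos x₀ (hKt hz)).le, hY1 z]
        _ = 1 := by field_simp
    · rw [chartField_eq_zero hZK hx, norm_zero]
      exact zero_le_one

end ChartFields

/-! ### Translations and sets of finite perimeter in Euclidean space -/

section Shift

variable {m : ℕ}

local notation "𝔽" => EuclideanSpace ℝ (Fin m)

/-- The derivative of the integral of a test function over a translated set. -/
lemma hasDerivAt_setIntegral_comp_add_smul (S : Set 𝔽) {Y : 𝔽 → ℝ}
    (hY : ContDiff ℝ ∞ Y) (hYc : HasCompactSupport Y) (v : 𝔽) (s₀ : ℝ) :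
    HasDerivAt (fun s : ℝ => ∫ y in S, Y (y + s • v)) (∫ y in S, fderiv ℝ Y (y + s₀ • v) v) s₀ := by
  have hY' : Continuous (fun z => fderiv ℝ Y z v) :=
    (hY.continuous_fderiv (by simp)).clm_apply continuous_const
  obtain ⟨C, hC⟩ := hY'.bounded_above_of_compact_support (hYc.fderiv_apply ℝ v)
  obtain ⟨R, hR⟩ := hYc.isCompact.isBounded.subset_closedBall 0
  set R' := R + (|s₀| + 1) * ‖v‖ with hR'
  -- The derivatives for parameters near `s₀` have a common compact support.
  have hzero : ∀ s ∈ Metric.ball s₀ 1, ∀ y, y ∉ Metric.closedBall (0 : 𝔽) R' →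
      fderiv ℝ Y (y + s • v) v = 0 := by
    intro s hs y hy
    by_contra hne
    have h1 : y + s • v ∈ tsupport Y := by
      refine support_fderiv_subset ℝ (f := Y) fun h0 => hne ?_
      rw [h0, zero_apply]
    have h2 := hR h1
    rw [mem_closedBall_zero_iff] at h2 hy
    refine hy ?_
    have h3 : |s| ≤ |s₀| + 1 := by
      rw [Metric.mem_ball, Real.dist_eq] at hs
      have := abs_sub_abs_le_abs_sub s s₀
      linarith
    calc ‖y‖ = ‖(y + s • v) - s • v‖ := by rw [add_sub_cancel_right]
      _ ≤ ‖y + s • v‖ + ‖s • v‖ := norm_sub_le _ _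
      _ ≤ R + (|s₀| + 1) * ‖v‖ := by
        rw [norm_smul, Real.norm_eq_abs]
        gcongr
  refine (hasDerivAt_integral_of_dominated_loc_of_deriv_le (μ := volume.restrict S)
    (F := fun s y => Y (y + s • v)) (F' := fun s y => fderiv ℝ Y (y + s • v) v)
    (bound := (Metric.closedBall (0 : 𝔽) R').indicator fun _ => C) (Metric.ball_mem_nhds s₀ one_pos)
    ?_ ?_ ?_ ?_ ?_ ?_).2
  · exact Eventually.of_forall fun s =>
      (hY.continuous.comp (continuous_id.add continuous_const)).aestronglyMeasurable
  · exact ((hY.continuous.integrable_of_hasCompactSupport hYc).comp_add_right (s₀ • v)).integrableOn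
  · exact (hY'.comp (continuous_id.add continuous_const)).aestronglyMeasurable
  · refine Eventually.of_forall fun y s hs => ?_
    by_cases hy : y ∈ Metric.closedBall (0 : 𝔽) R'
    · rw [indicator_of_mem hy]; exact hC _
    · rw [indicator_of_notMem hy, hzero s hs y hy, norm_zero]
  · refine Integrable.integrableOn ?_
    rw [integrable_indicator_iff Metric.isClosed_closedBall.measurableSet]
    exact integrableOn_const (isCompact_closedBall _ _).measure_lt_top.ne
  · refine Eventually.of_forall fun y s _ => ?_
    have h1 := (hY.differentiable (by simp) (y + s • v)).hasFDerivAt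
    have h2 : HasDerivAt (fun s : ℝ => y + s • v) v s := by
      simpa using ((hasDerivAt_id s).smul_const v).const_add y
    exact h1.comp_hasDerivAt s h2

/-- If the distributional derivative of `1_S` in the direction `v` has mass at most `c`, then the
translation by `v` moves a set of volume at most `c` out of `S`. -/
lemma volume_shift_le {S K W : Set 𝔽} (hS : MeasurableSet S) (hK : IsCompact K) (hW : IsOpen W)
    {v : 𝔽} {c : ℝ} (hc : 0 ≤ c)
    (h : ∀ Y : 𝔽 → ℝ, ContDiff ℝ ∞ Y → Function.support Y ⊆ K → (∀ z, |Y z| ≤ 1) →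
      ∫ z in S, fderiv ℝ Y z v ≤ c)
    (hWK : ∀ y ∈ W, ∀ s ∈ Icc (0 : ℝ) 1, y + s • v ∈ K) :
    volume {y | y ∈ W ∧ y ∈ S ∧ y + v ∉ S} ≤ ENNReal.ofReal c := by
  set E := {y | y ∈ W ∧ y ∈ S ∧ y + v ∉ S} with hE
  have hSv : MeasurableSet {y | y + v ∈ S} := (measurable_id.add_const v) hS
  have hEm : MeasurableSet E := hW.measurableSet.inter (hS.inter hSv.compl)
  -- test functions supported in `W`
  have key : ∀ ψ : 𝔽 → ℝ, ContDiff ℝ ∞ ψ → Function.support ψ ⊆ W → (∀ z, ψ z ∈ Icc (0 : ℝ) 1) →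
      ∫ y, (S.indicator 1 y - {y | y + v ∈ S}.indicator 1 y) * ψ y ≤ c := by
    intro ψ hψ hψW hψ1
    have hWK0 : W ⊆ K := fun y hy => by simpa using hWK y hy 0 (by simp)
    have hψc : HasCompactSupport ψ :=
      HasCompactSupport.of_support_subset_isCompact hK (hψW.trans hWK0)
    have hd := hasDerivAt_setIntegral_comp_add_smul S hψ hψc (-v)
    -- By the mean value theorem, the difference of the integrals over `S` and its translate is the
    -- distributional derivative on a translated test function.
    obtain ⟨s, hs, hs'⟩ := exists_hasDerivAt_eq_slope (fun s : ℝ => ∫ y in S, ψ (y + s • (-v)))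
      (fun s => ∫ y in S, fderiv ℝ ψ (y + s • (-v)) (-v)) zero_lt_one
      (fun s _ => (hd s).continuousAt.continuousWithinAt) (fun s _ => hd s)
    have hY := h (fun y => ψ (y + s • (-v))) (hψ.comp (contDiff_id.add contDiff_const)) ?_ ?_
    · have e1 : ∀ z, fderiv ℝ (fun y => ψ (y + s • (-v))) z = fderiv ℝ ψ (z + s • (-v)) := fun z =>
        fderiv_comp_add_right _
      simp_rw [e1] at hY
      have e2 : ∫ y in S, fderiv ℝ ψ (y + s • (-v)) (-v) =
          - ∫ y in S, fderiv ℝ ψ (y + s • (-v)) v := by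
        rw [← integral_neg]
        simp only [map_neg]
      rw [e2] at hs'
      simp only [one_smul, zero_smul, add_zero, sub_zero, div_one] at hs'
      have iψ : Integrable ψ := hψ.continuous.integrable_of_hasCompactSupport hψc
      have e3 : ∫ y in S, ψ (y + -v) = ∫ y, {y | y + v ∈ S}.indicator ψ y := by
        rw [← integral_indicator hS, ← integral_add_right_eq_self _ v]
        congr 1
        ext y
        by_cases hy : y + v ∈ S
        · rw [indicator_of_mem hy, indicator_of_mem (by exact hy), add_neg_cancel_right]
        · rw [indicator_of_notMem hy, indicator_of_notMem (by exact hy)]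
      have e4 : ∫ y, (S.indicator 1 y - {y | y + v ∈ S}.indicator 1 y) * ψ y =
          ∫ y, (S.indicator ψ y - {y | y + v ∈ S}.indicator ψ y) := by
        congr 1
        ext y
        rw [sub_mul, ← indicator_mul_left, ← indicator_mul_left]
        simp only [Pi.one_apply, one_mul]
      rw [e4, integral_sub (iψ.indicator hS) (iψ.indicator hSv), ← e3, integral_indicator hS]
      linarith
    · intro y hy
      have h1 := hWK _ (hψW hy) s ⟨hs.1.le, hs.2.le⟩
      simpa using h1
    · intro z
      have := hψ1 (z + s • (-v))
      rw [abs_of_nonneg this.1]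
      exact this.2
  by_contra hlt
  push Not at hlt
  -- Otherwise approximate the set that is moved out by a compact set from inside and by an open set
  -- from outside, and use a cutoff function between the two.
  obtain ⟨Kc, hKE, hKc, hlt'⟩ := hEm.exists_lt_isCompact hlt
  have hKfin : volume Kc < ⊤ := hKc.measure_lt_top
  have hcK : c < (volume Kc).toReal := by
    rwa [← ENNReal.ofReal_lt_iff_lt_toReal hc hKfin.ne]
  obtain ⟨V, hKV, hV, hVlt⟩ := Kc.exists_isOpen_lt_add (μ := volume) hKfin.ne
    (ε := ENNReal.ofReal ((volume Kc).toReal - c)) (by simpa using hcK)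
  obtain ⟨ψ, hψ, hψr, hψs, hψ1⟩ := exists_contMDiff_support_eq_eq_one_iff 𝓘(ℝ, 𝔽) (n := ⊤)
    (hV.inter hW) hKc.isClosed (subset_inter hKV (hKE.trans fun y hy => hy.1))
  have hψI : ∀ z, ψ z ∈ Icc (0 : ℝ) 1 := fun z => hψr (mem_range_self z)
  have h1 := key ψ hψ.contDiff (by rw [hψs]; exact inter_subset_right) hψI
  have hVfin : volume V ≠ ⊤ := (hVlt.trans (ENNReal.add_lt_top.2 ⟨hKfin, by simp⟩)).ne
  have hψint : Integrable ψ := by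
    have hWK0 : W ⊆ K := fun y hy => by simpa using hWK y hy 0 (by simp)
    refine hψ.contDiff.continuous.integrable_of_hasCompactSupport
      (HasCompactSupport.of_support_subset_isCompact hK ?_)
    rw [hψs]
    exact inter_subset_right.trans hWK0
  have h2 : ∫ y, (Kc.indicator (fun _ => (1 : ℝ)) y - (V \ Kc).indicator (fun _ => (1 : ℝ)) y) ≤
      ∫ y, (S.indicator 1 y - {y | y + v ∈ S}.indicator 1 y) * ψ y := by
    refine integral_mono ?_ ?_ fun y => ?_
    · refine Integrable.sub ?_ ?_
      · exact (integrable_indicator_iff hKc.measurableSet).2 (integrableOn_const hKfin.ne)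
      · exact (integrable_indicator_iff (hV.measurableSet.diff hKc.measurableSet)).2
          (integrableOn_const ((measure_mono sdiff_subset).trans_lt hVfin.lt_top).ne)
    · refine (hψint.bdd_mul (c := 1) ?_ ?_)
      · exact ((measurable_one.indicator hS).sub
          (measurable_one.indicator hSv)).aestronglyMeasurable
      · refine Eventually.of_forall fun y => ?_
        by_cases h1 : y ∈ S <;> by_cases h2 : y + v ∈ S <;> simp [h1, h2]
    · by_cases hyK : y ∈ Kc
      · have hyE := hKE hyK
        have h3 : y ∈ S := hyE.2.1
        have h4 : y ∉ {y | y + v ∈ S} := hyE.2.2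
        have h5 : ψ y = 1 := (hψ1 y).1 hyK
        simp [hyK, h3, h5, indicator_of_notMem h4]
      · by_cases hyV : y ∈ V
        · have h5 := hψI y
          rw [indicator_of_notMem hyK, indicator_of_mem (show y ∈ V \ Kc from ⟨hyV, hyK⟩), zero_sub]
          by_cases h1 : y ∈ S <;> by_cases h2 : y + v ∈ S <;> simp [h1, h2] <;>
            linarith [h5.1, h5.2]
        · have h6 : ψ y = 0 := by
            by_contra h7
            have : y ∈ Function.support ψ := h7
            rw [hψs] at this
            exact hyV this.1
          simp [hyK, hyV, h6]
  have h3 : ∫ y, (Kc.indicator (fun _ => (1 : ℝ)) y - (V \ Kc).indicator (fun _ => (1 : ℝ)) y) =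
      (volume Kc).toReal - (volume (V \ Kc)).toReal := by
    rw [integral_sub, integral_indicator_const _ hKc.measurableSet,
      integral_indicator_const _ (hV.measurableSet.diff hKc.measurableSet)]
    · simp [Measure.real]
    · exact (integrable_indicator_iff hKc.measurableSet).2 (integrableOn_const hKfin.ne)
    · exact (integrable_indicator_iff (hV.measurableSet.diff hKc.measurableSet)).2
          (integrableOn_const ((measure_mono sdiff_subset).trans_lt hVfin.lt_top).ne)
  have h4 : (volume (V \ Kc)).toReal < (volume Kc).toReal - c := by
    rw [measure_sdiff hKV hKc.measurableSet.nullMeasurableSet hKfin.ne]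
    rw [← ENNReal.lt_ofReal_iff_toReal_lt (ENNReal.sub_ne_top hVfin)]
    exact ENNReal.sub_lt_of_lt_add (measure_mono hKV) (by rwa [add_comm])
  linarith

/-- The volume of `P × Q`, computed by sorting its points `(y, y')` by `y' - y`. -/
lemma lintegral_volume_inter_shift {P Q : Set 𝔽} (hP : MeasurableSet P) (hQ : MeasurableSet Q) :
    ∫⁻ v, volume (P ∩ {y | y + v ∈ Q}) = volume P * volume Q := by
  have h1 : ∀ v : 𝔽, volume (P ∩ {y | y + v ∈ Q}) =
      ∫⁻ y, P.indicator 1 y * Q.indicator (1 : 𝔽 → ℝ≥0∞) (y + v) := fun v => by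
    have hm : MeasurableSet (P ∩ {y | y + v ∈ Q}) := hP.inter ((measurable_id.add_const v) hQ)
    rw [← lintegral_indicator_one hm]
    congr 1
    ext y
    by_cases h1 : y ∈ P <;> by_cases h2 : y + v ∈ Q <;> simp [h1, h2]
  simp_rw [h1]
  rw [lintegral_lintegral_swap]
  · have h2 : ∀ y : 𝔽, ∫⁻ v, P.indicator 1 y * Q.indicator (1 : 𝔽 → ℝ≥0∞) (y + v) =
        P.indicator 1 y * volume Q := fun y => by
      have hm : Measurable fun v => Q.indicator (1 : 𝔽 → ℝ≥0∞) (y + v) :=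
        (measurable_one.indicator hQ).comp (measurable_const_add y)
      rw [lintegral_const_mul _ hm, lintegral_add_left_eq_self (Q.indicator (1 : 𝔽 → ℝ≥0∞)) y,
        lintegral_indicator_one hQ]
    simp_rw [h2]
    rw [lintegral_mul_const _ (measurable_one.indicator hP), lintegral_indicator_one hP]
  · exact (((measurable_one.indicator hP).comp measurable_snd).mul
      ((measurable_one.indicator hQ).comp (measurable_snd.add measurable_fst))).aemeasurable

end Shift

/-! ### Sets of small perimeter -/

section Isoperimetry

variable {n : ℕ} {M : Type*} [MetricSpace M]
    [ChartedSpace (EuclideanSpace ℝ (Fin (n + 1))) M] [IsManifold (𝓡 (n + 1)) ∞ M]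
    [RiemannianBundle (fun x : M => TangentSpace (𝓡 (n + 1)) x)]
    [IsContMDiffRiemannianBundle (𝓡 (n + 1)) ∞ (EuclideanSpace ℝ (Fin (n + 1)))
      (fun x : M => TangentSpace (𝓡 (n + 1)) x)]
    [IsRiemannianManifold (𝓡 (n + 1)) M] [MeasurableSpace M] [BorelSpace M]
    [SecondCountableTopology M] [CompactSpace M]

local notation "𝔼" => EuclideanSpace ℝ (Fin (n + 1))
local notation "𝕀" => 𝓡 (n + 1)

/-- In a chart, translations move the points of a set out of it at a rate controlled by the
perimeter. -/
lemma exists_volume_shift_le_perimeter (x₀ : M) {K : Set 𝔼} (hK : IsCompact K)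
    (hKt : K ⊆ (extChartAt 𝕀 x₀).target) : ∃ C : ℝ, 0 < C ∧ ∀ (A U : Set M) (L : Set 𝔼)
      (P : ℝ≥0) (W : Set 𝔼) (v : 𝔼), MeasurableSet A → IsCompact L → L ⊆ K →
      (extChartAt 𝕀 x₀).symm '' L ⊆ U → perimeter n A U ≤ P → IsOpen W →
      (∀ y ∈ W, ∀ s ∈ Icc (0 : ℝ) 1, y + s • v ∈ L) →
      volume {y | y ∈ W ∧ y ∈ chartSet x₀ A ∧ y + v ∉ chartSet x₀ A} ≤
        ENNReal.ofReal (C * ‖v‖ * P) := by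
  obtain ⟨C, hC, h⟩ := exists_integral_fderiv_le_perimeter (n := n) x₀ hK hKt
  refine ⟨C, hC, fun A U L P W v hA hL hLK hLU hP hW hWL => ?_⟩
  exact volume_shift_le (measurableSet_chartSet x₀ hA) hL hW (by positivity)
    (fun Y hY hYL hY1 => h A U L P Y v hA hL hLK hLU hP hY hYL hY1) hWL

/-- A weak relative isoperimetric inequality for balls in a chart. -/
lemma exists_volume_mul_volume_le_perimeter (x₀ : M) {K : Set 𝔼} (hK : IsCompact K)
    (hKt : K ⊆ (extChartAt 𝕀 x₀).target) : ∃ C : ℝ, 0 < C ∧ ∀ (A U : Set M) (P : ℝ≥0)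
      (z : 𝔼) (r : ℝ), MeasurableSet A →
      (extChartAt 𝕀 x₀).symm '' Metric.closedBall z r ⊆ U →
      perimeter n A U ≤ P → Metric.closedBall z r ⊆ K →
      volume (Metric.ball z r ∩ chartSet x₀ A) * volume (Metric.ball z r \ chartSet x₀ A) ≤
        ENNReal.ofReal (C * (2 * r) * P) * volume (Metric.ball (0 : 𝔼) (2 * r)) := by
  obtain ⟨C, hC, h⟩ := exists_volume_shift_le_perimeter (n := n) x₀ hK hKt
  refine ⟨C, hC, fun A U P z r hA hKU hP hzK => ?_⟩
  have hS := measurableSet_chartSet (n := n) x₀ hA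
  have hB : MeasurableSet (Metric.ball z r) := Metric.isOpen_ball.measurableSet
  -- Pairs of a point of `A` and a point outside of `A`, sorted by their difference `v`.
  rw [← lintegral_volume_inter_shift (hB.inter hS) (hB.diff hS), ← setLIntegral_const,
    ← lintegral_indicator Metric.isOpen_ball.measurableSet]
  refine lintegral_mono fun v => ?_
  by_cases hv : v ∈ Metric.ball (0 : 𝔼) (2 * r)
  · rw [indicator_of_mem hv]
    rw [mem_ball_zero_iff] at hv
    have hW : IsOpen (Metric.ball z r ∩ {y | y + v ∈ Metric.ball z r}) :=
      Metric.isOpen_ball.inter (Metric.isOpen_ball.preimage (continuous_id.add continuous_const))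
    refine le_trans (measure_mono ?_) ((h A U _ P _ v hA (isCompact_closedBall z r) hzK hKU hP hW
      ?_).trans ?_)
    · rintro y ⟨⟨h1, h2⟩, h3, h4⟩
      exact ⟨⟨h1, h3⟩, h2, h4⟩
    · rintro y ⟨h1, h2⟩ s hs
      exact Metric.ball_subset_closedBall ((convex_ball z r).add_smul_mem h1 h2 hs)
    · refine ENNReal.ofReal_le_ofReal ?_
      gcongr
  · rw [indicator_of_notMem hv, nonpos_iff_eq_zero]
    refine measure_mono_null (t := ∅) ?_ measure_empty
    rintro y ⟨⟨h1, -⟩, h3, -⟩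
    refine hv ?_
    rw [mem_ball_zero_iff]
    rw [Metric.mem_ball] at h1 h3
    calc ‖v‖ = dist (y + v) y := by rw [dist_eq_norm, add_sub_cancel_left]
      _ ≤ dist (y + v) z + dist y z := dist_triangle_right _ _ _
      _ < 2 * r := by linarith

/-- Each point has a neighbourhood in which a weak relative isoperimetric inequality holds. -/
lemma exists_riemVol_mul_riemVol_le_perimeter (x : M) : ∃ W : Set M, IsOpen W ∧ x ∈ W ∧
    ∃ C : ℝ≥0∞, C ≠ 0 ∧ C ≠ ⊤ ∧ ∀ A : Set M, MeasurableSet A → perimeter n A univ ≠ ⊤ →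
      riemVol n (A ∩ W) * riemVol n (W \ A) ≤ C * perimeter n A univ := by
  obtain ⟨r, hr, hrt⟩ :=
    Metric.nhds_basis_closedBall.mem_iff.1 (extChartAt_target_mem_nhds (I := 𝕀) x)
  set z := extChartAt 𝕀 x x with hz
  have hK : IsCompact (Metric.closedBall z r) := isCompact_closedBall _ _
  obtain ⟨C, hC, h⟩ := exists_volume_mul_volume_le_perimeter (n := n) x hK hrt
  obtain ⟨R, hR⟩ := hK.exists_bound_of_continuousOn
    ((contDiffOn_chartDensity (n := n) x).continuousOn.mono hrt)
  set W : Set M := (extChartAt 𝕀 x).source ∩ extChartAt 𝕀 x ⁻¹' Metric.ball z r with hWdef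
  have hW : IsOpen W :=
    (continuousOn_extChartAt x).isOpen_inter_preimage (isOpen_extChartAt_source x)
      Metric.isOpen_ball
  -- volumes in `W` are bounded by volumes in the chart
  have hvol : ∀ A : Set M, MeasurableSet A → A ⊆ W →
      riemVol n A ≤ ENNReal.ofReal R * volume (extChartAt 𝕀 x '' A) := by
    intro A hA hAW
    have hAs : A ⊆ (extChartAt 𝕀 x).source := fun y hy => (hAW hy).1
    rw [riemVol_eq_setLIntegral hA hAs, ← setLIntegral_const]
    refine setLIntegral_mono' (measurableSet_image_extChartAt hA hAs) ?_
    rintro _ ⟨y, hy, rfl⟩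
    refine ENNReal.ofReal_le_ofReal ?_
    exact (le_abs_self _).trans (hR _ (Metric.ball_subset_closedBall (hAW hy).2))
  set V : ℝ≥0∞ := volume (Metric.ball (0 : 𝔼) (2 * r)) with hV
  refine ⟨W, hW, ⟨mem_extChartAt_source x, Metric.mem_ball_self hr⟩,
    ENNReal.ofReal R * ENNReal.ofReal R * (ENNReal.ofReal (C * (2 * r)) * V) + 1,
    by simp, ?_, fun A hA hP => ?_⟩
  · have : V ≠ ⊤ := Metric.isBounded_ball.measure_lt_top.ne
    finiteness
  lift perimeter n A univ to ℝ≥0 using hP with P hP'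
  have h1 := h A univ P z r hA (subset_univ _) hP'.ge le_rfl
  have h2 : extChartAt 𝕀 x '' (A ∩ W) ⊆ Metric.ball z r ∩ chartSet x A := by
    rintro _ ⟨y, ⟨hyA, hyW⟩, rfl⟩
    refine ⟨hyW.2, (extChartAt 𝕀 x).map_source hyW.1, ?_⟩
    rwa [mem_preimage, (extChartAt 𝕀 x).left_inv hyW.1]
  have h3 : extChartAt 𝕀 x '' (W \ A) ⊆ Metric.ball z r \ chartSet x A := by
    rintro _ ⟨y, ⟨hyW, hyA⟩, rfl⟩
    refine ⟨hyW.2, fun h4 => hyA ?_⟩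
    have h5 := h4.2
    rwa [mem_preimage, (extChartAt 𝕀 x).left_inv hyW.1] at h5
  calc riemVol n (A ∩ W) * riemVol n (W \ A)
      ≤ (ENNReal.ofReal R * volume (extChartAt 𝕀 x '' (A ∩ W))) *
        (ENNReal.ofReal R * volume (extChartAt 𝕀 x '' (W \ A))) := by
        gcongr
        · exact hvol _ (hA.inter hW.measurableSet) inter_subset_right
        · exact hvol _ (hW.measurableSet.diff hA) sdiff_subset
    _ ≤ (ENNReal.ofReal R * volume (Metric.ball z r ∩ chartSet x A)) *
        (ENNReal.ofReal R * volume (Metric.ball z r \ chartSet x A)) := by gcongr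
    _ = ENNReal.ofReal R * ENNReal.ofReal R * (volume (Metric.ball z r ∩ chartSet x A) *
        volume (Metric.ball z r \ chartSet x A)) := by ring
    _ ≤ ENNReal.ofReal R * ENNReal.ofReal R * (ENNReal.ofReal (C * (2 * r) * P) * V) := by
        gcongr
    _ = ENNReal.ofReal R * ENNReal.ofReal R * (ENNReal.ofReal (C * (2 * r)) * V) * P := by
        rw [ENNReal.ofReal_mul (by positivity), ENNReal.ofReal_coe_nnreal]
        ring
    _ ≤ _ := by
        gcongr
        exact le_self_add

/-- Sets of small perimeter are almost null or almost conull in `W`. -/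
def IsIsoperimetric (n : ℕ) {M : Type*} [MetricSpace M]
    [ChartedSpace (EuclideanSpace ℝ (Fin (n + 1))) M] [IsManifold (𝓡 (n + 1)) ∞ M]
    [RiemannianBundle (fun x : M => TangentSpace (𝓡 (n + 1)) x)]
    [MeasurableSpace M] [BorelSpace M] (W : Set M) : Prop :=
  ∀ δ : ℝ≥0∞, 0 < δ → ∃ ε : ℝ≥0∞, 0 < ε ∧ ∀ A : Set M, MeasurableSet A →
    perimeter n A univ < ε → riemVol n (A ∩ W) < δ ∨ riemVol n (W \ A) < δ

lemma exists_isIsoperimetric_nhds (x : M) :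
    ∃ W : Set M, IsOpen W ∧ x ∈ W ∧ IsIsoperimetric n W := by
  obtain ⟨W, hW, hx, C, hC0, hC, h⟩ := exists_riemVol_mul_riemVol_le_perimeter (n := n) x
  refine ⟨W, hW, hx, fun δ hδ => ?_⟩
  have hδ1 : min δ 1 ≠ ⊤ := (min_le_right δ 1).trans_lt ENNReal.one_lt_top |>.ne
  have hδ0 : min δ 1 ≠ 0 := (lt_min hδ one_pos).ne'
  refine ⟨min δ 1 * min δ 1 / C, ENNReal.div_pos (mul_ne_zero hδ0 hδ0) hC, fun A hA hAε => ?_⟩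
  by_contra! hcon
  have h1 := h A hA hAε.ne_top
  have h2 : C * perimeter n A univ < min δ 1 * min δ 1 := by
    rw [mul_comm]
    exact (ENNReal.lt_div_iff_mul_lt (Or.inl hC0) (Or.inl hC)).1 hAε
  refine absurd (h1.trans_lt h2) (not_lt.2 ?_)
  exact mul_le_mul' ((min_le_left _ _).trans hcon.1) ((min_le_left _ _).trans hcon.2)

/-- The isoperimetric property passes to the union of two overlapping open sets: on the overlap,
which has positive volume, the two alternatives must agree. -/
lemma IsIsoperimetric.union {V W : Set M} (hV : IsOpen V) (hW : IsOpen W) (hVW : (V ∩ W).Nonempty)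
    (h₁ : IsIsoperimetric n V) (h₂ : IsIsoperimetric n W) : IsIsoperimetric n (V ∪ W) := by
  intro δ hδ
  have hpos : 0 < riemVol n (V ∩ W) := (hV.inter hW).measure_pos _ hVW
  set δ' := min (δ / 2) (riemVol n (V ∩ W) / 2) with hδ'
  have hδ'0 : 0 < δ' := lt_min (ENNReal.half_pos hδ.ne') (ENNReal.half_pos hpos.ne')
  have hadd : ∀ {a b c : ℝ≥0∞}, a < c / 2 → b < c / 2 → a + b < c := fun h1 h2 =>
    (ENNReal.add_lt_add h1 h2).trans_eq (ENNReal.add_halves _)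
  obtain ⟨ε₁, hε₁, h₁⟩ := h₁ δ' hδ'0
  obtain ⟨ε₂, hε₂, h₂⟩ := h₂ δ' hδ'0
  refine ⟨min ε₁ ε₂, lt_min hε₁ hε₂, fun A hA hAε => ?_⟩
  have hsplit : riemVol n (V ∩ W) ≤ riemVol n (A ∩ (V ∩ W)) + riemVol n ((V ∩ W) \ A) := by
    refine (measure_mono fun x hx => ?_).trans (measure_union_le _ _)
    by_cases hxA : x ∈ A
    · exact Or.inl ⟨hxA, hx⟩
    · exact Or.inr ⟨hx, hxA⟩
  rcases h₁ A hA (hAε.trans_le (min_le_left _ _)) with h3 | h3 <;>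
    rcases h₂ A hA (hAε.trans_le (min_le_right _ _)) with h4 | h4
  · left
    rw [inter_union_distrib_left]
    exact (measure_union_le _ _).trans_lt
      (hadd (h3.trans_le (min_le_left _ _)) (h4.trans_le (min_le_left _ _)))
  · refine absurd (hsplit.trans_lt (hadd
      ((measure_mono ?_).trans_lt (h3.trans_le (min_le_right _ _)))
      ((measure_mono ?_).trans_lt (h4.trans_le (min_le_right _ _))))) (lt_irrefl _)
    · exact inter_subset_inter_right _ inter_subset_left
    · exact sdiff_subset_sdiff_left inter_subset_right
  · refine absurd (hsplit.trans_lt (hadd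
      ((measure_mono ?_).trans_lt (h4.trans_le (min_le_right _ _)))
      ((measure_mono ?_).trans_lt (h3.trans_le (min_le_right _ _))))) (lt_irrefl _)
    · exact inter_subset_inter_right _ inter_subset_right
    · exact sdiff_subset_sdiff_left inter_subset_left
  · right
    rw [union_sdiff_distrib]
    exact (measure_union_le _ _).trans_lt
      (hadd (h3.trans_le (min_le_left _ _)) (h4.trans_le (min_le_left _ _)))

/-- On a connected closed manifold, sets of small perimeter are almost null or almost conull. -/
theorem isIsoperimetric_univ [ConnectedSpace M] : IsIsoperimetric n (univ : Set M) := by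
  obtain ⟨x₀⟩ := (inferInstance : Nonempty M)
  -- The points that share an isoperimetric open set with `x₀` form an open and closed set.
  set G : Set M := {y | ∃ W : Set M, IsOpen W ∧ x₀ ∈ W ∧ y ∈ W ∧ IsIsoperimetric n W} with hG
  have hstep : ∀ y V, IsOpen V → IsIsoperimetric n V → y ∈ V → (G ∩ V).Nonempty → y ∈ G := by
    rintro y V hV hVI hy ⟨z, ⟨W, hW, hx, hz, hWI⟩, hzV⟩
    exact ⟨W ∪ V, hW.union hV, Or.inl hx, Or.inr hy, hWI.union hW hV ⟨z, hz, hzV⟩ hVI⟩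
  have hGo : IsOpen G := by
    rw [isOpen_iff_mem_nhds]
    rintro y ⟨W, hW, hx, hy, hWI⟩
    filter_upwards [hW.mem_nhds hy] with z hz
    exact ⟨W, hW, hx, hz, hWI⟩
  have hGc : IsClosed G := by
    rw [← closure_subset_iff_isClosed]
    intro y hy
    obtain ⟨V, hV, hyV, hVI⟩ := exists_isIsoperimetric_nhds (n := n) y
    obtain ⟨z, hz⟩ := mem_closure_iff.1 hy V hV hyV
    exact hstep y V hV hVI hyV ⟨z, hz.2, hz.1⟩
  have hGu : G = univ := by
    refine IsClopen.eq_univ ⟨hGc, hGo⟩ ⟨x₀, ?_⟩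
    obtain ⟨V, hV, hyV, hVI⟩ := exists_isIsoperimetric_nhds (n := n) x₀
    exact ⟨V, hV, hyV, hyV, hVI⟩
  choose W hW hx hy hWI using fun y : M => (hGu ▸ mem_univ y : y ∈ G)
  obtain ⟨t, ht⟩ := isCompact_univ.elim_finite_subcover W hW fun y _ => mem_iUnion.2 ⟨y, hy y⟩
  have hfin : ∀ t : Finset M, t.Nonempty → IsIsoperimetric n (⋃ y ∈ t, W y) := by
    classical
    intro t ht
    induction ht using Finset.Nonempty.cons_induction with
    | singleton a => simpa using hWI a
    | cons a s ha hs ih =>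
      rw [Finset.cons_eq_insert, Finset.set_biUnion_insert]
      obtain ⟨b, hb⟩ := hs
      exact (hWI a).union (hW a) (isOpen_biUnion fun y _ => hW y)
        ⟨x₀, hx a, mem_iUnion₂.2 ⟨b, hb, hx b⟩⟩ ih
  have hne : t.Nonempty := by
    rw [Finset.nonempty_iff_ne_empty]
    rintro rfl
    simpa using ht (mem_univ x₀)
  have := hfin t hne
  rwa [univ_subset_iff.1 ht] at this

/-- A set has zero perimeter only if it is null or conull. -/
lemma perimeter_eq_zero_iff [ConnectedSpace M] {A : Set M} (hA : MeasurableSet A) :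
    perimeter n A univ = 0 ↔ riemVol n A = 0 ∨ riemVol n Aᶜ = 0 := by
  constructor
  · intro h
    by_contra! hcon
    obtain ⟨ε, hε, h1⟩ := isIsoperimetric_univ (n := n) (M := M) (min (riemVol n A) (riemVol n Aᶜ))
      (lt_min (pos_iff_ne_zero.2 hcon.1) (pos_iff_ne_zero.2 hcon.2))
    have h2 := h1 A hA (h ▸ hε)
    rw [inter_univ, ← compl_eq_univ_sdiff] at h2
    rcases h2 with h2 | h2
    · exact absurd h2 (not_lt.2 (min_le_left _ _))
    · exact absurd h2 (not_lt.2 (min_le_right _ _))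
  · rintro (h | h)
    · rw [perimeter_congr_ae (ae_eq_empty.2 h), perimeter_empty]
    · rw [← perimeter_compl hA, perimeter_congr_ae (ae_eq_empty.2 h), perimeter_empty]

end Isoperimetry

/-! ### Symmetric differences of sets of finite perimeter -/

section SymmDiff

variable {n : ℕ} {M : Type*} [MetricSpace M]
    [ChartedSpace (EuclideanSpace ℝ (Fin (n + 1))) M] [IsManifold (𝓡 (n + 1)) ∞ M]
    [RiemannianBundle (fun x : M => TangentSpace (𝓡 (n + 1)) x)]
    [IsContMDiffRiemannianBundle (𝓡 (n + 1)) ∞ (EuclideanSpace ℝ (Fin (n + 1)))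
      (fun x : M => TangentSpace (𝓡 (n + 1)) x)]

local notation "𝔼" => EuclideanSpace ℝ (Fin (n + 1))
local notation "𝕀" => 𝓡 (n + 1)

/-- In the chart at `x₀`, small translations change `A` by a volume at most proportional to their
length, locally uniformly. -/
def HasShiftBound (x₀ : M) (A : Set M) : Prop :=
  ∀ K : Set (EuclideanSpace ℝ (Fin (n + 1))), IsCompact K → K ⊆ (extChartAt (𝓡 (n + 1)) x₀).target →
    ∃ D : ℝ, 0 ≤ D ∧ ∃ t > 0, ∀ v, ‖v‖ < t →
      volume (K ∩ (chartSet x₀ A ∆ {y | y + v ∈ chartSet x₀ A})) ≤ ENNReal.ofReal (D * ‖v‖)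

lemma HasShiftBound.symmDiff {x₀ : M} {A B : Set M} (hA : HasShiftBound (n := n) x₀ A)
    (hB : HasShiftBound (n := n) x₀ B) : HasShiftBound (n := n) x₀ (A ∆ B) := by
  intro K hK hKt
  obtain ⟨D₁, hD₁, t₁, ht₁, h₁⟩ := hA K hK hKt
  obtain ⟨D₂, hD₂, t₂, ht₂, h₂⟩ := hB K hK hKt
  refine ⟨D₁ + D₂, by positivity, min t₁ t₂, lt_min ht₁ ht₂, fun v hv => ?_⟩
  rw [add_mul, ENNReal.ofReal_add (by positivity) (by positivity)]
  refine (measure_mono ?_).trans ((measure_union_le _ _).trans (add_le_add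
    (h₁ v (hv.trans_le (min_le_left _ _))) (h₂ v (hv.trans_le (min_le_right _ _)))))
  rintro y ⟨hyK, hy⟩
  simp only [mem_union, mem_inter_iff, mem_symmDiff, mem_ofPred_eq, mem_preimage] at hy ⊢
  tauto

variable [IsRiemannianManifold (𝓡 (n + 1)) M] [MeasurableSpace M] [BorelSpace M]
    [SecondCountableTopology M] [CompactSpace M]

/-- Sets of finite perimeter satisfy a bound for translations. -/
lemma hasShiftBound_of_perimeter_ne_top {A : Set M} (hA : MeasurableSet A)
    (hP : perimeter n A univ ≠ ⊤) (x₀ : M) : HasShiftBound (n := n) x₀ A := by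
  intro K hK hKt
  obtain ⟨δ, hδ, hδt⟩ := hK.exists_cthickening_subset_open (isOpen_extChartAt_target x₀) hKt
  obtain ⟨C, hC, h⟩ := exists_volume_shift_le_perimeter (n := n) x₀ (hK.cthickening (r := δ)) hδt
  lift perimeter n A univ to ℝ≥0 using hP with P hP'
  refine ⟨C * P + C * P, by positivity, δ / 2, by positivity, fun v hv => ?_⟩
  have hWK : ∀ y ∈ Metric.thickening (δ / 2) K, ∀ s ∈ Icc (0 : ℝ) 1,
      y + s • v ∈ Metric.cthickening δ K := by
    intro y hy s hs
    refine Metric.thickening_subset_cthickening _ _ ?_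
    rw [Metric.mem_thickening_iff] at hy ⊢
    obtain ⟨z, hz, hyz⟩ := hy
    refine ⟨z, hz, ?_⟩
    have h1 : dist (y + s • v) y ≤ ‖v‖ := by
      rw [dist_eq_norm, add_sub_cancel_left, norm_smul, Real.norm_of_nonneg hs.1]
      exact mul_le_of_le_one_left (norm_nonneg _) hs.2
    linarith [dist_triangle (y + s • v) y z]
  -- A point enters the set exactly if it leaves the complement.
  have h1 := h A univ _ P _ v hA (hK.cthickening (r := δ)) le_rfl (subset_univ _) hP'.ge
    Metric.isOpen_thickening hWK
  have h2 := h Aᶜ univ _ P _ v hA.compl (hK.cthickening (r := δ)) le_rfl (subset_univ _)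
    (by rw [perimeter_compl hA, hP']) Metric.isOpen_thickening hWK
  rw [add_mul, ENNReal.ofReal_add (by positivity) (by positivity),
    mul_assoc, mul_comm (P : ℝ), ← mul_assoc]
  refine (measure_mono ?_).trans ((measure_union_le _ _).trans (add_le_add h1 h2))
  rintro y ⟨hyK, hy⟩
  have hyW : y ∈ Metric.thickening (δ / 2) K := Metric.self_subset_thickening (by positivity) K hyK
  rcases hy with ⟨h3, h4⟩ | ⟨h3, h4⟩
  · exact Or.inl ⟨hyW, h3, h4⟩
  · exact Or.inr ⟨hyW, ⟨hKt hyK, fun h5 => h4 ⟨hKt hyK, h5⟩⟩, fun h5 => h5.2 h3.2⟩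

/-- A bound for translations bounds the distributional derivative. -/
lemma HasShiftBound.exists_integral_fderiv_le {x₀ : M} {A : Set M} (hA : MeasurableSet A)
    (h : HasShiftBound (n := n) x₀ A) {K : Set 𝔼} (hK : IsCompact K)
    (hKt : K ⊆ (extChartAt 𝕀 x₀).target) : ∃ D : ℝ, 0 ≤ D ∧ ∀ (Y : 𝔼 → ℝ) (m : ℝ) (v : 𝔼),
      ContDiff ℝ ∞ Y → Function.support Y ⊆ K → (∀ z, |Y z| ≤ m) →
      ∫ z in chartSet x₀ A, fderiv ℝ Y z v ≤ m * (D * ‖v‖) := by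
  obtain ⟨D, hD, t, ht, h⟩ := h K hK hKt
  refine ⟨D, hD, fun Y m v hY hYK hYm => ?_⟩
  have hm : 0 ≤ m := (abs_nonneg _).trans (hYm 0)
  set S := chartSet (n := n) x₀ A with hSdef
  have hS : MeasurableSet S := measurableSet_chartSet (n := n) x₀ hA
  have hYc : HasCompactSupport Y := HasCompactSupport.of_support_subset_isCompact hK hYK
  have iY : Integrable Y := hY.continuous.integrable_of_hasCompactSupport hYc
  -- The integral is the derivative of the integrals of `Y` over the translates of `S`.
  have hd := (hasDerivAt_setIntegral_comp_add_smul S hY hYc v 0).tendsto_slope_zero_right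
  simp only [zero_smul, add_zero, zero_add, smul_eq_mul] at hd
  refine le_of_tendsto hd ?_
  have hsmall : ∀ᶠ s : ℝ in 𝓝[>] 0, s * ‖v‖ < t := by
    have : Tendsto (fun s : ℝ => s * ‖v‖) (𝓝 0) (𝓝 (0 * ‖v‖)) := tendsto_id.mul_const _
    rw [zero_mul] at this
    exact (this.mono_left nhdsWithin_le_nhds).eventually (gt_mem_nhds ht)
  filter_upwards [hsmall, self_mem_nhdsWithin] with s hst hs
  rw [mem_Ioi] at hs
  set w : 𝔼 := -(s • v) with hw
  have hnw : ‖w‖ = s * ‖v‖ := by rw [hw, norm_neg, norm_smul, Real.norm_of_nonneg hs.le]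
  have hSw : MeasurableSet {y | y + w ∈ S} := (measurable_id.add_const w) hS
  have e3 : ∫ y in S, Y (y + s • v) = ∫ y, {y | y + w ∈ S}.indicator Y y := by
    rw [← integral_indicator hS, ← integral_add_right_eq_self _ w]
    congr 1
    ext y
    by_cases hy : y + w ∈ S
    · rw [indicator_of_mem hy, indicator_of_mem (by exact hy), hw, neg_add_cancel_right]
    · rw [indicator_of_notMem hy, indicator_of_notMem (by exact hy)]
  have hvol := h w (by rwa [hnw])
  rw [hnw] at hvol
  set E := K ∩ (S ∆ {y | y + w ∈ S}) with hE
  have hEm : MeasurableSet E := hK.measurableSet.inter (hS.symmDiff hSw)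
  have hEfin : volume E ≠ ⊤ := (hvol.trans_lt ENNReal.ofReal_lt_top).ne
  have h1 : (∫ y in S, Y (y + s • v)) - ∫ y in S, Y y ≤ m * (volume E).toReal := by
    rw [e3, ← integral_indicator hS, ← integral_sub (iY.indicator hSw) (iY.indicator hS)]
    have h2 : ∫ y, E.indicator (fun _ => m) y = m * (volume E).toReal := by
      rw [integral_indicator_const _ hEm, smul_eq_mul, mul_comm]
      rfl
    rw [← h2]
    refine integral_mono ((iY.indicator hSw).sub (iY.indicator hS))
      ((integrable_indicator_iff hEm).2 (integrableOn_const hEfin)) fun y => ?_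
    by_cases hyK : y ∈ K
    · have h5 := abs_le.1 (hYm y)
      by_cases h3 : y ∈ S <;> by_cases h4 : y ∈ {y | y + w ∈ S}
      · have h6 : y ∉ E := by rintro ⟨-, h | h⟩ <;> simp_all
        simp only [indicator_of_mem h3, indicator_of_mem h4, indicator_of_notMem h6]
        linarith
      · have h6 : y ∈ E := ⟨hyK, Or.inl ⟨h3, h4⟩⟩
        simp only [indicator_of_mem h3, indicator_of_notMem h4, indicator_of_mem h6]
        linarith
      · have h6 : y ∈ E := ⟨hyK, Or.inr ⟨h4, h3⟩⟩
        simp only [indicator_of_notMem h3, indicator_of_mem h4, indicator_of_mem h6]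
        linarith
      · have h6 : y ∉ E := by rintro ⟨-, h | h⟩ <;> simp_all
        simp only [indicator_of_notMem h3, indicator_of_notMem h4, indicator_of_notMem h6]
        linarith
    · have h0 : Y y = 0 := by
        by_contra h7
        exact hyK (hYK h7)
      have h6 : y ∉ E := fun h => hyK h.1
      rw [indicator_of_notMem h6]
      by_cases h3 : y ∈ S <;> by_cases h4 : y ∈ {y | y + w ∈ S} <;>
        simp only [indicator_of_mem, indicator_of_notMem, h3, h4, h0, not_false_eq_true,
          sub_self, le_refl]
  have h2 : (volume E).toReal ≤ D * (s * ‖v‖) :=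
    ENNReal.toReal_le_of_le_ofReal (by positivity) hvol
  rw [inv_mul_le_iff₀ hs]
  calc _ ≤ m * (volume E).toReal := h1
    _ ≤ m * (D * (s * ‖v‖)) := by gcongr
    _ = s * (m * (D * ‖v‖)) := by ring

lemma setIntegral_divergence_chartField (x₀ : M) (v : 𝔼) {Y : 𝔼 → ℝ} {K : Set 𝔼}
    (hK : IsCompact K) (hKt : K ⊆ (extChartAt 𝕀 x₀).target) (hYK : Function.support Y ⊆ K)
    (hY : ContDiff ℝ ∞ Y) {A : Set M} (hA : MeasurableSet A) :
    ∫ x in A, chartLift x₀ (fun z => fderiv ℝ Y z v / chartDensity x₀ z) x ∂(riemVol n) =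
      ∫ z in chartSet x₀ A, fderiv ℝ Y z v := by
  have h3 := setIntegral_chartLift x₀ (w := fun z => fderiv ℝ Y z v / chartDensity x₀ z) hA
    (u := fun _ => 1) measurable_const (isDivergence_chartField x₀ v hK hKt hYK hY).1.measurable
  simp only [mul_one] at h3
  rw [h3]
  refine setIntegral_congr_fun (measurableSet_chartSet x₀ hA) fun z hz => ?_
  field_simp [(chartDensity_pos x₀ hz.1).ne']

lemma isSmoothField_sum {ι : Type*} (s : Finset ι) {X : ι → ∀ x : M, TangentSpace 𝕀 x}
    (hX : ∀ i ∈ s, IsSmoothField (X i)) : IsSmoothField fun x => ∑ i ∈ s, X i x :=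
  ContMDiff.sum_section hX

lemma isDivergence_sum {ι : Type*} (s : Finset ι) {X : ι → ∀ x : M, TangentSpace 𝕀 x}
    {h : ι → M → ℝ} (hX : ∀ i ∈ s, IsSmoothField (X i)) (hh : ∀ i ∈ s, IsDivergence n (X i) (h i)) :
    IsDivergence n (fun x => ∑ i ∈ s, X i x) (fun x => ∑ i ∈ s, h i x) := by
  classical
  induction s using Finset.induction_on with
  | empty =>
    refine ⟨by simpa using continuous_const, fun φ hφ => ?_⟩
    simp only [Finset.sum_empty, zero_mul, integral_zero]
    rw [eq_comm, neg_eq_zero]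
    refine Eq.trans (integral_congr_ae (Eventually.of_forall fun x => ?_)) (integral_zero M ℝ)
    exact (mfderiv 𝕀 𝓘(ℝ, ℝ) φ x).map_zero
  | insert i s hi ih =>
    simp only [Finset.sum_insert hi]
    have h1 := isSmoothField_sum s fun j hj => hX j (Finset.mem_insert_of_mem hj)
    exact (hh i (Finset.mem_insert_self _ _)).add (hX i (Finset.mem_insert_self _ _)) h1
      (ih (fun j hj => hX j (Finset.mem_insert_of_mem hj))
        fun j hj => hh j (Finset.mem_insert_of_mem hj))

/-- A field supported in a chart is a sum of chart fields. -/
lemma exists_sum_chartField (x₀ : M) {X : ∀ x : M, TangentSpace 𝕀 x} (hX : IsSmoothField X)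
    {χ : M → ℝ} (hχ : ContMDiff 𝕀 𝓘(ℝ, ℝ) ∞ χ) {K : Set 𝔼} (hK : IsCompact K)
    (hKt : K ⊆ (extChartAt 𝕀 x₀).target) (hχK : Function.support χ ⊆ (extChartAt 𝕀 x₀).symm '' K) :
    ∃ Y : Fin (n + 1) → 𝔼 → ℝ, (∀ i, ContDiff ℝ ∞ (Y i)) ∧ (∀ i, Function.support (Y i) ⊆ K) ∧
      (∀ x, χ x • X x = ∑ i, chartField x₀ (EuclideanSpace.single i 1) (Y i) x) ∧
      ∀ i, ∀ z ∈ K, Y i z = chartDensity x₀ z * χ ((extChartAt 𝕀 x₀).symm z) *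
        coordMap x₀ ((extChartAt 𝕀 x₀).symm z) (X ((extChartAt 𝕀 x₀).symm z)) i := by
  classical
  let T := (extChartAt 𝕀 x₀).target
  -- The components of `χ X` in the coordinate frame, multiplied by the density.
  let g : Fin (n + 1) → 𝔼 → ℝ := fun i z => chartDensity x₀ z * χ ((extChartAt 𝕀 x₀).symm z) *
        coordMap x₀ ((extChartAt 𝕀 x₀).symm z) (X ((extChartAt 𝕀 x₀).symm z)) i
  have hc : ContDiffOn ℝ ∞ (fun z => (coordMap x₀ ((extChartAt 𝕀 x₀).symm z)
      (X ((extChartAt 𝕀 x₀).symm z)) : 𝔼)) T := by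
    rw [← contMDiffOn_iff_contDiffOn]
    have h1 := ((trivializationAt 𝔼 (TangentSpace 𝕀) x₀).contMDiffOn_section_baseSet_iff).1
      hX.contMDiffOn
    refine (h1.comp (contMDiffOn_extChartAt_symm x₀) fun z hz => ?_).congr fun z hz => ?_
    · have := symm_mem_chart_source hz
      simpa using this
    · have := symm_mem_chart_source hz
      rw [Trivialization.continuousLinearMapAt_apply, Trivialization.linearMapAt_apply,
        if_pos (by simpa using this)]
      rfl
  have hg : ∀ i, ContDiffOn ℝ ∞ (g i) T := fun i =>
    ((contDiffOn_chartDensity x₀).mul (contDiffOn_comp_extChartAt_symm hχ x₀)).mul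
      ((contDiffOn_piLp 2).1 hc i)
  let Y : Fin (n + 1) → 𝔼 → ℝ := fun i => T.indicator (g i)
  have hYK : ∀ i, Function.support (Y i) ⊆ K := by
    intro i z hz
    have hzT : z ∈ T := mem_of_indicator_ne_zero hz
    have h1 : χ ((extChartAt 𝕀 x₀).symm z) ≠ 0 := by
      intro h0
      refine hz ?_
      simp only [Y, indicator_of_mem hzT, g, h0, mul_zero, zero_mul]
    obtain ⟨z', hz', he⟩ := hχK h1
    have : z' = z := (extChartAt 𝕀 x₀).symm.injOn (hKt hz') hzT he
    exact this ▸ hz'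
  refine ⟨Y, fun i => ?_, hYK, fun x => ?_, fun i z hz => indicator_of_mem (hKt hz) _⟩
  · rw [contDiff_iff_contDiffAt]
    intro z
    by_cases hz : z ∈ T
    · have hT : T ∈ 𝓝 z := (isOpen_extChartAt_target x₀).mem_nhds hz
      refine ((hg i).contDiffAt hT).congr_of_eventuallyEq ?_
      filter_upwards [hT] with y hy
      exact indicator_of_mem hy _
    · have hz' : z ∈ Kᶜ := fun h => hz (hKt h)
      refine (contDiffAt_const (c := (0 : ℝ))).congr_of_eventuallyEq ?_
      filter_upwards [hK.isClosed.isOpen_compl.mem_nhds hz'] with y hy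
      by_contra h0
      exact hy (hYK i h0)
  · by_cases hx : x ∈ (extChartAt 𝕀 x₀).symm '' K
    · obtain ⟨z, hz, rfl⟩ := hx
      set x := (extChartAt 𝕀 x₀).symm z with hxdef
      have hρ := chartDensity_pos x₀ (hKt hz)
      have hxs : x ∈ (chartAt 𝔼 x₀).source := symm_mem_chart_source (hKt hz)
      have h1 : ∀ i, chartField x₀ (EuclideanSpace.single i 1) (Y i) x =
          χ x • (coordMap x₀ x (X x) i • frameMap x₀ x (EuclideanSpace.single i 1)) := fun i => by
        rw [chartField, chartLift_symm (hKt hz), smul_smul]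
        congr 1
        have hYz : Y i z = chartDensity x₀ z * χ x * coordMap x₀ x (X x) i :=
          indicator_of_mem (hKt hz) _
        rw [hYz]
        field_simp
      simp_rw [h1]
      rw [← Finset.smul_sum]
      congr 1
      conv_lhs => rw [← frameMap_coordMap hxs (X x)]
      have h2 : coordMap x₀ x (X x) =
          ∑ i, coordMap x₀ x (X x) i • (EuclideanSpace.single i (1 : ℝ) : 𝔼) := by
        have := ((EuclideanSpace.basisFun (Fin (n + 1)) ℝ).sum_repr (coordMap x₀ x (X x))).symm
        simpa only [EuclideanSpace.basisFun_repr, EuclideanSpace.basisFun_apply] using this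
      conv_lhs => rw [h2, map_sum]
      simp only [map_smul]
    · have h0 : χ x = 0 := by
        by_contra h
        exact hx (hχK h)
      rw [h0, zero_smul, Finset.sum_eq_zero fun i _ => chartField_eq_zero (hYK i) hx]

/-- Near each point, components of vectors in the chart are bounded by their length. -/
lemma exists_nhds_norm_coordMap_le (x₀ : M) : ∃ V : Set M, IsOpen V ∧ x₀ ∈ V ∧
    V ⊆ (extChartAt 𝕀 x₀).source ∧ ∃ C : ℝ, 0 ≤ C ∧ ∀ x ∈ V, ∀ u : TangentSpace 𝕀 x,
      ‖coordMap x₀ x u‖ ≤ C * ‖u‖ := by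
  let C' : TangentSpace 𝕀 x₀ →L[ℝ] 𝔼 := coordMap (n := n) x₀ x₀
  obtain ⟨V, hV, hVo, hx⟩ := eventually_nhds_iff.1 (Filter.Eventually.and
    (eventually_norm_frameMap_coordMap_le (n := n) x₀ one_lt_two)
    (extChartAt_source_mem_nhds (I := 𝕀) x₀))
  refine ⟨V, hVo, hx, fun y hy => (hV y hy).2, ‖C'‖ * 2, by positivity, fun x hx u => ?_⟩
  have h1 : C' (frameMap x₀ x₀ (coordMap x₀ x u)) = coordMap x₀ x u :=
    coordMap_frameMap (mem_chart_source _ _) _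
  rw [← h1, mul_assoc]
  exact (C'.le_opNorm _).trans (by gcongr; exact (hV x hx).1 u)

/-- Conversely, bounds for translations in all charts imply finite perimeter, by a partition of
unity. -/
lemma perimeter_ne_top_of_hasShiftBound {A : Set M} (hA : MeasurableSet A)
    (h : ∀ x₀, HasShiftBound (n := n) x₀ A) : perimeter n A univ ≠ ⊤ := by
  classical
  choose V hVo hxV hVs B hB0 hB using exists_nhds_norm_coordMap_le (n := n) (M := M)
  obtain ⟨t, ht⟩ := isCompact_univ.elim_finite_subcover V hVo fun x _ => mem_iUnion.2 ⟨x, hxV x⟩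
  obtain ⟨f, hf⟩ := SmoothPartitionOfUnity.exists_isSubordinate 𝕀 isClosed_univ
    (fun i : t => V i) (fun i => hVo i) (fun x hx => by
      obtain ⟨i, hi, hxi⟩ := mem_iUnion₂.1 (ht hx)
      exact mem_iUnion.2 ⟨⟨i, hi⟩, hxi⟩)
  let K : t → Set 𝔼 := fun i => extChartAt 𝕀 (i : M) '' tsupport (f i)
  have hts : ∀ i : t, tsupport (f i) ⊆ (extChartAt 𝕀 (i : M)).source := fun i =>
    (hf i).trans (hVs i)
  have hKc : ∀ i, IsCompact (K i) := fun i =>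
    (isClosed_tsupport _).isCompact.image_of_continuousOn ((continuousOn_extChartAt _).mono (hts i))
  have hKt : ∀ i : t, K i ⊆ (extChartAt 𝕀 (i : M)).target := by
    rintro i _ ⟨x, hx, rfl⟩
    exact (extChartAt 𝕀 (i : M)).map_source (hts i hx)
  have hfK : ∀ i : t, Function.support (f i) ⊆ (extChartAt 𝕀 (i : M)).symm '' K i := by
    intro i x hx
    have hx' := subset_tsupport _ hx
    exact ⟨_, mem_image_of_mem _ hx', (extChartAt 𝕀 (i : M)).left_inv (hts i hx')⟩
  choose R hR using fun i : t => (hKc i).exists_bound_of_continuousOn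
    ((contDiffOn_chartDensity (n := n) (i : M)).continuousOn.mono (hKt i))
  choose D hD0 hD using fun i : t => (h (i : M)).exists_integral_fderiv_le hA (hKc i) (hKt i)
  refine (lt_of_le_of_lt (perimeter_le (C := ENNReal.ofReal
    (∑ i : t, ∑ _k : Fin (n + 1), (|R i| * B i) * (D i * 1))) fun X h' hX _ hX1 hh' => ?_)
    ENNReal.ofReal_lt_top).ne
  refine ENNReal.ofReal_le_ofReal ?_
  choose Y hY hYK hXY hYf using fun i : t =>
    exists_sum_chartField (i : M) hX (f i).contMDiff (hKc i) (hKt i) (hfK i)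
  -- Decompose the field by the partition of unity, and each part into its components.
  have hsum : ∀ x, X x =
      ∑ i : t, ∑ k, chartField (i : M) (EuclideanSpace.single k 1) (Y i k) x := by
    intro x
    have h1 : ∑ i : t, f i x = 1 := by
      rw [← finsum_eq_sum_of_fintype]
      exact f.sum_eq_one (mem_univ x)
    simp_rw [← hXY]
    rw [← Finset.sum_smul, h1, one_smul]
  have hs1 : ∀ (i : t) k, IsSmoothField (chartField (i : M) (EuclideanSpace.single k 1) (Y i k)) :=
    fun i k => isSmoothField_chartField _ _ (hKc i) (hKt i) (hYK i k) (hY i k).contDiffOn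
  have hs2 := fun (i : t) k => isDivergence_chartField (i : M) (EuclideanSpace.single k 1)
    (hKc i) (hKt i) (hYK i k) (hY i k)
  have hdiv := isDivergence_sum Finset.univ (fun i _ => isSmoothField_sum Finset.univ
    fun k _ => hs1 i k) (fun i (_ : i ∈ Finset.univ) => isDivergence_sum Finset.univ
      (fun k _ => hs1 i k) (fun k _ => hs2 i k))
  rw [← funext hsum] at hdiv
  rw [setIntegral_congr_ae hA ((hh'.ae_eq hdiv).mono fun x hx _ => hx)]
  have hint : ∀ (i : t) k, Integrable (chartLift (i : M) fun z =>
      fderiv ℝ (Y i k) z (EuclideanSpace.single k 1) / chartDensity (i : M) z)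
      ((riemVol n).restrict A) := fun i k => (integrable_of_continuous (hs2 i k).1).integrableOn
  rw [integral_finsetSum _ fun i _ => integrable_finsetSum _ fun k _ => hint i k]
  refine Finset.sum_le_sum fun i _ => ?_
  rw [integral_finsetSum _ fun k _ => hint i k]
  refine Finset.sum_le_sum fun k _ => ?_
  rw [setIntegral_divergence_chartField (i : M) _ (hKc i) (hKt i) (hYK i k) (hY i k) hA]
  have h1 := hD i (Y i k) (|R i| * B i) (EuclideanSpace.single k 1) (hY i k) (hYK i k) ?_
  · rwa [PiLp.norm_single, norm_one] at h1
  · intro z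
    by_cases hz : z ∈ K i
    · obtain ⟨x, hx, rfl⟩ := hz
      have hz' : extChartAt 𝕀 (i : M) x ∈ K i := mem_image_of_mem _ hx
      rw [hYf i k _ hz', (extChartAt 𝕀 (i : M)).left_inv (hts i hx), abs_mul, abs_mul]
      have h2 : |coordMap (i : M) x (X x) k| ≤ B i * 1 :=
        (PiLp.norm_apply_le (coordMap (i : M) x (X x)) k).trans
          ((hB i x (hf i hx) (X x)).trans (by gcongr; exacts [hB0 i, hX1 x]))
      have h3 : |f i x| ≤ 1 := by
        rw [abs_of_nonneg (f.nonneg i x)]; exact f.le_one i x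
      have h4 : |chartDensity (i : M) (extChartAt 𝕀 (i : M) x)| ≤ |R i| :=
        (hR i _ hz').trans (le_abs_self _)
      calc _ ≤ |R i| * 1 * (B i * 1) := by gcongr
        _ = |R i| * B i := by ring
    · have h0 : Y i k z = 0 := by
        by_contra h0
        exact hz (hYK i k h0)
      rw [h0, abs_zero]
      exact mul_nonneg (abs_nonneg _) (hB0 i)

/-- Symmetric differences of sets of finite perimeter have finite perimeter. -/
theorem perimeter_symmDiff_ne_top {A B : Set M} (hA : MeasurableSet A) (hB : MeasurableSet B)
    (hA' : perimeter n A univ ≠ ⊤) (hB' : perimeter n B univ ≠ ⊤) :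
    perimeter n (A ∆ B) univ ≠ ⊤ :=
  perimeter_ne_top_of_hasShiftBound (hA.symmDiff hB) fun x₀ =>
    (hasShiftBound_of_perimeter_ne_top hA hA' x₀).symmDiff
      (hasShiftBound_of_perimeter_ne_top hB hB' x₀)

end SymmDiff

/-! ### Sets without concentrated perimeter in dimension one -/

section DimensionOne

variable {M : Type*} [MetricSpace M]
    [ChartedSpace (EuclideanSpace ℝ (Fin (0 + 1))) M] [IsManifold (𝓡 (0 + 1)) ∞ M]
    [RiemannianBundle (fun x : M => TangentSpace (𝓡 (0 + 1)) x)]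
    [IsContMDiffRiemannianBundle (𝓡 (0 + 1)) ∞ (EuclideanSpace ℝ (Fin (0 + 1)))
      (fun x : M => TangentSpace (𝓡 (0 + 1)) x)]
    [IsRiemannianManifold (𝓡 (0 + 1)) M] [MeasurableSpace M] [BorelSpace M]
    [SecondCountableTopology M] [CompactSpace M]

local notation "𝔼₁" => EuclideanSpace ℝ (Fin (0 + 1))
local notation "𝕀₁" => 𝓡 (0 + 1)

lemma volume_closedBall_line (z : 𝔼₁) {r : ℝ} (hr : 0 ≤ r) :
    volume (Metric.closedBall z r) = ENNReal.ofReal r * volume (Metric.ball (0 : 𝔼₁) 1) := by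
  rw [Measure.addHaar_closedBall _ _ hr, finrank_euclideanSpace_fin, zero_add, pow_one]

/-- On the line, the volume of a set in an interval is a Lipschitz function of the interval. -/
lemma volume_inter_closedBall_le (S : Set 𝔼₁) (z z' : 𝔼₁) {r : ℝ} (hr : 0 ≤ r) (r' : ℝ) :
    volume (S ∩ Metric.closedBall z' r') ≤ volume (S ∩ Metric.closedBall z r) +
      ENNReal.ofReal (|r' - r| + dist z' z) * volume (Metric.ball (0 : 𝔼₁) 1) := by
  set R := max r (r' + dist z' z) with hR
  have hrR : r ≤ R := le_max_left _ _
  have h1 : S ∩ Metric.closedBall z' r' ⊆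
      S ∩ Metric.closedBall z r ∪ (Metric.closedBall z R \ Metric.closedBall z r) := by
    rintro y ⟨hyS, hy⟩
    have h2 : y ∈ Metric.closedBall z R := Metric.closedBall_subset_closedBall (le_max_right _ _)
      (Metric.closedBall_subset_closedBall' le_rfl hy)
    by_cases h3 : y ∈ Metric.closedBall z r
    · exact Or.inl ⟨hyS, h3⟩
    · exact Or.inr ⟨h2, h3⟩
  refine (measure_mono h1).trans ((measure_union_le _ _).trans (add_le_add le_rfl ?_))
  rw [measure_sdiff (Metric.closedBall_subset_closedBall hrR)
    measurableSet_closedBall.nullMeasurableSet (isCompact_closedBall z r).measure_lt_top.ne,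
    volume_closedBall_line z hr, volume_closedBall_line z (hr.trans hrR),
    ← ENNReal.sub_mul fun _ _ => measure_ball_lt_top.ne, ← ENNReal.ofReal_sub _ hr]
  gcongr
  have := le_abs_self (r' - r)
  have := abs_nonneg (r' - r)
  have := dist_nonneg (x := z') (y := z)
  rcases max_cases r (r' + dist z' z) with h | h <;> rw [hR, h.1] <;> linarith

lemma continuousOn_volume_inter_closedBall (S : Set 𝔼₁) :
    ContinuousOn (fun q : 𝔼₁ × ℝ => (volume (S ∩ Metric.closedBall q.1 q.2)).toReal)
      {q | 0 ≤ q.2} := by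
  set β := (volume (Metric.ball (0 : 𝔼₁) 1)).toReal with hβ
  have hfin : ∀ z r, volume (S ∩ Metric.closedBall z r) ≠ ⊤ := fun z r =>
    ((measure_mono inter_subset_right).trans_lt (isCompact_closedBall z r).measure_lt_top).ne
  have key : ∀ z z' r r', 0 ≤ r → (volume (S ∩ Metric.closedBall z' r')).toReal -
      (volume (S ∩ Metric.closedBall z r)).toReal ≤ (|r' - r| + dist z' z) * β := by
    intro z z' r r' hr
    have h1 := ENNReal.toReal_mono (ENNReal.add_ne_top.2 ⟨hfin z r, ENNReal.mul_ne_top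
      ENNReal.ofReal_ne_top measure_ball_lt_top.ne⟩) (volume_inter_closedBall_le S z z' hr r')
    rw [ENNReal.toReal_add (hfin z r) (ENNReal.mul_ne_top ENNReal.ofReal_ne_top
      measure_ball_lt_top.ne), ENNReal.toReal_mul, ENNReal.toReal_ofReal (by positivity)] at h1
    linarith
  intro q hq
  rw [ContinuousWithinAt, tendsto_iff_dist_tendsto_zero]
  have h2 : Tendsto (fun q' : 𝔼₁ × ℝ => (|q'.2 - q.2| + dist q'.1 q.1) * β)
      (𝓝[{q | 0 ≤ q.2}] q) (𝓝 0) := by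
    have : Continuous fun q' : 𝔼₁ × ℝ => (|q'.2 - q.2| + dist q'.1 q.1) * β := by fun_prop
    have h3 := this.tendsto q
    simp only [sub_self, abs_zero, dist_self, add_zero, zero_mul] at h3
    exact h3.mono_left nhdsWithin_le_nhds
  refine squeeze_zero' (Eventually.of_forall fun _ => dist_nonneg) ?_ h2
  filter_upwards [self_mem_nhdsWithin] with q' hq'
  rw [Real.dist_eq, abs_le]
  have h4 := key q.1 q'.1 q.2 q'.2 hq
  have h5 := key q'.1 q.1 q'.2 q.2 hq'
  rw [abs_sub_comm, dist_comm] at h5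
  exact ⟨by linarith, h4⟩

/-- A set that fills less than half of each small interval around the points of an open set is a
null set there. -/
lemma volume_inter_eq_zero_of_lt_half {S U : Set 𝔼₁} (hS : MeasurableSet S) {r₁ : ℝ}
    (hr₁ : 0 < r₁) (h : ∀ z ∈ U, ∀ r ∈ Ioo 0 r₁,
      (volume (S ∩ Metric.closedBall z r)).toReal < (volume (Metric.closedBall z r)).toReal / 2) :
    volume (S ∩ U) = 0 := by
  have h1 := Besicovitch.ae_tendsto_measure_inter_div_of_measurableSet
    (volume : Measure 𝔼₁) hS
  refine measure_mono_null ?_ (ae_iff.1 h1)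
  rintro z ⟨hzS, hzU⟩ hz
  rw [indicator_of_mem hzS] at hz
  have h2 : (1 : ℝ≥0∞) ≤ 1 / 2 := by
    refine le_of_tendsto hz ?_
    filter_upwards [Ioo_mem_nhdsGT hr₁] with r hr
    have hfin : volume (Metric.closedBall z r) ≠ ⊤ := (isCompact_closedBall z r).measure_lt_top.ne
    have hpos : volume (Metric.closedBall z r) ≠ 0 :=
      (Metric.measure_closedBall_pos volume z hr.1).ne'
    have hfin' : volume (S ∩ Metric.closedBall z r) ≠ ⊤ :=
      ((measure_mono inter_subset_right).trans_lt hfin.lt_top).ne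
    rw [ENNReal.div_le_iff hpos hfin, ← ENNReal.toReal_le_toReal hfin'
      (ENNReal.mul_ne_top (by simp) hfin), ENNReal.toReal_mul]
    have := h z hzU r hr
    simp only [one_div, ENNReal.toReal_inv, ENNReal.toReal_ofNat]
    linarith
  norm_num at h2

/-- In dimension one, a set whose perimeter in small balls is small has density different from one
half at all small scales, so that locally it is a null set or the complement of one. -/
lemma exists_nhds_null_or_null {A : Set M} (hA : MeasurableSet A)
    (h : ∀ ε : ℝ≥0∞, 0 < ε → ∃ ρ : ℝ, 0 < ρ ∧ ∀ q : M, perimeter 0 A (Metric.ball q ρ) ≤ ε)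
    (x₀ : M) : ∃ W : Set M, IsOpen W ∧ x₀ ∈ W ∧
      (riemVol 0 (A ∩ W) = 0 ∨ riemVol 0 (Aᶜ ∩ W) = 0) := by
  obtain ⟨R, hR, hRt⟩ := Metric.nhds_basis_closedBall.mem_iff.1
    (extChartAt_target_mem_nhds (I := 𝕀₁) x₀)
  set z₀ := extChartAt 𝕀₁ x₀ x₀ with hz₀
  have hK : IsCompact (Metric.closedBall z₀ R) := isCompact_closedBall _ _
  obtain ⟨C, hC, hiso⟩ := exists_volume_mul_volume_le_perimeter (n := 0) x₀ hK hRt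
  set β := volume (Metric.ball (0 : 𝔼₁) 1) with hβdef
  have hβ : β ≠ ⊤ := measure_ball_lt_top.ne
  have hβ0 : 0 < β.toReal := ENNReal.toReal_pos (Metric.measure_ball_pos volume _ one_pos).ne' hβ
  -- The isoperimetric inequality shows that a set with perimeter at most `P` in a ball of radius
  -- `r` does not fill exactly one half of it: otherwise `(r β / 2) ^ 2 ≤ r β / 16 * (2 r β)`.
  set P : ℝ≥0 := (β.toReal / (32 * C)).toNNReal with hP
  have hP0 : 0 < P := Real.toNNReal_pos.2 (by positivity)
  have hPval : (P : ℝ) = β.toReal / (32 * C) := Real.coe_toNNReal _ (by positivity)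
  obtain ⟨ρ, hρ, hper⟩ := h P (by exact_mod_cast hP0)
  obtain ⟨r₁, hr₁, huc⟩ := Metric.uniformContinuousOn_iff.1 (hK.uniformContinuousOn_of_continuous
    ((continuousOn_extChartAt_symm (I := 𝕀₁) x₀).mono hRt)) ρ hρ
  set r₂ := min r₁ (R / 2) with hr₂
  have hr₂0 : 0 < r₂ := lt_min hr₁ (half_pos hR)
  set S := chartSet (n := 0) x₀ A with hSdef
  have hS : MeasurableSet S := measurableSet_chartSet (n := 0) x₀ hA
  set U := Metric.ball z₀ (R / 2) with hU
  have hsub : ∀ z ∈ U, ∀ r ∈ Ioo 0 r₂, Metric.closedBall z r ⊆ Metric.closedBall z₀ R := by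
    intro z hz r hr
    refine Metric.closedBall_subset_closedBall' ?_
    have h1 : dist z z₀ < R / 2 := hz
    have h2 : r < R / 2 := hr.2.trans_le (min_le_right _ _)
    linarith
  have hfin : ∀ T : Set 𝔼₁, ∀ z r, volume (T ∩ Metric.closedBall z r) ≠ ⊤ := fun T z r =>
    ((measure_mono inter_subset_right).trans_lt (isCompact_closedBall z r).measure_lt_top).ne
  have hsplit : ∀ z r, (volume (S ∩ Metric.closedBall z r)).toReal +
      (volume (Sᶜ ∩ Metric.closedBall z r)).toReal = (volume (Metric.closedBall z r)).toReal := by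
    intro z r
    rw [← ENNReal.toReal_add (hfin _ _ _) (hfin _ _ _), inter_comm, inter_comm Sᶜ,
      ← sdiff_eq, measure_inter_add_sdiff _ hS]
  have hne : ∀ z ∈ U, ∀ r ∈ Ioo 0 r₂, (volume (S ∩ Metric.closedBall z r)).toReal -
      (volume (Metric.closedBall z r)).toReal / 2 ≠ 0 := by
    intro z hz r hr heq
    have hzK := hsub z hz r hr
    have h1 : (extChartAt 𝕀₁ x₀).symm '' Metric.closedBall z r ⊆
        Metric.ball ((extChartAt 𝕀₁ x₀).symm z) ρ := by
      rintro _ ⟨y, hy, rfl⟩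
      exact huc y (hzK hy) z (hzK (Metric.mem_closedBall_self hr.1.le))
        ((Metric.mem_closedBall.1 hy).trans_lt (hr.2.trans_le (min_le_left _ _)))
    have h2 := hiso A _ P z r hA h1 (hper _) hzK
    have hball : (Metric.ball z r : Set 𝔼₁) =ᵐ[volume] Metric.closedBall z r := by
      rw [← Metric.ball_union_sphere]
      exact (union_ae_eq_left_of_ae_eq_empty (ae_eq_empty.2 (Measure.addHaar_sphere _ _ _))).symm
    have e1 : ∀ T : Set 𝔼₁, volume (Metric.ball z r ∩ T) = volume (T ∩ Metric.closedBall z r) :=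
      fun T => by
        rw [inter_comm]
        exact measure_congr ((ae_eq_refl T).inter hball)
    have h2r : 0 ≤ 2 * r := by linarith [hr.1]
    rw [← hSdef, sdiff_eq, e1, e1, ← Measure.addHaar_closedBall_eq_addHaar_ball volume,
      volume_closedBall_line _ h2r] at h2
    have h3 := ENNReal.toReal_mono (by finiteness) h2
    rw [ENNReal.toReal_mul, ENNReal.toReal_mul, ENNReal.toReal_mul, ENNReal.toReal_ofReal
      (by have := hr.1; positivity), ENNReal.toReal_ofReal (by linarith [hr.1]), hPval] at h3
    have h4 := hsplit z r
    rw [volume_closedBall_line z hr.1.le, ENNReal.toReal_mul,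
      ENNReal.toReal_ofReal hr.1.le] at h4 heq
    rw [← hβdef] at h3 h4 heq
    have h5 : (volume (S ∩ Metric.closedBall z r)).toReal = r * β.toReal / 2 := by linarith
    have h6 : (volume (Sᶜ ∩ Metric.closedBall z r)).toReal = r * β.toReal / 2 := by linarith
    have h6' : C * (2 * r) * (β.toReal / (32 * C)) = r * β.toReal / 16 := by
      field_simp
      ring
    rw [h5, h6, h6'] at h3
    have h7 : 0 < r * β.toReal * (r * β.toReal) := by have := hr.1; positivity
    nlinarith
  -- The sign of the deviation from density one half cannot change.
  have hconn : IsPreconnected (U ×ˢ Ioo (0 : ℝ) r₂) :=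
    ((convex_ball z₀ (R / 2)).prod (convex_Ioo 0 r₂)).isPreconnected
  have hcont : ContinuousOn (fun q : 𝔼₁ × ℝ => (volume (S ∩ Metric.closedBall q.1 q.2)).toReal -
      (volume (Metric.closedBall q.1 q.2)).toReal / 2) (U ×ˢ Ioo (0 : ℝ) r₂) := by
    have hsub' : U ×ˢ Ioo (0 : ℝ) r₂ ⊆ {q | 0 ≤ q.2} := fun q hq => hq.2.1.le
    have h2 := continuousOn_volume_inter_closedBall univ
    simp only [univ_inter] at h2
    exact ((continuousOn_volume_inter_closedBall S).mono hsub').sub ((h2.mono hsub').div_const 2)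
  have hsign : (∀ z ∈ U, ∀ r ∈ Ioo 0 r₂, (volume (S ∩ Metric.closedBall z r)).toReal <
      (volume (Metric.closedBall z r)).toReal / 2) ∨ ∀ z ∈ U, ∀ r ∈ Ioo 0 r₂,
      (volume (Sᶜ ∩ Metric.closedBall z r)).toReal <
        (volume (Metric.closedBall z r)).toReal / 2 := by
    by_contra! hcon
    obtain ⟨⟨z, hz, r, hr, h1⟩, z', hz', r', hr', h2⟩ := hcon
    have h3 := hsplit z' r'
    obtain ⟨q, hq, hq0⟩ := hconn.intermediate_value (a := (z', r')) (b := (z, r))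
      ⟨hz', hr'⟩ ⟨hz, hr⟩ hcont (show (0 : ℝ) ∈ Icc _ _ from ⟨by simp only; linarith,
        by simp only; linarith⟩)
    exact hne q.1 hq.1 q.2 hq.2 hq0
  set W : Set M := (extChartAt 𝕀₁ x₀).source ∩ extChartAt 𝕀₁ x₀ ⁻¹' U with hWdef
  have hW : IsOpen W :=
    (continuousOn_extChartAt x₀).isOpen_inter_preimage (isOpen_extChartAt_source x₀)
      Metric.isOpen_ball
  have hback : ∀ (B : Set M) (T : Set 𝔼₁), MeasurableSet B → extChartAt 𝕀₁ x₀ '' (B ∩ W) ⊆ T ∩ U →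
      volume (T ∩ U) = 0 → riemVol 0 (B ∩ W) = 0 := by
    intro B T hB hBT hT
    rw [riemVol_eq_setLIntegral (hB.inter hW.measurableSet) fun y hy => hy.2.1]
    exact setLIntegral_measure_zero _ _ (measure_mono_null hBT hT)
  refine ⟨W, hW, ⟨mem_extChartAt_source x₀, Metric.mem_ball_self (half_pos hR)⟩, ?_⟩
  refine hsign.imp (fun h1 => hback A S hA ?_ (volume_inter_eq_zero_of_lt_half hS hr₂0 h1))
    fun h1 => hback Aᶜ Sᶜ hA.compl ?_ (volume_inter_eq_zero_of_lt_half hS.compl hr₂0 h1)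
  · rintro _ ⟨y, ⟨hyA, hyW⟩, rfl⟩
    refine ⟨⟨(extChartAt 𝕀₁ x₀).map_source hyW.1, ?_⟩, hyW.2⟩
    rwa [mem_preimage, (extChartAt 𝕀₁ x₀).left_inv hyW.1]
  · rintro _ ⟨y, ⟨hyA, hyW⟩, rfl⟩
    refine ⟨fun h4 => hyA ?_, hyW.2⟩
    have h5 := h4.2
    rwa [mem_preimage, (extChartAt 𝕀₁ x₀).left_inv hyW.1] at h5

/-- On a connected curve, a set whose perimeter does not concentrate is trivial. -/
lemma perimeter_eq_zero_of_dim_one [ConnectedSpace M] {A : Set M} (hA : MeasurableSet A)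
    (h : ∀ ε : ℝ≥0∞, 0 < ε → ∃ ρ : ℝ, 0 < ρ ∧ ∀ q : M, perimeter 0 A (Metric.ball q ρ) ≤ ε) :
    perimeter 0 A univ = 0 := by
  rw [perimeter_eq_zero_iff hA]
  let G : Set M → Set M := fun B => {x | ∃ W : Set M, IsOpen W ∧ x ∈ W ∧ riemVol 0 (B ∩ W) = 0}
  have hGo : ∀ B, IsOpen (G B) := fun B => isOpen_iff_forall_mem_open.2 fun x ⟨W, hW, hx, h0⟩ =>
    ⟨W, fun y hy => ⟨W, hW, hy, h0⟩, hW, hx⟩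
  have hGnull : ∀ B, G B = univ → riemVol 0 B = 0 := fun B hB => by
    refine measure_null_of_locally_null B fun x _ => ?_
    obtain ⟨W, hW, hx, h0⟩ : x ∈ G B := hB ▸ mem_univ x
    exact ⟨B ∩ W, inter_mem_nhdsWithin _ (hW.mem_nhds hx), h0⟩
  have hcover : G A ∪ G Aᶜ = univ := eq_univ_of_forall fun x => by
    obtain ⟨W, hW, hx, h0⟩ := exists_nhds_null_or_null hA h x
    exact h0.imp (fun h0 => ⟨W, hW, hx, h0⟩) fun h0 => ⟨W, hW, hx, h0⟩
  have hdisj : Disjoint (G A) (G Aᶜ) := by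
    rw [Set.disjoint_left]
    rintro x ⟨W, hW, hx, h0⟩ ⟨W', hW', hx', h0'⟩
    refine ((hW.inter hW').measure_pos (riemVol 0) ⟨x, hx, hx'⟩).ne' (measure_mono_null ?_
      (measure_union_null h0 h0'))
    rintro y ⟨hy, hy'⟩
    by_cases hyA : y ∈ A
    · exact Or.inl ⟨hyA, hy⟩
    · exact Or.inr ⟨hyA, hy'⟩
  have hclopen : IsClopen (G A) := by
    refine ⟨?_, hGo A⟩
    rw [← isOpen_compl_iff, (IsCompl.of_le (hdisj.le_bot) hcover.ge).compl_eq]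
    exact hGo Aᶜ
  rcases isClopen_iff.1 hclopen with h0 | h0
  · right
    refine hGnull _ ?_
    rwa [h0, empty_union] at hcover
  · exact Or.inl (hGnull _ h0)

end DimensionOne

/-! ### The flat topology -/

section FlatTopology

variable {n : ℕ} {M : Type*} [MetricSpace M]
    [ChartedSpace (EuclideanSpace ℝ (Fin (n + 1))) M] [IsManifold (𝓡 (n + 1)) ∞ M]
    [RiemannianBundle (fun x : M => TangentSpace (𝓡 (n + 1)) x)]
    [IsContMDiffRiemannianBundle (𝓡 (n + 1)) ∞ (EuclideanSpace ℝ (Fin (n + 1)))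
      (fun x : M => TangentSpace (𝓡 (n + 1)) x)]
    [IsRiemannianManifold (𝓡 (n + 1)) M] [MeasurableSpace M] [BorelSpace M]
    [SecondCountableTopology M] [CompactSpace M]

local notation "𝔼" => EuclideanSpace ℝ (Fin (n + 1))
local notation "𝕀" => 𝓡 (n + 1)

/-- The volume distance of two sets up to complements: the volume of their symmetric difference or
of its complement, whichever is smaller. -/
def volDist (n : ℕ) {M : Type*} [MetricSpace M] [MeasurableSpace M] [BorelSpace M] (A B : Set M) :
    ℝ :=
  min ((riemVol n).real (A ∆ B)) ((riemVol n).real (A ∆ B)ᶜ)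

lemma volDist_nonneg (A B : Set M) : 0 ≤ volDist n A B :=
  le_min measureReal_nonneg measureReal_nonneg

lemma volDist_comm (A B : Set M) : volDist n A B = volDist n B A := by
  rw [volDist, volDist, symmDiff_comm]

lemma volDist_self (A : Set M) : volDist n A A = 0 :=
  le_antisymm ((min_le_left _ _).trans_eq (by simp)) (volDist_nonneg A A)

lemma volDist_triangle (A B C : Set M) : volDist n A C ≤ volDist n A B + volDist n B C := by
  have h1 : ∀ S T R : Set M, S ⊆ T ∪ R →
      (riemVol n).real S ≤ (riemVol n).real T + (riemVol n).real R := fun S T R h =>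
    (measureReal_mono h).trans (measureReal_union_le T R)
  have e1 := h1 (A ∆ C) (A ∆ B) (B ∆ C) (symmDiff_triangle A B C)
  have e2 : (riemVol n).real (A ∆ C) ≤
      (riemVol n).real (A ∆ B)ᶜ + (riemVol n).real (B ∆ C)ᶜ := h1 _ _ _ fun x hx => by
    simp only [mem_union, mem_compl_iff, mem_symmDiff] at hx ⊢
    tauto
  have e3 : (riemVol n).real (A ∆ C)ᶜ ≤
      (riemVol n).real (A ∆ B) + (riemVol n).real (B ∆ C)ᶜ := h1 _ _ _ fun x hx => by
    simp only [mem_union, mem_compl_iff, mem_symmDiff] at hx ⊢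
    tauto
  have e4 : (riemVol n).real (A ∆ C)ᶜ ≤
      (riemVol n).real (A ∆ B)ᶜ + (riemVol n).real (B ∆ C) := h1 _ _ _ fun x hx => by
    simp only [mem_union, mem_compl_iff, mem_symmDiff] at hx ⊢
    tauto
  have m1 : volDist n A C ≤ _ := min_le_left _ _
  have m2 : volDist n A C ≤ _ := min_le_right _ _
  rcases min_cases ((riemVol n).real (A ∆ B)) ((riemVol n).real (A ∆ B)ᶜ) with ⟨h, -⟩ | ⟨h, -⟩ <;>
    rcases min_cases ((riemVol n).real (B ∆ C)) ((riemVol n).real (B ∆ C)ᶜ) with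
      ⟨h', -⟩ | ⟨h', -⟩ <;>
    rw [volDist.eq_1 n A B, volDist.eq_1 n B C, h, h'] <;> linarith

lemma volDist_eq_zero_iff [ConnectedSpace M] {A B : Set M} (hA : MeasurableSet A)
    (hB : MeasurableSet B) : volDist n A B = 0 ↔ perimeter n (A ∆ B) univ = 0 := by
  rw [perimeter_eq_zero_iff (hA.symmDiff hB), ← measureReal_eq_zero_iff, ← measureReal_eq_zero_iff,
    volDist]
  constructor
  · intro h
    rcases min_choice ((riemVol n).real (A ∆ B)) ((riemVol n).real (A ∆ B)ᶜ) with h' | h'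
    · exact Or.inl (h'.symm.trans h)
    · exact Or.inr (h'.symm.trans h)
  · rintro (h | h)
    · rw [h, min_eq_left measureReal_nonneg]
    · rw [h, min_eq_right measureReal_nonneg]

namespace CaccioppoliSet

variable [ConnectedSpace M]

lemma boundary_eq_iff {Ω Θ : CaccioppoliSet n M} :
    Ω.boundary = Θ.boundary ↔ volDist n Ω.carrier Θ.carrier = 0 := by
  have h : Equivalence fun Ω Θ : CaccioppoliSet n M =>
      perimeter n (Ω.carrier ∆ Θ.carrier) univ = 0 := by
    simp_rw [← volDist_eq_zero_iff (CaccioppoliSet.measurableSet _)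
      (CaccioppoliSet.measurableSet _)]
    refine ⟨fun Ω => volDist_self _, fun h => by rwa [volDist_comm], fun {Ω Θ Ξ} h h' => ?_⟩
    exact le_antisymm ((volDist_triangle _ Θ.carrier _).trans_eq (by rw [h, h', add_zero]))
      (volDist_nonneg _ _)
  exact (h.quot_mk_eq_iff Ω Θ).trans (volDist_eq_zero_iff Ω.measurableSet Θ.measurableSet).symm

lemma perimeter_eq_of_boundary_eq {Ω Θ : CaccioppoliSet n M} (h : Ω.boundary = Θ.boundary)
    (U : Set M) : perimeter n Ω.carrier U = perimeter n Θ.carrier U := by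
  rw [boundary_eq_iff, volDist_eq_zero_iff Ω.measurableSet Θ.measurableSet,
    perimeter_eq_zero_iff (Ω.measurableSet.symmDiff Θ.measurableSet)] at h
  rcases h with h | h
  · exact perimeter_congr_ae (measure_symmDiff_eq_zero_iff.1 h) U
  · rw [← perimeter_compl Θ.measurableSet]
    refine perimeter_congr_ae (measure_symmDiff_eq_zero_iff.1 ?_) U
    convert h using 2
    ext x
    simp only [mem_compl_iff, mem_symmDiff]
    tauto

lemma areaIn_boundary (Ω : CaccioppoliSet n M) (U : Set M) :
    Ω.boundary.areaIn U = perimeter n Ω.carrier U :=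
  le_antisymm (iInf_le_of_le Ω (iInf_le_of_le rfl le_rfl))
    (le_iInf₂ fun _ h => (perimeter_eq_of_boundary_eq h U).ge)

/-- The symmetric difference of two Caccioppoli sets. -/
def symmDiff (Ω Θ : CaccioppoliSet n M) : CaccioppoliSet n M where
  carrier := Ω.carrier ∆ Θ.carrier
  measurableSet := Ω.measurableSet.symmDiff Θ.measurableSet
  perimeter_lt_top := (perimeter_symmDiff_ne_top Ω.measurableSet Θ.measurableSet
    Ω.perimeter_lt_top.ne Θ.perimeter_lt_top.ne).lt_top

/-- The complement of a Caccioppoli set. -/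
def compl (Ω : CaccioppoliSet n M) : CaccioppoliSet n M where
  carrier := Ω.carrierᶜ
  measurableSet := Ω.measurableSet.compl
  perimeter_lt_top := by
    rw [perimeter_compl Ω.measurableSet]
    exact Ω.perimeter_lt_top

lemma boundary_compl (Ω : CaccioppoliSet n M) : Ω.compl.boundary = Ω.boundary := by
  rw [boundary_eq_iff]
  refine le_antisymm ((min_le_right _ _).trans_eq ?_) (volDist_nonneg _ _)
  have : (Ω.compl.carrier ∆ Ω.carrier)ᶜ = ∅ := by
    ext x
    simp only [compl, mem_compl_iff, mem_symmDiff, mem_empty_iff_false]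
    tauto
  rw [this, measureReal_empty]

lemma flatDist_boundary_le (Ω Θ : CaccioppoliSet n M) :
    BoundaryCycle.flatDist Ω.boundary Θ.boundary ≤
      ENNReal.ofReal (volDist n Ω.carrier Θ.carrier) := by
  have key : ∀ Q : CaccioppoliSet n M,
      perimeter n ((Ω.carrier ∆ Θ.carrier) ∆ Q.carrier) univ = 0 →
      BoundaryCycle.flatDist Ω.boundary Θ.boundary ≤
        ENNReal.ofReal ((riemVol n).real Q.carrier) := by
    intro Q hQ
    rw [ofReal_measureReal]
    refine iInf_le_of_le Ω (iInf_le_of_le rfl (iInf_le_of_le Θ (iInf_le_of_le rfl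
      (iInf_le_of_le Q ?_))))
    rw [hQ, zero_add]
    exact le_rfl
  rcases min_choice ((riemVol n).real (Ω.carrier ∆ Θ.carrier))
    ((riemVol n).real (Ω.carrier ∆ Θ.carrier)ᶜ) with h | h
  · rw [volDist, h]
    refine key (Ω.symmDiff Θ) ?_
    rw [show (Ω.symmDiff Θ).carrier = Ω.carrier ∆ Θ.carrier from rfl, symmDiff_self]
    exact perimeter_empty univ
  · rw [volDist, h]
    refine key (Ω.symmDiff Θ).compl ?_
    rw [show (Ω.symmDiff Θ).compl.carrier = (Ω.carrier ∆ Θ.carrier)ᶜ from rfl, symmDiff_compl_self]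
    change perimeter n (univ : Set M) univ = 0
    rw [← compl_empty, perimeter_compl MeasurableSet.empty, perimeter_empty]

end CaccioppoliSet

namespace BoundaryCycle

variable [ConnectedSpace M]

lemma exists_boundary_eq (T : BoundaryCycle n M) : ∃ Ω : CaccioppoliSet n M, Ω.boundary = T :=
  Quot.exists_rep T

/-- The volume distance of two boundaries. -/
def bdist (S T : BoundaryCycle n M) : ℝ :=
  volDist n S.exists_boundary_eq.choose.carrier T.exists_boundary_eq.choose.carrier

lemma bdist_boundary (Ω Θ : CaccioppoliSet n M) :
    bdist Ω.boundary Θ.boundary = volDist n Ω.carrier Θ.carrier := by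
  have key : ∀ Ω Ω' Θ Θ' : CaccioppoliSet n M, Ω.boundary = Ω'.boundary →
      Θ.boundary = Θ'.boundary →
      volDist n Ω.carrier Θ.carrier ≤ volDist n Ω'.carrier Θ'.carrier := by
    intro Ω Ω' Θ Θ' h h'
    rw [CaccioppoliSet.boundary_eq_iff] at h h'
    have h1 := volDist_triangle (n := n) Ω.carrier Ω'.carrier Θ.carrier
    have h2 := volDist_triangle (n := n) Ω'.carrier Θ'.carrier Θ.carrier
    rw [volDist_comm Θ'.carrier] at h2
    linarith
  have e1 := Ω.boundary.exists_boundary_eq.choose_spec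
  have e2 := Θ.boundary.exists_boundary_eq.choose_spec
  exact le_antisymm (key _ _ _ _ e1 e2) (key _ _ _ _ e1.symm e2.symm)

lemma bdist_self (T : BoundaryCycle n M) : bdist T T = 0 := volDist_self _

lemma bdist_triangle (S T R : BoundaryCycle n M) : bdist S R ≤ bdist S T + bdist T R :=
  volDist_triangle _ _ _

lemma eq_of_bdist_eq_zero {S T : BoundaryCycle n M} (h : bdist S T = 0) : S = T := by
  obtain ⟨Ω, rfl⟩ := S.exists_boundary_eq
  obtain ⟨Θ, rfl⟩ := T.exists_boundary_eq
  rwa [bdist_boundary, ← CaccioppoliSet.boundary_eq_iff] at h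

lemma flatDist_le (S T : BoundaryCycle n M) : flatDist S T ≤ ENNReal.ofReal (bdist S T) := by
  obtain ⟨Ω, rfl⟩ := S.exists_boundary_eq
  obtain ⟨Θ, rfl⟩ := T.exists_boundary_eq
  rw [bdist_boundary]
  exact CaccioppoliSet.flatDist_boundary_le Ω Θ

/-- Boundaries at small flat distance have small volume distance: by the isoperimetric property,
a set of small perimeter has small volume, or its complement has. -/
lemma exists_bdist_lt_of_flatDist_lt {δ : ℝ} (hδ : 0 < δ) : ∃ ε : ℝ≥0∞, 0 < ε ∧
    ∀ S T : BoundaryCycle n M, flatDist S T < ε → bdist S T < δ := by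
  have hδ' : 0 < ENNReal.ofReal (δ / 2) := ENNReal.ofReal_pos.2 (by positivity)
  obtain ⟨ε, hε, h⟩ := isIsoperimetric_univ (n := n) (M := M) _ hδ'
  refine ⟨min ε (ENNReal.ofReal (δ / 2)), lt_min hε hδ', fun S T hST => ?_⟩
  simp only [flatDist, iInf_lt_iff] at hST
  obtain ⟨Ω, rfl, Θ, rfl, Q, hQ⟩ := hST
  rw [bdist_boundary]
  have h1 := h _ ((Ω.measurableSet.symmDiff Θ.measurableSet).symmDiff Q.measurableSet)
    ((le_self_add.trans_lt hQ).trans_le (min_le_left _ _))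
  rw [inter_univ, ← compl_eq_univ_sdiff] at h1
  have hQ1 : (riemVol n).real Q.carrier < δ / 2 := by
    rw [Measure.real, ← ENNReal.lt_ofReal_iff_toReal_lt (measure_ne_top _ _)]
    exact (le_add_self.trans_lt hQ).trans_le (min_le_right _ _)
  have hlt : ∀ A : Set M, riemVol n A < ENNReal.ofReal (δ / 2) → (riemVol n).real A < δ / 2 :=
    fun A hA => by rwa [Measure.real, ← ENNReal.lt_ofReal_iff_toReal_lt (measure_ne_top _ _)]
  rcases h1 with h1 | h1
  · refine (min_le_left _ _).trans_lt ?_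
    refine ((measureReal_mono (s₂ := (Ω.carrier ∆ Θ.carrier) ∆ Q.carrier ∪ Q.carrier)
      fun x hx => ?_).trans (measureReal_union_le _ _)).trans_lt
      (by linarith [hlt _ h1] : _ < δ)
    rw [mem_union, mem_symmDiff (a := x) (s := Ω.carrier ∆ Θ.carrier)]
    tauto
  · refine (min_le_right _ _).trans_lt ?_
    refine ((measureReal_mono (s₂ := ((Ω.carrier ∆ Θ.carrier) ∆ Q.carrier)ᶜ ∪ Q.carrier)
      fun x hx => ?_).trans (measureReal_union_le _ _)).trans_lt
      (by linarith [hlt _ h1] : _ < δ)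
    rw [mem_union, mem_compl_iff, mem_symmDiff (a := x) (s := Ω.carrier ∆ Θ.carrier)]
    rw [mem_compl_iff] at hx
    tauto

/-- The volume distance induces the flat topology. -/
lemma mem_nhds_iff {T : BoundaryCycle n M} {V : Set (BoundaryCycle n M)} :
    V ∈ 𝓝 T ↔ ∃ δ : ℝ, 0 < δ ∧ ∀ S, bdist T S < δ → S ∈ V := by
  constructor
  · intro hV
    obtain ⟨W, hWV, hW, hT⟩ := _root_.mem_nhds_iff.1 hV
    obtain ⟨ε, hε, h⟩ := hW T hT
    obtain ⟨ε', hε', hεε'⟩ := ENNReal.lt_iff_exists_real_btwn.1 hε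
    refine ⟨ε', ENNReal.ofReal_pos.1 hεε'.1, fun S hS => hWV (h S ?_)⟩
    refine (flatDist_le T S).trans_lt (lt_of_le_of_lt ?_ hεε'.2)
    exact ENNReal.ofReal_le_ofReal hS.le
  · rintro ⟨δ, hδ, h⟩
    refine _root_.mem_nhds_iff.2 ⟨{S | bdist T S < δ}, h, fun S hS => ?_, ?_⟩
    · obtain ⟨ε, hε, h1⟩ := exists_bdist_lt_of_flatDist_lt (n := n) (M := M) (sub_pos.2 hS)
      refine ⟨ε, hε, fun R hR => ?_⟩
      have h2 := h1 S R hR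
      have h3 := bdist_triangle T S R
      show bdist T R < δ
      linarith
    · rw [mem_ofPred_eq, bdist_self]
      exact hδ

end BoundaryCycle

end FlatTopology

/-! ### The retraction onto the half-volume cycles -/

section SublevelRetraction

variable {n : ℕ} {M : Type*} [MetricSpace M]
    [ChartedSpace (EuclideanSpace ℝ (Fin (n + 1))) M] [IsManifold (𝓡 (n + 1)) ∞ M]
    [RiemannianBundle (fun x : M => TangentSpace (𝓡 (n + 1)) x)]
    [IsContMDiffRiemannianBundle (𝓡 (n + 1)) ∞ (EuclideanSpace ℝ (Fin (n + 1)))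
      (fun x : M => TangentSpace (𝓡 (n + 1)) x)]
    [IsRiemannianManifold (𝓡 (n + 1)) M] [MeasurableSpace M] [BorelSpace M]
    [SecondCountableTopology M] [CompactSpace M]

local notation "𝔼" => EuclideanSpace ℝ (Fin (n + 1))
local notation "𝕀" => 𝓡 (n + 1)

/-- For a Morse function, the volume swept out by the sublevel sets depends continuously on the
level, as the level sets are null sets. -/
lemma IsMorse.continuous_volume_union_sublevel {f : M → ℝ} (hf : IsMorse n f) {A : Set M}
    (hA : MeasurableSet A) : Continuous fun c : ℝ => riemVol n (A ∪ {x | f x ≤ c}) := by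
  have hfm : Measurable f := hf.1.continuous.measurable
  refine continuous_iff_continuousAt.2 fun c => ?_
  refine tendsto_measure_of_ae_tendsto_indicator_of_isFiniteMeasure (𝓝 c)
    (hA.union (hfm measurableSet_Iic)) (fun d => hA.union (hfm measurableSet_Iic)) ?_
  have h0 : ∀ᵐ x ∂(riemVol n : Measure M), f x ≠ c := by
    rw [ae_iff]
    simpa only [ne_eq, not_not] using! hf.riemVol_level c
  filter_upwards [h0] with x hx
  rcases hx.lt_or_gt with hx | hx
  · filter_upwards [lt_mem_nhds hx] with d hd
    exact iff_of_true (Or.inr hd.le) (Or.inr hx.le)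
  · filter_upwards [gt_mem_nhds hx] with d hd
    simp only [mem_union, mem_ofPred_eq, hx.not_ge, hd.not_ge]

lemma IsMorse.exists_volume_union_sublevel_eq [Nonempty M] {f : M → ℝ} (hf : IsMorse n f)
    {A : Set M} (hA : MeasurableSet A) {y : ℝ} (hy : (riemVol n).real A ≤ y)
    (hy' : y ≤ (riemVol n).real (univ : Set M)) :
    ∃ c : ℝ, (riemVol n).real (A ∪ {x | f x ≤ c}) = y := by
  obtain ⟨x₁, -, h₁⟩ := isCompact_univ.exists_isMinOn univ_nonempty hf.1.continuous.continuousOn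
  obtain ⟨x₂, -, h₂⟩ := isCompact_univ.exists_isMaxOn univ_nonempty hf.1.continuous.continuousOn
  have hlo : A ∪ {x | f x ≤ f x₁ - 1} = A := by
    rw [union_eq_left]
    intro x hx
    have h3 : f x₁ ≤ f x := h₁ (mem_univ x)
    rw [mem_ofPred_eq] at hx
    linarith
  have hhi : A ∪ {x | f x ≤ f x₂} = univ := by
    rw [eq_univ_iff_forall]
    exact fun x => Or.inr (h₂ (mem_univ x))
  have hcont : Continuous fun c : ℝ => (riemVol n).real (A ∪ {x | f x ≤ c}) := by
    refine continuous_iff_continuousAt.2 fun c => ?_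
    exact (ENNReal.tendsto_toReal (measure_ne_top _ _)).comp
      (hf.continuous_volume_union_sublevel hA).continuousAt
  have h12 : f x₁ - 1 ≤ f x₂ := by
    have h3 : f x₁ ≤ f x₂ := h₁ (mem_univ x₂)
    linarith
  obtain ⟨c, -, hc⟩ := intermediate_value_Icc h12 hcont.continuousOn
    (show y ∈ Icc _ _ by simpa only [hlo, hhi] using ⟨hy, hy'⟩)
  exact ⟨c, hc⟩

lemma measureReal_symmDiff_of_subset {A B : Set M} (hA : MeasurableSet A) (h : A ⊆ B) :
    (riemVol n).real (A ∆ B) = (riemVol n).real B - (riemVol n).real A := by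
  rw [Set.symmDiff_def, sdiff_eq_empty.2 h, empty_union, measureReal_sdiff h hA]

/-- Sublevel sets are nested, so that adding them to two sets of nearly equal volumes creates no
further symmetric difference than the volumes account for. -/
lemma measureReal_symmDiff_union_sublevel_le (f : M → ℝ) {A B : Set M} {c d : ℝ}
    (hA : MeasurableSet (A ∪ {x | f x ≤ c})) (hB : MeasurableSet (B ∪ {x | f x ≤ d})) :
    (riemVol n).real ((A ∪ {x | f x ≤ c}) ∆ (B ∪ {x | f x ≤ d})) ≤
      2 * (riemVol n).real (A ∆ B) + |(riemVol n).real (A ∪ {x | f x ≤ c}) -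
        (riemVol n).real (B ∪ {x | f x ≤ d})| := by
  have key : ∀ (A B : Set M) (c d : ℝ), c ≤ d → MeasurableSet (A ∪ {x | f x ≤ c}) →
      MeasurableSet (B ∪ {x | f x ≤ d}) →
      (riemVol n).real ((A ∪ {x | f x ≤ c}) ∆ (B ∪ {x | f x ≤ d})) ≤
      2 * (riemVol n).real (A ∆ B) + |(riemVol n).real (A ∪ {x | f x ≤ c}) -
        (riemVol n).real (B ∪ {x | f x ≤ d})| := by
    intro A B c d hcd hA hB
    set X := A ∪ {x | f x ≤ c}
    set Y := B ∪ {x | f x ≤ d}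
    have h1 : (riemVol n).real (X \ Y) ≤ (riemVol n).real (A ∆ B) := by
      refine measureReal_mono ?_
      rintro x ⟨hx | hx, hxY⟩
      · exact Or.inl ⟨hx, fun h => hxY (Or.inl h)⟩
      · exact (hxY (Or.inr (le_trans hx hcd))).elim
    have h2 := measureReal_inter_add_sdiff (μ := (riemVol n : Measure M)) (s := X) hB
    have h3 := measureReal_inter_add_sdiff (μ := (riemVol n : Measure M)) (s := Y) hA
    have h4 : (riemVol n).real (X ∆ Y) ≤ (riemVol n).real (X \ Y) + (riemVol n).real (Y \ X) :=
      measureReal_union_le _ _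
    rw [inter_comm] at h3
    have h5 := neg_abs_le ((riemVol n).real X - (riemVol n).real Y)
    linarith
  rcases le_total c d with h | h
  · exact key A B c d h hA hB
  · rw [symmDiff_comm, symmDiff_comm A, abs_sub_comm]
    exact key B A d c h hB hA

/-- The Lipschitz estimate behind the continuity of the retraction. If `A` and `B` are close, it
holds because sublevel sets are nested; if `A` is close to the complement of `B`, both volumes are
close to half the volume of `M`, and almost nothing is added to `A` and to `B`. -/
lemma volDist_union_sublevel_le (f : M → ℝ) {A B : Set M} {c d H t s : ℝ}
    (hH : (riemVol n).real (univ : Set M) = 2 * H) (hA : MeasurableSet A) (hB : MeasurableSet B)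
    (hAH : (riemVol n).real A ≤ H) (hBH : (riemVol n).real B ≤ H)
    (hA' : MeasurableSet (A ∪ {x | f x ≤ c})) (hB' : MeasurableSet (B ∪ {x | f x ≤ d}))
    (ht : t ∈ Icc (0 : ℝ) 1) (hs : s ∈ Icc (0 : ℝ) 1)
    (hvA : (riemVol n).real (A ∪ {x | f x ≤ c}) =
      (riemVol n).real A + t * (H - (riemVol n).real A))
    (hvB : (riemVol n).real (B ∪ {x | f x ≤ d}) =
      (riemVol n).real B + s * (H - (riemVol n).real B)) :
    volDist n (A ∪ {x | f x ≤ c}) (B ∪ {x | f x ≤ d}) ≤ 3 * volDist n A B + H * |t - s| := by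
  have hH0 : 0 ≤ H := measureReal_nonneg.trans hAH
  have hts : 0 ≤ H * |t - s| := by positivity
  -- Either `A` and `B` or `A` and the complement of `B` are close.
  rcases min_choice ((riemVol n).real (A ∆ B)) ((riemVol n).real (A ∆ B)ᶜ) with h | h
  · have h1 := measureReal_symmDiff_union_sublevel_le (n := n) f hA' hB'
    have h2 : |(riemVol n).real A - (riemVol n).real B| ≤ (riemVol n).real (A ∆ B) :=
      abs_measureReal_sub_le_measureReal_symmDiff hA.nullMeasurableSet hB.nullMeasurableSet
    have h3 : |(riemVol n).real (A ∪ {x | f x ≤ c}) - (riemVol n).real (B ∪ {x | f x ≤ d})| ≤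
        (riemVol n).real (A ∆ B) + H * |t - s| := by
      rw [hvA, hvB, show (riemVol n).real A + t * (H - (riemVol n).real A) -
        ((riemVol n).real B + s * (H - (riemVol n).real B)) =
        (1 - t) * ((riemVol n).real A - (riemVol n).real B) +
          (t - s) * (H - (riemVol n).real B) by ring]
      refine (abs_add_le _ _).trans (add_le_add ?_ ?_)
      · rw [abs_mul, abs_of_nonneg (by linarith [ht.2] : 0 ≤ 1 - t)]
        exact (mul_le_of_le_one_left (abs_nonneg _) (by linarith [ht.1])).trans h2
      · rw [abs_mul, mul_comm, abs_of_nonneg (by linarith : 0 ≤ H - (riemVol n).real B)]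
        exact mul_le_mul_of_nonneg_right
          (by linarith [measureReal_nonneg (μ := riemVol n) (s := B)]) (abs_nonneg _)
    refine (min_le_left _ _).trans (h1.trans ?_)
    rw [volDist, h]
    linarith
  · have h1 : (riemVol n).real (A ∆ B) + (riemVol n).real (A ∆ B)ᶜ = 2 * H := by
      rw [measureReal_add_measureReal_compl (hA.symmDiff hB), hH]
    have h2 : (riemVol n).real (A ∆ B) ≤ (riemVol n).real A + (riemVol n).real B :=
      (measureReal_mono (symmDiff_subset_union)).trans (measureReal_union_le _ _)
    have hd : volDist n A B = (riemVol n).real (A ∆ B)ᶜ := h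
    have h3 : volDist n (A ∪ {x | f x ≤ c}) A ≤ volDist n A B := by
      rw [volDist_comm]
      refine (min_le_left _ _).trans ?_
      rw [measureReal_symmDiff_of_subset hA subset_union_left, hvA, add_sub_cancel_left]
      exact (mul_le_of_le_one_left (by linarith) ht.2).trans (by linarith)
    have h4 : volDist n B (B ∪ {x | f x ≤ d}) ≤ volDist n A B := by
      refine (min_le_left _ _).trans ?_
      rw [measureReal_symmDiff_of_subset hB subset_union_left, hvB, add_sub_cancel_left]
      exact (mul_le_of_le_one_left (by linarith) hs.2).trans (by linarith)
    have h5 := volDist_triangle (n := n) (A ∪ {x | f x ≤ c}) A (B ∪ {x | f x ≤ d})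
    have h6 := volDist_triangle (n := n) A B (B ∪ {x | f x ≤ d})
    linarith

variable (n M) in
/-- Half the volume of the manifold, as a real number. -/
def halfVolReal : ℝ := (riemVol n).real (univ : Set M) / 2

lemma toReal_halfVol : (halfVol n M).toReal = halfVolReal n M := by
  rw [halfVol, halfVolReal, ENNReal.toReal_div, ENNReal.toReal_ofNat]
  rfl

lemma halfVol_ne_top : halfVol n M ≠ ⊤ := ENNReal.div_ne_top (measure_ne_top _ _) two_ne_zero

lemma CaccioppoliSet.vol_le_halfVol_iff (Ω : CaccioppoliSet n M) :
    Ω.vol ≤ halfVol n M ↔ (riemVol n).real Ω.carrier ≤ halfVolReal n M := by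
  rw [← toReal_halfVol, Measure.real, ENNReal.toReal_le_toReal (measure_ne_top _ _) halfVol_ne_top]
  rfl

lemma CaccioppoliSet.vol_eq_halfVol_iff (Ω : CaccioppoliSet n M) :
    Ω.vol = halfVol n M ↔ (riemVol n).real Ω.carrier = halfVolReal n M := by
  rw [← toReal_halfVol, Measure.real, ENNReal.toReal_eq_toReal_iff' (measure_ne_top _ _)
    halfVol_ne_top]
  rfl

/-- `Ω'` arises from `Ω` by adding the sublevel set of `f` which covers the fraction `t` of the
volume that `Ω` lacks to half the volume of the manifold. -/
def IsSublevelExtension (f : M → ℝ) (Ω : CaccioppoliSet n M) (t : unitInterval)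
    (Ω' : CaccioppoliSet n M) : Prop :=
  (∃ c : ℝ, Ω'.carrier = Ω.carrier ∪ {x | f x ≤ c}) ∧ (riemVol n).real Ω'.carrier =
    (riemVol n).real Ω.carrier + t * (halfVolReal n M - (riemVol n).real Ω.carrier)

lemma IsMorse.exists_isSublevelExtension [Nonempty M] {f : M → ℝ} (hf : IsMorse n f)
    {Ω : CaccioppoliSet n M} (hΩ : (riemVol n).real Ω.carrier ≤ halfVolReal n M)
    (t : unitInterval) : ∃ Ω', IsSublevelExtension f Ω t Ω' := by
  have h1 : t * (halfVolReal n M - (riemVol n).real Ω.carrier) ≤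
      halfVolReal n M - (riemVol n).real Ω.carrier :=
    mul_le_of_le_one_left (by linarith) t.2.2
  have h2 : 0 ≤ t * (halfVolReal n M - (riemVol n).real Ω.carrier) :=
    mul_nonneg t.2.1 (by linarith)
  have h3 : halfVolReal n M ≤ (riemVol n).real (univ : Set M) := by
    rw [halfVolReal]
    linarith [measureReal_nonneg (μ := riemVol n) (s := (univ : Set M))]
  obtain ⟨c, hc⟩ := hf.exists_volume_union_sublevel_eq Ω.measurableSet (le_add_of_nonneg_right h2)
    (by linarith)
  refine ⟨⟨Ω.carrier ∪ {x | f x ≤ c},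
    Ω.measurableSet.union (hf.1.continuous.measurable measurableSet_Iic), ?_⟩, ⟨c, rfl⟩, hc⟩
  refine (perimeter_union_sublevel_le hf.1 Ω.measurableSet c univ).trans_lt
    (ENNReal.add_lt_top.2 ⟨Ω.perimeter_lt_top, ?_⟩)
  simpa only [inter_univ] using! hf.maxLevelArea_lt_top

lemma IsSublevelExtension.subset {f : M → ℝ} {Ω Ω' : CaccioppoliSet n M} {t : unitInterval}
    (h : IsSublevelExtension f Ω t Ω') : Ω.carrier ⊆ Ω'.carrier := by
  obtain ⟨⟨c, hc⟩, -⟩ := h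
  rw [hc]
  exact subset_union_left

variable [ConnectedSpace M]

lemma IsSublevelExtension.bdist_le {f : M → ℝ} {Ω Ω' Θ Θ' : CaccioppoliSet n M}
    {t s : unitInterval} (h : IsSublevelExtension f Ω t Ω') (h' : IsSublevelExtension f Θ s Θ')
    (hΩ : (riemVol n).real Ω.carrier ≤ halfVolReal n M)
    (hΘ : (riemVol n).real Θ.carrier ≤ halfVolReal n M) :
    BoundaryCycle.bdist Ω'.boundary Θ'.boundary ≤
      3 * BoundaryCycle.bdist Ω.boundary Θ.boundary + halfVolReal n M * |(t : ℝ) - s| := by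
  obtain ⟨⟨c, hc⟩, hv⟩ := h
  obtain ⟨⟨d, hd⟩, hv'⟩ := h'
  have hm := Ω'.measurableSet
  have hm' := Θ'.measurableSet
  rw [BoundaryCycle.bdist_boundary, BoundaryCycle.bdist_boundary, hc, hd]
  rw [hc] at hv hm
  rw [hd] at hv' hm'
  exact volDist_union_sublevel_le f (by rw [halfVolReal]; ring) Ω.measurableSet Θ.measurableSet
    hΩ hΘ hm hm' t.2 s.2 hv hv'

lemma IsSublevelExtension.boundary_eq {f : M → ℝ} {Ω Ω' : CaccioppoliSet n M} {t : unitInterval}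
    (h : IsSublevelExtension f Ω t Ω')
    (hv : (riemVol n).real Ω'.carrier = (riemVol n).real Ω.carrier) :
    Ω'.boundary = Ω.boundary := by
  rw [CaccioppoliSet.boundary_eq_iff, volDist_comm]
  refine le_antisymm ((min_le_left _ _).trans_eq ?_) (volDist_nonneg _ _)
  rw [measureReal_symmDiff_of_subset Ω.measurableSet h.subset, hv, sub_self]

lemma IsSublevelExtension.areaIn_le {f : M → ℝ} (hf : IsMorse n f) {Ω Ω' : CaccioppoliSet n M}
    {t : unitInterval} (h : IsSublevelExtension f Ω t Ω') (U : Set M) :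
    Ω'.boundary.areaIn U ≤
      Ω.boundary.areaIn U + ⨆ s : ℝ, (μHE[n] : Measure M) (f ⁻¹' {s} ∩ U) := by
  obtain ⟨⟨c, hc⟩, -⟩ := h
  rw [CaccioppoliSet.areaIn_boundary, CaccioppoliSet.areaIn_boundary, hc]
  exact perimeter_union_sublevel_le hf.1 Ω.measurableSet c U

/-- A set or its complement has at most half the volume. -/
lemma BoundaryCycle.exists_boundary_eq_volume_le (T : BoundaryCycle n M) :
    ∃ Ω : CaccioppoliSet n M, Ω.boundary = T ∧
      (riemVol n).real Ω.carrier ≤ halfVolReal n M := by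
  obtain ⟨Ω, rfl⟩ := T.exists_boundary_eq
  have h1 := measureReal_add_measureReal_compl (μ := riemVol n) Ω.measurableSet
  rcases le_total ((riemVol n).real Ω.carrier) (halfVolReal n M) with h | h
  · exact ⟨Ω, rfl, h⟩
  · refine ⟨Ω.compl, Ω.boundary_compl, ?_⟩
    change (riemVol n).real Ω.carrierᶜ ≤ _
    rw [halfVolReal] at h ⊢
    linarith

/-- Any Morse function gives a deformation retraction onto the half-volume cycles. -/
theorem IsMorse.exists_isHalfVolumeRetraction {f : M → ℝ} (hf : IsMorse n f) :
    ∃ θ : C(BoundaryCycle n M × unitInterval, BoundaryCycle n M), IsHalfVolumeRetraction f θ ∧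
      ∀ (T : BoundaryCycle n M) (t : unitInterval) (U : Set M), (θ (T, t)).areaIn U ≤
        T.areaIn U + ⨆ s : ℝ, (μHE[n] : Measure M) (f ⁻¹' {s} ∩ U) := by
  have hex : ∀ q : BoundaryCycle n M × unitInterval, ∃ Ω Ω' : CaccioppoliSet n M,
      Ω.boundary = q.1 ∧ (riemVol n).real Ω.carrier ≤ halfVolReal n M ∧
        IsSublevelExtension f Ω q.2 Ω' := fun q => by
    obtain ⟨Ω, h1, h2⟩ := q.1.exists_boundary_eq_volume_le
    obtain ⟨Ω', h3⟩ := hf.exists_isSublevelExtension h2 q.2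
    exact ⟨Ω, Ω', h1, h2, h3⟩
  -- For each `T` a set `F` of at most half the volume with boundary `T`, and an extension `G` of
  -- it.
  choose F G hF hFv hG using hex
  have hlip : ∀ q r : BoundaryCycle n M × unitInterval,
      BoundaryCycle.bdist (G q).boundary (G r).boundary ≤
        3 * BoundaryCycle.bdist q.1 r.1 + halfVolReal n M * |(q.2 : ℝ) - r.2| := fun q r => by
    have h1 := (hG q).bdist_le (hG r) (hFv q) (hFv r)
    rwa [hF, hF] at h1
  have hH : 0 ≤ halfVolReal n M := div_nonneg measureReal_nonneg zero_le_two
  -- By the Lipschitz estimate, the choices of representatives and of levels do not matter, and the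
  -- map is continuous.
  have hcont : Continuous fun q => (G q).boundary := by
    refine continuous_iff_continuousAt.2 fun q V hV => ?_
    obtain ⟨δ, hδ, h⟩ := BoundaryCycle.mem_nhds_iff.1 hV
    have h1 : {S | BoundaryCycle.bdist q.1 S < δ / 6} ∈ 𝓝 q.1 :=
      BoundaryCycle.mem_nhds_iff.2 ⟨δ / 6, by positivity, fun S hS => hS⟩
    have h2 : {s : unitInterval | halfVolReal n M * |(q.2 : ℝ) - s| < δ / 2} ∈ 𝓝 q.2 := by
      refine (isOpen_lt (by fun_prop) continuous_const).mem_nhds ?_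
      rw [mem_ofPred_eq, sub_self, abs_zero, mul_zero]
      positivity
    change ∀ᶠ r in 𝓝 q, (G r).boundary ∈ V
    filter_upwards [prod_mem_nhds h1 h2] with r hr
    refine h _ ((hlip q r).trans_lt ?_)
    have h3 : BoundaryCycle.bdist q.1 r.1 < δ / 6 := hr.1
    have h4 : halfVolReal n M * |(q.2 : ℝ) - r.2| < δ / 2 := hr.2
    linarith
  have huniq : ∀ (Ω Ω' : CaccioppoliSet n M) (t : unitInterval),
      (riemVol n).real Ω.carrier ≤ halfVolReal n M → IsSublevelExtension f Ω t Ω' →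
      (G (Ω.boundary, t)).boundary = Ω'.boundary := fun Ω Ω' t hΩ h => by
    refine BoundaryCycle.eq_of_bdist_eq_zero (le_antisymm ?_ (volDist_nonneg _ _))
    refine ((hG (Ω.boundary, t)).bdist_le h (hFv _) hΩ).trans_eq ?_
    rw [hF, BoundaryCycle.bdist_self, sub_self, abs_zero, mul_zero, mul_zero, add_zero]
  refine ⟨⟨_, hcont⟩, ⟨fun T => ?_, fun T => ?_, ?_, fun Ω hΩ t => ?_⟩, fun T t U => ?_⟩
  · have h1 := hG (T, 0)
    refine (h1.boundary_eq ?_).trans (hF (T, 0))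
    rw [h1.2, Icc.coe_zero, zero_mul, add_zero]
  · refine ⟨G (T, 1), ?_, rfl⟩
    rw [CaccioppoliSet.vol_eq_halfVol_iff, (hG (T, 1)).2, Icc.coe_one, one_mul,
      add_sub_cancel]
  · rintro T ⟨Ω, hΩ, rfl⟩ t
    rw [CaccioppoliSet.vol_eq_halfVol_iff] at hΩ
    obtain ⟨Ω', h⟩ := hf.exists_isSublevelExtension hΩ.le t
    refine (huniq Ω Ω' t hΩ.le h).trans (h.boundary_eq ?_)
    rw [h.2, hΩ, sub_self, mul_zero, add_zero]
  · have hΩ' := Ω.vol_le_halfVol_iff.1 hΩ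
    obtain ⟨Ω', h⟩ := hf.exists_isSublevelExtension hΩ' t
    obtain ⟨c, hc⟩ := h.1
    refine ⟨c, Ω', hc, ?_, huniq Ω Ω' t hΩ' h⟩
    have hv : Ω.vol ≠ ⊤ := measure_ne_top _ _
    have hv' : Ω'.vol ≠ ⊤ := measure_ne_top _ _
    have hfin : ENNReal.ofReal t * (halfVol n M - Ω.vol) ≠ ⊤ :=
      ENNReal.mul_ne_top ENNReal.ofReal_ne_top (ENNReal.sub_ne_top halfVol_ne_top)
    rw [← ENNReal.toReal_eq_toReal_iff' hv' (ENNReal.add_ne_top.2 ⟨hv, hfin⟩),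
      ENNReal.toReal_add hv hfin, ENNReal.toReal_mul, ENNReal.toReal_ofReal t.2.1,
      ENNReal.toReal_sub_of_le hΩ halfVol_ne_top, toReal_halfVol]
    exact h.2
  · refine ((hG (T, t)).areaIn_le hf U).trans_eq ?_
    rw [hF]

end SublevelRetraction

/-! ### Half-volume sweepouts and widths -/

section Widths

variable {n : ℕ} {M : Type*} [MetricSpace M]
    [ChartedSpace (EuclideanSpace ℝ (Fin (n + 1))) M] [IsManifold (𝓡 (n + 1)) ∞ M]
    [RiemannianBundle (fun x : M => TangentSpace (𝓡 (n + 1)) x)]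
    [IsContMDiffRiemannianBundle (𝓡 (n + 1)) ∞ (EuclideanSpace ℝ (Fin (n + 1)))
      (fun x : M => TangentSpace (𝓡 (n + 1)) x)]
    [IsRiemannianManifold (𝓡 (n + 1)) M] [MeasurableSpace M] [BorelSpace M]
    [SecondCountableTopology M] [CompactSpace M] [ConnectedSpace M]

local notation "𝔼" => EuclideanSpace ℝ (Fin (n + 1))
local notation "𝕀" => 𝓡 (n + 1)

/-- The final map of a half-volume retraction, as a map to the half-volume cycles. -/
def IsHalfVolumeRetraction.retract {f : M → ℝ}
    {θ : C(BoundaryCycle n M × unitInterval, BoundaryCycle n M)}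
    (h : IsHalfVolumeRetraction f θ) : C(BoundaryCycle n M, halfVolumeCycles n M) where
  toFun T := ⟨θ (T, 1), h.map_one_mem T⟩
  continuous_toFun := by fun_prop

lemma IsHalfVolumeRetraction.isPSweepout {f : M → ℝ}
    {θ : C(BoundaryCycle n M × unitInterval, BoundaryCycle n M)}
    (h : IsHalfVolumeRetraction f θ) {p : ℕ} {X : Type*} [TopologicalSpace X]
    {Φ : C(X, BoundaryCycle n M)} (hΦ : IsPSweepout p Φ) :
    IsPSweepout p (h.retract.comp Φ) := by
  refine hΦ.comp_retraction ⟨Subtype.val, continuous_subtype_val⟩ h.retract ?_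
    ⟨ContinuousMap.Homotopy.symm ⟨⟨fun q => θ (q.2, q.1), by fun_prop⟩, fun T => ?_, fun T => rfl⟩⟩
  · ext T
    exact h.map_of_mem _ T.2 1
  · exact h.map_zero T

lemma NoConcentrationOfMass.exists_ball_areaIn_le {X : Type*} {Φ : X → BoundaryCycle n M}
    (h : NoConcentrationOfMass Φ) {ε : ℝ≥0∞} (hε : 0 < ε) :
    ∃ ρ : ℝ, 0 < ρ ∧ ∀ x q, (Φ x).areaIn (Metric.ball q ρ) ≤ ε := by
  obtain ⟨ρ, h1, h2⟩ := ((h.eventually (ge_mem_nhds hε)).and self_mem_nhdsWithin).exists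
  exact ⟨ρ, h2, fun x q => (le_iSup₂_of_le q x le_rfl).trans h1⟩

/-- On a curve, a family without concentration of mass consists of zero cycles, so it is
constant. -/
lemma NoConcentrationOfMass.ne_zero_of_isPSweepout {p : ℕ} (hp : 1 ≤ p) {X : Type*}
    [TopologicalSpace X] {Φ : C(X, BoundaryCycle n M)} (hΦ : IsPSweepout p Φ)
    (h : NoConcentrationOfMass Φ) : n ≠ 0 := by
  rintro rfl
  have key : ∀ Ω : CaccioppoliSet 0 M, ∀ x, Ω.boundary = Φ x →
      perimeter 0 Ω.carrier univ = 0 := fun Ω x hx => by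
    refine perimeter_eq_zero_of_dim_one Ω.measurableSet fun ε hε => ?_
    obtain ⟨ρ, hρ, h1⟩ := h.exists_ball_areaIn_le hε
    refine ⟨ρ, hρ, fun q => ?_⟩
    have h2 := h1 x q
    rwa [← hx, CaccioppoliSet.areaIn_boundary] at h2
  -- All sets are null or conull, so that all boundaries vanish.
  refine not_isPSweepout_of_constant hp (fun x y => ?_) hΦ
  obtain ⟨Ω, hΩ⟩ := (Φ x).exists_boundary_eq
  obtain ⟨Θ, hΘ⟩ := (Φ y).exists_boundary_eq
  have h1 := (perimeter_eq_zero_iff Ω.measurableSet).1 (key Ω x hΩ)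
  have h2 := (perimeter_eq_zero_iff Θ.measurableSet).1 (key Θ y hΘ)
  have key2 : ∀ Ω : CaccioppoliSet 0 M, riemVol 0 Ω.carrier = 0 ∨ riemVol 0 Ω.carrierᶜ = 0 →
      ∃ Ω' : CaccioppoliSet 0 M, Ω'.boundary = Ω.boundary ∧ riemVol 0 Ω'.carrier = 0 :=
    fun Ω h => h.elim (fun h => ⟨Ω, rfl, h⟩) fun h => ⟨Ω.compl, Ω.boundary_compl, h⟩
  obtain ⟨Ω', h3, h4⟩ := key2 Ω h1
  obtain ⟨Θ', h5, h6⟩ := key2 Θ h2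
  rw [← hΩ, ← hΘ, ← h3, ← h5, CaccioppoliSet.boundary_eq_iff]
  refine le_antisymm ((min_le_left _ _).trans_eq ?_) (volDist_nonneg _ _)
  rw [measureReal_eq_zero_iff]
  exact measure_mono_null symmDiff_subset_union (measure_union_null h4 h6)

/-- Composing a sweepout without concentration of mass with a half-volume retraction whose local
areas are controlled gives a half-volume sweepout without concentration of mass. -/
lemma IsHalfVolumeRetraction.isAdmissible {f : M → ℝ} (hf : IsMorse n f)
    {θ : C(BoundaryCycle n M × unitInterval, BoundaryCycle n M)} (h : IsHalfVolumeRetraction f θ)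
    (hθ : ∀ (T : BoundaryCycle n M) (t : unitInterval) (U : Set M), (θ (T, t)).areaIn U ≤
      T.areaIn U + ⨆ s : ℝ, (μHE[n] : Measure M) (f ⁻¹' {s} ∩ U))
    {p : ℕ} (hp : 1 ≤ p) {X : Type*} [TopologicalSpace X] {Φ : C(X, BoundaryCycle n M)}
    (hΦ : IsAdmissibleSweepout p Φ) : IsAdmissibleHalfVolumeSweepout p (h.retract.comp Φ) := by
  refine ⟨h.isPSweepout hΦ.1, ?_⟩
  have hn := hΦ.2.ne_zero_of_isPSweepout hp hΦ.1
  have h1 := hΦ.2.add (hf.tendsto_measure_level hn)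
  rw [add_zero] at h1
  refine tendsto_of_tendsto_of_tendsto_of_le_of_le tendsto_const_nhds h1 (fun _ => zero_le)
    fun r => iSup₂_le fun q x => (hθ (Φ x) 1 (Metric.ball q r)).trans ?_
  exact add_le_add (le_iSup₂_of_le q x le_rfl) (le_iSup_of_le q le_rfl)

/-- The width bound that any half-volume retraction with controlled areas gives. -/
lemma halfVolumePWidth_le {K : ℝ≥0∞} {p : ℕ}
    (H : ∀ (m : ℕ) (X : Set (Fin m → ℝ)), IsCubicalComplex X →
      ∀ Φ : C(X, BoundaryCycle n M), IsAdmissibleSweepout p Φ →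
        ∃ Ψ : C(X, halfVolumeCycles n M), IsAdmissibleHalfVolumeSweepout p Ψ ∧
          ⨆ x, (Ψ x : BoundaryCycle n M).area ≤ (⨆ x, (Φ x).area) + K) :
    halfVolumePWidth n M p ≤ pWidth n M p + K := by
  refine tsub_le_iff_right.1 (le_iInf fun m => le_iInf fun X => le_iInf fun hX => le_iInf fun Φ =>
    le_iInf fun hΦ => tsub_le_iff_right.2 ?_)
  obtain ⟨Ψ, hΨ, h⟩ := H m X hX Φ hΦ
  refine le_trans ?_ h
  rw [halfVolumePWidth]
  refine iInf_le_of_le m ?_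
  refine iInf_le_of_le X ?_
  refine iInf_le_of_le hX ?_
  exact iInf_le_of_le Ψ (iInf_le_of_le hΨ le_rfl)

/-- The second part of the theorem for one Morse function. -/
theorem IsMorse.exists_isHalfVolumeRetraction_sweepout {f : M → ℝ} (hf : IsMorse n f) :
    ∃ θ : C(BoundaryCycle n M × unitInterval, BoundaryCycle n M),
      IsHalfVolumeRetraction f θ ∧
      (∀ T t, (θ (T, t)).area ≤ T.area + maxLevelArea n f) ∧
      ∀ p : ℕ, 1 ≤ p → ∀ (m : ℕ) (X : Set (Fin m → ℝ)), IsCubicalComplex X →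
        ∀ Φ : C(X, BoundaryCycle n M), IsAdmissibleSweepout p Φ →
          ∃ Ψ : C(X, halfVolumeCycles n M), (∀ x, (Ψ x : BoundaryCycle n M) = θ (Φ x, 1)) ∧
            IsAdmissibleHalfVolumeSweepout p Ψ ∧
            ⨆ x, (Ψ x : BoundaryCycle n M).area ≤ (⨆ x, (Φ x).area) + maxLevelArea n f := by
  obtain ⟨θ, h, hθ⟩ := hf.exists_isHalfVolumeRetraction
  have harea : ∀ T t, (θ (T, t)).area ≤ T.area + maxLevelArea n f := fun T t => by
    simpa only [inter_univ] using! hθ T t univ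
  refine ⟨θ, h, harea, fun p hp m X _ Φ hΦ =>
    ⟨h.retract.comp Φ, fun x => rfl, h.isAdmissible hf hθ hp hΦ, iSup_le fun x => ?_⟩⟩
  exact (harea (Φ x) 1).trans (add_le_add (le_iSup (fun x => (Φ x).area) x) le_rfl)

lemma IsMorse.halfVolumePWidth_le {f : M → ℝ} (hf : IsMorse n f) {p : ℕ} (hp : 1 ≤ p) :
    halfVolumePWidth n M p ≤ pWidth n M p + maxLevelArea n f := by
  obtain ⟨θ, -, -, h⟩ := hf.exists_isHalfVolumeRetraction_sweepout
  refine _root_.halfVolumePWidth_le fun m X hX Φ hΦ => ?_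
  obtain ⟨Ψ, -, h1, h2⟩ := h p hp m X hX Φ hΦ
  exact ⟨Ψ, h1, h2⟩

end Widths

end

theorem mainTheorem6 (n : ℕ) {M : Type*} [MetricSpace M] [MeasurableSpace M] [BorelSpace M]
    [ChartedSpace (EuclideanSpace ℝ (Fin (n + 1))) M] [IsManifold (𝓡 (n + 1)) ∞ M]
    [RiemannianBundle (fun x : M => TangentSpace (𝓡 (n + 1)) x)]
    [IsContMDiffRiemannianBundle (𝓡 (n + 1)) ∞ (EuclideanSpace ℝ (Fin (n + 1)))
      (fun x : M => TangentSpace (𝓡 (n + 1)) x)]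
    [IsRiemannianManifold (𝓡 (n + 1)) M] [CompactSpace M] [ConnectedSpace M] :
    (∃ K : ℝ≥0, ∀ p : ℕ, 1 ≤ p → halfVolumePWidth n M p ≤ pWidth n M p + K + 1) ∧
    (∃ f : M → ℝ, IsMorse n f) ∧
    ∀ f : M → ℝ, IsMorse n f →
      maxLevelArea n f < ⊤ ∧
      (∀ p : ℕ, 1 ≤ p → halfVolumePWidth n M p ≤ pWidth n M p + maxLevelArea n f + 1) ∧
      ∃ θ : C(BoundaryCycle n M × unitInterval, BoundaryCycle n M),
        IsHalfVolumeRetraction f θ ∧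
        (∀ T t, (θ (T, t)).area ≤ T.area + maxLevelArea n f) ∧
        ∀ p : ℕ, 1 ≤ p → ∀ (m : ℕ) (X : Set (Fin m → ℝ)), IsCubicalComplex X →
          ∀ Φ : C(X, BoundaryCycle n M), IsAdmissibleSweepout p Φ →
            ∃ Ψ : C(X, halfVolumeCycles n M), (∀ x, (Ψ x : BoundaryCycle n M) = θ (Φ x, 1)) ∧
              IsAdmissibleHalfVolumeSweepout p Ψ ∧
              ⨆ x, (Ψ x : BoundaryCycle n M).area ≤ (⨆ x, (Φ x).area) + maxLevelArea n f := by
  have : SecondCountableTopology M := inferInstance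
  obtain ⟨f₀, hf₀⟩ := exists_isMorse (n := n) (M := M)
  refine ⟨⟨(maxLevelArea n f₀).toNNReal, fun p hp => ?_⟩, ⟨f₀, hf₀⟩, fun f hf =>
    ⟨hf.maxLevelArea_lt_top, fun p hp => ?_, hf.exists_isHalfVolumeRetraction_sweepout⟩⟩
  · rw [ENNReal.coe_toNNReal hf₀.maxLevelArea_lt_top.ne]
    exact (hf₀.halfVolumePWidth_le hp).trans le_self_add
  · exact (hf.halfVolumePWidth_le hp).trans le_self_add
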